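/- Let $\Gamma=\mathrm{SL}_2(\mathbb Z)$, $T=\left(\begin{smallmatrix}1&1\\0&1\end{smallmatrix}\right)$, $B=\{\pm T^n: n\in\mathbb Z\}$, let $\mathfrak H$ be the upper half-plane with $z=x+iy$, $q=e^{2\pi i z}$, and $j(\gamma,w)=cw+d$ for $\gamma=\left(\begin{smallmatrix}*&*\\c&d\end{smallmatrix}\right)\in\Gamma$. For $r,s\in\mathbb Z$ let $\mathcal M_{r,s}$ be the space of real-analytic $f:\mathfrak H\to\mathbb C$ such that: (i) $f(z)=O(y^C)$ as $y\to\infty$, uniformly in $x$, for some $C>0$; (ii) $f(\gamma z)=j(\gamma,z)^r j(\gamma,\bar z)^s f(z)$ for all $\gamma\in\Gamma$, $z\in\mathfrak H$; (iii) $f(z)=\sum_{|j|\le N}y^j\sum_{m,n\ge0}a^{(j)}_{m,n}q^m\bar q^n$ for some $N\in\mathbb N$ and $a^{(j)}_{m,n}\in\mathbb C$, each inner double series converging absolutely on $\mathfrak H$. Put $\mathcal M=\bigoplus_{r,s\in\mathbb Z}\mathcal M_{r,s}$. Let $\partial$ and $\bar\partial$ be the bigraded operators which on functions of weights $(r,s)$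 are $$\partial_r=2iy\frac{\partial}{\partial z}+r\ \text{ (with values in weights } (r+1,s-1)),\qquad \bar\partial_s=-2iy\frac{\partial}{\partial\bar z}+s\ \text{ (with values in weights } (r-1,s+1)).$$ Let $S=\bigoplus_n S_n$ be the space of holomorphic cusp forms for $\Gamma$, $\bar S$ the space of their complex conjugates, and $\mathcal E_{r,s}(z)=\sum_{\gamma\in B\backslash\Gamma}j(\gamma,z)^{-r}j(\gamma,\bar z)^{-s}$. The space $\mathcal{MI}'_2$ of extended modular iterated integrals of length $2$ is the largest subspace of $\mathcal M$ satisfying $$\partial\,\mathcal{MI}'_2\subset\mathcal{MI}'_2+\bigoplus_{\substack{j\in\mathbb Z,\ r,s\ge1\\ r+s\ge4\text{ even}}}y^j\mathcal E_{r,s}S,\qquad \bar\partial\,\mathcal{MI}'_2\subset\mathcal{MI}'_2+\bigoplus_{\substack{j\in\mathbb Z,\ r,s\ge1\\ r+s\ge4\text{ even}}}y^j\mathcal E_{r,s}\bar S .$$ For an even integer $k\ge12$ and $f\in S_k$ put $$F_f^+(z,X)=\int_{i\infty}^z f(w)(w-X)^{k-2}\,dw,\qquad F_f^-(z,X)=\overline{\int_{i\infty}^z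 f(w)(w-X)^{k-2}\,dw},$$ where the bar acts trivially on $X$. For integers $r,s$ with $r+s$ even and $r+s>k$ put $$\phi^\pm_{r,s}(f;z,X)=\sum_{\gamma\in B\backslash\Gamma}\frac{F_f^\pm(\gamma z,\gamma X)\,j(\gamma,X)^{k-2}}{j(\gamma,z)^r j(\gamma,\bar z)^s}=\sum_{i=0}^{k-2}\phi^\pm_{r,s}(f;i,z)(X-z)^i(X-\bar z)^{k-2-i}.$$ **Theorem.** The series defining $\phi^\pm_{r,s}(f;z,X)$ converge absolutely (as series of polynomials in $X$, for each $z\in\mathfrak H$). Let $\mathcal A$ be the complex vector space spanned by all the functions $\phi^\pm_{r,s}(f;i,-)$, regarded as having weights $(r+i,\,s+k-2-i)$, for even $k\ge12$, $f\in S_k$, integers $r,s$ with $r+s$ even and $r+s>k$, and $0\le i\le k-2$. Then $\mathcal A\subset\mathcal{MI}'_2$. -/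

import Mathlib

open scoped MatrixGroups UpperHalfPlane ComplexConjugate
open UpperHalfPlane

noncomputable section

namespace ModIter

/-! ### Real-analytic modular forms for `Γ = SL(2, ℤ)` -/

/-- The automorphy factor `j(γ, w) = c w + d`, for an arbitrary complex number `w`
(it is used at `w = z` and at `w = conj z`). -/
def autj (γ : SL(2, ℤ)) (w : ℂ) : ℂ := (γ 1 0 : ℂ) * w + (γ 1 1 : ℂ)

/-- `q = exp (2 π i z)`. -/
def qpar (z : ℍ) : ℂ := Complex.exp (2 * Real.pi * Complex.I * (z : ℂ))

/-- Real-analyticity of a function on the upper half-plane, as a function on an open subset of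
`ℂ = ℝ²`. -/
def IsRealAnalytic (f : ℍ → ℂ) : Prop :=
  AnalyticOnNhd ℝ (fun w : ℂ => f (ofComplex w)) {w : ℂ | 0 < w.im}

/-- `f(z) = O(y ^ C)` as `y → ∞`, uniformly in `x`, for some `C > 0`. -/
def HasModerateGrowth (f : ℍ → ℂ) : Prop :=
  ∃ C : ℝ, 0 < C ∧ f =O[atImInfty] (fun z : ℍ => z.im ^ C)

/-- `f` has an expansion `∑_{|j| ≤ N} y ^ j ∑_{m, n ≥ 0} a_{m,n}^{(j)} q ^ m (conj q) ^ n` for some `N`;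
the finitely many `j` that occur are the support of the finitely supported family `a`, and each
inner double series converges absolutely at every point. -/
def HasFourierExpansion (f : ℍ → ℂ) : Prop :=
  ∃ a : ℤ →₀ (ℕ × ℕ → ℂ),
    (∀ (j : ℤ) (z : ℍ), Summable fun p : ℕ × ℕ => a j p * qpar z ^ p.1 * conj (qpar z) ^ p.2) ∧
    ∀ z : ℍ, f z = a.sum fun j c =>
      (z.im : ℂ) ^ j * ∑' p : ℕ × ℕ, c p * qpar z ^ p.1 * conj (qpar z) ^ p.2

/-- The space `𝓜_{r,s}` of real-analytic modular forms of weights `(r, s)`. -/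
def realAnForms (r s : ℤ) : Submodule ℂ (ℍ → ℂ) where
  carrier := {f | IsRealAnalytic f ∧ HasModerateGrowth f ∧
    (∀ (γ : SL(2, ℤ)) (z : ℍ), f (γ • z) = autj γ z ^ r * autj γ (conj (z : ℂ)) ^ s * f z) ∧
    HasFourierExpansion f}
  zero_mem' := by
    refine ⟨?_, ⟨1, one_pos, Asymptotics.isBigO_zero _ _⟩, by simp, 0, by simp [summable_zero],
      by simp⟩
    exact analyticOnNhd_const
  add_mem' := by
    rintro f g ⟨hf1, ⟨C, hC, hf2⟩, hf3, a, ha, hf4⟩ ⟨hg1, ⟨D, hD, hg2⟩, hg3, b, hb, hg4⟩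
    refine ⟨hf1.add hg1, ⟨max C D, lt_max_of_lt_left hC, ?_⟩, ?_, a + b, ?_, ?_⟩
    · have key : ∀ E : ℝ, E ≤ max C D →
          (fun z : ℍ => z.im ^ E) =O[atImInfty] (fun z : ℍ => z.im ^ (max C D)) := by
        intro E hE
        refine Asymptotics.IsBigO.of_bound 1 ?_
        have h1 : ∀ᶠ z : ℍ in atImInfty, 1 ≤ z.im :=
          Filter.tendsto_comap.eventually (Filter.eventually_ge_atTop (1 : ℝ))
        filter_upwards [h1] with z hz
        rw [one_mul, Real.norm_of_nonneg (by positivity), Real.norm_of_nonneg (by positivity)]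
        exact Real.rpow_le_rpow_of_exponent_le hz hE
      exact (hf2.trans (key C (le_max_left _ _))).add (hg2.trans (key D (le_max_right _ _)))
    · intro γ z
      simp only [Pi.add_apply, hf3 γ z, hg3 γ z]
      ring
    · intro j z
      refine ((ha j z).add (hb j z)).congr fun p => ?_
      simp only [Finsupp.add_apply, Pi.add_apply]
      ring
    · intro z
      have e : ∀ c : ℤ →₀ (ℕ × ℕ → ℂ), (c.sum fun j c =>
          (z.im : ℂ) ^ j * ∑' p : ℕ × ℕ, c p * qpar z ^ p.1 * conj (qpar z) ^ p.2) =
          ∑ j ∈ c.support, (z.im : ℂ) ^ j *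
            ∑' p : ℕ × ℕ, c j p * qpar z ^ p.1 * conj (qpar z) ^ p.2 := fun c => rfl
      have e2 : ∀ (c : ℤ →₀ (ℕ × ℕ → ℂ)) (s : Finset ℤ), c.support ⊆ s →
          (c.sum fun j c =>
          (z.im : ℂ) ^ j * ∑' p : ℕ × ℕ, c p * qpar z ^ p.1 * conj (qpar z) ^ p.2) =
          ∑ j ∈ s, (z.im : ℂ) ^ j *
            ∑' p : ℕ × ℕ, c j p * qpar z ^ p.1 * conj (qpar z) ^ p.2 := by
        intro c s hs
        rw [e]
        refine Finset.sum_subset hs fun j _ hj => ?_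
        rw [Finsupp.notMem_support_iff.1 hj]
        simp
      simp only [Pi.add_apply, hf4 z, hg4 z]
      rw [e2 a (a.support ∪ b.support) Finset.subset_union_left,
        e2 b (a.support ∪ b.support) Finset.subset_union_right,
        e2 (a + b) (a.support ∪ b.support) Finsupp.support_add, ← Finset.sum_add_distrib]
      refine Finset.sum_congr rfl fun j _ => ?_
      rw [← mul_add, ← (ha j z).tsum_add (hb j z)]
      congr 1
      refine tsum_congr fun p => ?_
      simp only [Finsupp.add_apply, Pi.add_apply]
      ring
  smul_mem' := by
    rintro c f ⟨hf1, ⟨C, hC, hf2⟩, hf3, a, ha, hf4⟩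
    refine ⟨analyticOnNhd_const.mul hf1, ⟨C, hC, hf2.const_mul_left c⟩, ?_, c • a, ?_, ?_⟩
    · intro γ z
      simp only [Pi.smul_apply, smul_eq_mul, hf3 γ z]
      ring
    · intro j z
      refine ((ha j z).mul_left c).congr fun p => ?_
      simp only [Finsupp.smul_apply, Pi.smul_apply, smul_eq_mul]
      ring
    · intro z
      simp only [Pi.smul_apply, smul_eq_mul, hf4 z]
      rw [Finsupp.sum_smul_index' (by simp), Finsupp.mul_sum]
      refine Finsupp.sum_congr fun j _ => ?_
      rw [mul_left_comm, ← tsum_mul_left]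
      congr 1
      refine tsum_congr fun p => ?_
      simp only [Pi.smul_apply, smul_eq_mul]
      ring

/-- Bigraded families of functions: finitely supported families indexed by weights `(r, s) ∈ ℤ²`. -/
abbrev GradedFun : Type := (ℤ × ℤ) →₀ (ℍ → ℂ)

/-- `𝓜 = ⨁_{r,s ∈ ℤ} 𝓜_{r,s}`, as the space of finitely supported families whose component of index
`(r, s)` lies in `𝓜_{r,s}`. -/
def gradedM : Submodule ℂ GradedFun where
  carrier := {F | ∀ p : ℤ × ℤ, F p ∈ realAnForms p.1 p.2}
  zero_mem' := fun _ => Submodule.zero_mem _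
  add_mem' := fun hF hG p => Submodule.add_mem _ (hF p) (hG p)
  smul_mem' := fun c _ hF p => Submodule.smul_mem _ c (hF p)

/-! ### The operators `∂` and `∂̄` -/

/-- `∂/∂z = (∂/∂x - i ∂/∂y) / 2`. -/
def dz (f : ℍ → ℂ) (z : ℍ) : ℂ :=
  (fderiv ℝ (fun w : ℂ => f (ofComplex w)) z 1
    - Complex.I * fderiv ℝ (fun w : ℂ => f (ofComplex w)) z Complex.I) / 2

/-- `∂/∂z̄ = (∂/∂x + i ∂/∂y) / 2`. -/
def dzbar (f : ℍ → ℂ) (z : ℍ) : ℂ :=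
  (fderiv ℝ (fun w : ℂ => f (ofComplex w)) z 1
    + Complex.I * fderiv ℝ (fun w : ℂ => f (ofComplex w)) z Complex.I) / 2

/-- `∂_r = 2 i y ∂/∂z + r`. -/
def maass (r : ℤ) (f : ℍ → ℂ) : ℍ → ℂ := fun z =>
  2 * Complex.I * (z.im : ℂ) * dz f z + (r : ℂ) * f z

/-- `∂̄_s = -2 i y ∂/∂z̄ + s`. -/
def maassBar (s : ℤ) (f : ℍ → ℂ) : ℍ → ℂ := fun z =>
  -2 * Complex.I * (z.im : ℂ) * dzbar f z + (s : ℂ) * f z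

/-- The bigraded operator `∂`, equal to `∂_r` from index `(r, s)` to index `(r + 1, s - 1)`. -/
def del (F : GradedFun) : GradedFun :=
  F.sum fun p f => Finsupp.single (p.1 + 1, p.2 - 1) (maass p.1 f)

/-- The bigraded operator `∂̄`, equal to `∂̄_s` from index `(r, s)` to index `(r - 1, s + 1)`. -/
def delBar (F : GradedFun) : GradedFun :=
  F.sum fun p f => Finsupp.single (p.1 - 1, p.2 + 1) (maassBar p.2 f)

/-! ### Eisenstein series and the space of extended modular iterated integrals of length two -/

/-- `B = {± T ^ n : n ∈ ℤ}`. -/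
def subgroupB : Subgroup SL(2, ℤ) where
  carrier := {γ | ∃ n : ℤ, γ = ModularGroup.T ^ n ∨ γ = -ModularGroup.T ^ n}
  one_mem' := ⟨0, by simp⟩
  mul_mem' := by
    rintro _ _ ⟨n, rfl | rfl⟩ ⟨m, rfl | rfl⟩ <;> refine ⟨n + m, ?_⟩ <;> simp [zpow_add]
  inv_mem' := by
    rintro _ ⟨n, rfl | rfl⟩
    · exact ⟨-n, Or.inl (by simp)⟩
    · refine ⟨-n, Or.inr ?_⟩
      rw [inv_eq_iff_mul_eq_one, neg_mul_neg, ← zpow_add]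
      simp

/-- The set `B \ Γ` of cosets `B γ`. Sums over `B \ Γ` below use a chosen representative
`γ.out` of each coset; the summands do not depend on that choice. -/
abbrev CosetB : Type := Quotient (QuotientGroup.rightRel subgroupB)

/-- `𝓔_{r,s}(z) = ∑_{γ ∈ B \ Γ} j(γ, z)^{-r} j(γ, z̄)^{-s}`. -/
def eisen (r s : ℤ) (z : ℍ) : ℂ :=
  ∑' γ : CosetB, autj γ.out z ^ (-r) * autj γ.out (conj (z : ℂ)) ^ (-s)

/-- `⨁ y ^ j 𝓔_{r,s} S`, over `j ∈ ℤ`, `r, s ≥ 1`, `r + s ≥ 4` even, where `S = ⨁_n S_n` is the space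
of holomorphic cusp forms. For `g ∈ S_n` the function `y ^ j 𝓔_{r,s} g` has weights
`(r + n - j, s - j)`. -/
def eisenCusp : Submodule ℂ GradedFun :=
  Submodule.span ℂ {G | ∃ j r s n : ℤ, 1 ≤ r ∧ 1 ≤ s ∧ 4 ≤ r + s ∧ Even (r + s) ∧
    ∃ g : CuspForm 𝒮ℒ n, G = Finsupp.single (r + n - j, s - j)
      (fun z : ℍ => (z.im : ℂ) ^ j * eisen r s z * g z)}

/-- `⨁ y ^ j 𝓔_{r,s} S̄`, with `S̄` the space of complex conjugates of elements of `S`. -/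
def eisenCuspBar : Submodule ℂ GradedFun :=
  Submodule.span ℂ {G | ∃ j r s n : ℤ, 1 ≤ r ∧ 1 ≤ s ∧ 4 ≤ r + s ∧ Even (r + s) ∧
    ∃ g : CuspForm 𝒮ℒ n, G = Finsupp.single (r - j, s + n - j)
      (fun z : ℍ => (z.im : ℂ) ^ j * eisen r s z * conj (g z))}

/-- The subspaces `N` of `𝓜` with `∂ N ⊆ N + ⨁ y ^ j 𝓔_{r,s} S` and `∂̄ N ⊆ N + ⨁ y ^ j 𝓔_{r,s} S̄`. -/
def admissible : Set (Submodule ℂ GradedFun) :=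
  {N | N ≤ gradedM ∧
    (∀ F ∈ N, del F ∈ N ⊔ eisenCusp) ∧ (∀ F ∈ N, delBar F ∈ N ⊔ eisenCuspBar)}

/-- The space `MI'₂` of extended modular iterated integrals of length two: the largest subspace of
`𝓜` satisfying the two inclusions (see `isGreatest_extMI`). -/
def extMI : Submodule ℂ GradedFun := sSup admissible

lemma differentiableAt_of_mem {r s : ℤ} {f : ℍ → ℂ} (hf : f ∈ realAnForms r s) (z : ℍ) :
    DifferentiableAt ℝ (fun w : ℂ => f (ofComplex w)) z :=
  (hf.1 z z.im_pos).differentiableAt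

lemma maass_add {r s a : ℤ} {f g : ℍ → ℂ} (hf : f ∈ realAnForms r s) (hg : g ∈ realAnForms r s) :
    maass a (f + g) = maass a f + maass a g := by
  funext z
  have h := fderiv_fun_add (differentiableAt_of_mem hf z) (differentiableAt_of_mem hg z)
  simp only [maass, dz, Pi.add_apply, h, add_apply]
  ring

lemma maassBar_add {r s a : ℤ} {f g : ℍ → ℂ} (hf : f ∈ realAnForms r s)
    (hg : g ∈ realAnForms r s) : maassBar a (f + g) = maassBar a f + maassBar a g := by
  funext z
  have h := fderiv_fun_add (differentiableAt_of_mem hf z) (differentiableAt_of_mem hg z)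
  simp only [maassBar, dzbar, Pi.add_apply, h, add_apply]
  ring

lemma maass_zero (a : ℤ) : maass a 0 = 0 := by
  funext z
  simp [maass, dz]

lemma maassBar_zero (a : ℤ) : maassBar a 0 = 0 := by
  funext z
  simp [maassBar, dzbar]

lemma del_apply (F : GradedFun) (p : ℤ × ℤ) :
    del F p = maass (p.1 - 1) (F (p.1 - 1, p.2 + 1)) := by
  classical
  rw [del, Finsupp.sum_apply, Finsupp.sum, Finset.sum_eq_single (p.1 - 1, p.2 + 1)]
  · simp
  · rintro ⟨a, b⟩ _ hb
    refine Finsupp.single_eq_of_ne ?_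
    rintro rfl
    exact hb (by simp)
  · intro h
    rw [Finsupp.notMem_support_iff.1 h, maass_zero]
    simp

lemma delBar_apply (F : GradedFun) (p : ℤ × ℤ) :
    delBar F p = maassBar (p.2 - 1) (F (p.1 + 1, p.2 - 1)) := by
  classical
  rw [delBar, Finsupp.sum_apply, Finsupp.sum, Finset.sum_eq_single (p.1 + 1, p.2 - 1)]
  · simp
  · rintro ⟨a, b⟩ _ hb
    refine Finsupp.single_eq_of_ne ?_
    rintro rfl
    exact hb (by simp)
  · intro h
    rw [Finsupp.notMem_support_iff.1 h, maassBar_zero]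
    simp

lemma del_add {F G : GradedFun} (hF : F ∈ gradedM) (hG : G ∈ gradedM) :
    del (F + G) = del F + del G := by
  refine Finsupp.ext fun p => ?_
  rw [Finsupp.add_apply]
  simp only [del_apply, Finsupp.add_apply]
  exact maass_add (hF (p.1 - 1, p.2 + 1)) (hG (p.1 - 1, p.2 + 1))

lemma delBar_add {F G : GradedFun} (hF : F ∈ gradedM) (hG : G ∈ gradedM) :
    delBar (F + G) = delBar F + delBar G := by
  refine Finsupp.ext fun p => ?_
  rw [Finsupp.add_apply]
  simp only [delBar_apply, Finsupp.add_apply]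
  exact maassBar_add (hF (p.1 + 1, p.2 - 1)) (hG (p.1 + 1, p.2 - 1))

/-- `MI'₂` is itself admissible, hence it is the largest admissible subspace. -/
theorem isGreatest_extMI : IsGreatest admissible extMI := by
  have hle : extMI ≤ gradedM := sSup_le fun N hN => hN.1
  refine ⟨⟨hle, ?_, ?_⟩, fun N hN => le_sSup hN⟩
  · intro F hF
    have hF' := hF
    rw [extMI, sSup_eq_iSup'] at hF'
    refine Submodule.iSup_induction (motive := fun F => F ∈ extMI ∧ del F ∈ extMI ⊔ eisenCusp) _
      hF' ?_ ?_ ?_ |>.2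
    · intro N G hG
      exact ⟨le_sSup N.2 hG, sup_le_sup_right (le_sSup N.2) _ (N.2.2.1 G hG)⟩
    · refine ⟨zero_mem _, ?_⟩
      have : del 0 = 0 := by simp [del]
      rw [this]
      exact zero_mem _
    · rintro G H ⟨hG, hG'⟩ ⟨hH, hH'⟩
      refine ⟨add_mem hG hH, ?_⟩
      rw [del_add (hle hG) (hle hH)]
      exact add_mem hG' hH'
  · intro F hF
    have hF' := hF
    rw [extMI, sSup_eq_iSup'] at hF'
    refine Submodule.iSup_induction
      (motive := fun F => F ∈ extMI ∧ delBar F ∈ extMI ⊔ eisenCuspBar) _ hF' ?_ ?_ ?_ |>.2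
    · intro N G hG
      exact ⟨le_sSup N.2 hG, sup_le_sup_right (le_sSup N.2) _ (N.2.2.2 G hG)⟩
    · refine ⟨zero_mem _, ?_⟩
      have : delBar 0 = 0 := by simp [delBar]
      rw [this]
      exact zero_mem _
    · rintro G H ⟨hG, hG'⟩ ⟨hH, hH'⟩
      refine ⟨add_mem hG hH, ?_⟩
      rw [delBar_add (hle hG) (hle hH)]
      exact add_mem hG' hH'

/-! ### Eichler integrals, the series `φ^±_{r,s}` and their coefficient functions -/

/-- `∫_{i∞}^z g(w) dw`, along the vertical half-line `w = z + i t`, with `t` running from `∞` to `0`. -/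
def integralFromCusp (g : ℂ → ℂ) (z : ℍ) : ℂ :=
  -Complex.I * ∫ t in Set.Ioi (0 : ℝ), g ((z : ℂ) + Complex.I * (t : ℂ))

/-- `F_f^+(z, X) = ∫_{i∞}^z f(w) (w - X)^{k-2} dw`, as a polynomial in `X`: the integral of a
polynomial-valued function is taken coefficient by coefficient. -/
def eichlerPlus {k : ℕ} (f : CuspForm 𝒮ℒ (k : ℤ)) (z : ℍ) : Polynomial ℂ :=
  ∑ m ∈ Finset.range (k - 1), Polynomial.monomial m (integralFromCusp (fun w : ℂ =>
    f (ofComplex w) * ((Polynomial.C w - Polynomial.X) ^ (k - 2)).coeff m) z)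

/-- `F_f^-(z, X)`, the complex conjugate of `F_f^+(z, X)`, with conjugation acting trivially on `X`. -/
def eichlerMinus {k : ℕ} (f : CuspForm 𝒮ℒ (k : ℤ)) (z : ℍ) : Polynomial ℂ :=
  (eichlerPlus f z).map (starRingEnd ℂ)

/-- For `P` of degree at most `n`, the polynomial `(c X + d) ^ n P((a X + b) / (c X + d))`. -/
def homSubst (n : ℕ) (a b c d : ℂ) (P : Polynomial ℂ) : Polynomial ℂ :=
  ∑ m ∈ Finset.range (n + 1), Polynomial.C (P.coeff m) *
    (Polynomial.C a * Polynomial.X + Polynomial.C b) ^ m *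
    (Polynomial.C c * Polynomial.X + Polynomial.C d) ^ (n - m)

/-- The action `(F |_{r,s,2-k} γ)(z, X) = F(γ z, γ X) j(γ, z)^{-r} j(γ, z̄)^{-s} j(γ, X)^{k-2}` on
functions with values in polynomials of degree at most `k - 2` in `X`. -/
def slash (k : ℕ) (r s : ℤ) (F : ℍ → Polynomial ℂ) (γ : SL(2, ℤ)) (z : ℍ) : Polynomial ℂ :=
  Polynomial.C (autj γ z ^ (-r) * autj γ (conj (z : ℂ)) ^ (-s)) *
    homSubst (k - 2) (γ 0 0) (γ 0 1) (γ 1 0) (γ 1 1) (F (γ • z))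

/-- `∑_{γ ∈ B \ Γ} F |_{r,s,2-k} γ`, summed coefficient by coefficient in `X`. For `F = F_f^±` this is
`φ^±_{r,s}(f; z, X)`. -/
def phi (k : ℕ) (r s : ℤ) (F : ℍ → Polynomial ℂ) (z : ℍ) : Polynomial ℂ :=
  ∑ m ∈ Finset.range (k - 1),
    Polynomial.monomial m (∑' γ : CosetB, (slash k r s F γ.out z).coeff m)

/-- The coefficient of `(X - z) ^ i (X - z̄) ^ {n-i}` in the expansion of a polynomial `P` of degree at
most `n` with respect to these `n + 1` polynomials (see `expCoeff_expansion` and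
`expCoeff_unique`). It is found by the substitution `u = (X - z) / (X - z̄)`. -/
def expCoeff (n : ℕ) (P : Polynomial ℂ) (i : ℕ) (z : ℍ) : ℂ :=
  ((z : ℂ) - conj (z : ℂ)) ^ (-(n : ℤ)) * (homSubst n (-conj (z : ℂ)) z (-1) 1 P).coeff i

/-- The coefficient function `φ^±_{r,s}(f; i, z)` (for `F = F_f^±`). -/
def phiCoeff (k : ℕ) (r s : ℤ) (F : ℍ → Polynomial ℂ) (i : ℕ) (z : ℍ) : ℂ :=
  expCoeff (k - 2) (phi k r s F z) i z

lemma homSubst_eval (n : ℕ) (a b c d u : ℂ) {P : Polynomial ℂ} (hP : P.natDegree ≤ n)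
    (h : c * u + d ≠ 0) :
    (homSubst n a b c d P).eval u = (c * u + d) ^ n * P.eval ((a * u + b) / (c * u + d)) := by
  rw [homSubst, Polynomial.eval_finsetSum,
    Polynomial.eval_eq_sum_range' (Nat.lt_succ_of_le hP), Finset.mul_sum]
  refine Finset.sum_congr rfl fun m hm => ?_
  have hm' : m ≤ n := Nat.lt_succ_iff.1 (Finset.mem_range.1 hm)
  obtain ⟨l, rfl⟩ := Nat.exists_eq_add_of_le hm'
  simp only [Polynomial.eval_mul, Polynomial.eval_pow, Polynomial.eval_add, Polynomial.eval_C,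
    Polynomial.eval_X, Nat.add_sub_cancel_left]
  generalize c * u + d = e at h ⊢
  rw [div_pow, pow_add]
  field_simp

lemma homSubst_natDegree (n : ℕ) (a b c d : ℂ) (P : Polynomial ℂ) :
    (homSubst n a b c d P).natDegree ≤ n := by
  refine Polynomial.natDegree_sum_le_of_forall_le _ _ fun m hm => ?_
  have hm' : m ≤ n := Nat.lt_succ_iff.1 (Finset.mem_range.1 hm)
  have h1 : ∀ (x y : ℂ) (e : ℕ),
      ((Polynomial.C x * Polynomial.X + Polynomial.C y) ^ e).natDegree ≤ e := fun x y e =>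
    (Polynomial.natDegree_pow_le_of_le e (Polynomial.natDegree_linear_le)).trans (by simp)
  calc _ ≤ (0 + m) + (n - m) := Polynomial.natDegree_mul_le_of_le
        (Polynomial.natDegree_mul_le_of_le (by simp) (h1 _ _ _)) (h1 _ _ _)
    _ = n := by omega

lemma z_sub_conj_ne (z : ℍ) : (z : ℂ) - conj (z : ℂ) ≠ 0 := by
  intro h
  have := congrArg Complex.im h
  simp at this
  exact z.im_pos.ne' this

/-- Existence of the expansion that defines the coefficient functions. -/
theorem expCoeff_expansion (n : ℕ) {P : Polynomial ℂ} (hP : P.natDegree ≤ n) (z : ℍ) :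
    P = ∑ i ∈ Finset.range (n + 1), Polynomial.C (expCoeff n P i z) *
      (Polynomial.X - Polynomial.C (z : ℂ)) ^ i *
      (Polynomial.X - Polynomial.C (conj (z : ℂ))) ^ (n - i) := by
  refine Polynomial.eq_of_infinite_eval_eq _ _
    (Set.Infinite.mono ?_ (Set.finite_singleton (conj (z : ℂ))).infinite_compl)
  intro x hx
  have hx' : x - conj (z : ℂ) ≠ 0 := sub_ne_zero.2 hx
  have hz := z_sub_conj_ne z
  set Z : ℂ := (z : ℂ) with hZ
  set u : ℂ := (x - Z) / (x - conj Z) with hu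
  have h1 : -1 * u + 1 = (Z - conj Z) / (x - conj Z) := by
    rw [hu]; field_simp; ring
  have h1' : -1 * u + 1 ≠ 0 := by rw [h1]; exact div_ne_zero hz hx'
  have h2 : (-conj Z * u + Z) / (-1 * u + 1) = x := by
    rw [h1, hu]; field_simp; ring
  have h3 := homSubst_eval n (-conj Z) Z (-1) 1 u hP h1'
  rw [h2, h1, Polynomial.eval_eq_sum_range'
    (Nat.lt_succ_of_le (homSubst_natDegree n (-conj Z) Z (-1) 1 P))] at h3
  have h4 : P.eval x = (x - conj Z) ^ n * (Z - conj Z) ^ (-(n : ℤ)) *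
      ∑ i ∈ Finset.range (n + 1), (homSubst n (-conj Z) Z (-1) 1 P).coeff i * u ^ i := by
    rw [h3, zpow_neg, zpow_natCast, div_pow]
    field_simp
  show P.eval x = _
  rw [h4, Polynomial.eval_finsetSum, Finset.mul_sum]
  refine Finset.sum_congr rfl fun i hi => ?_
  have hi' : i ≤ n := Nat.lt_succ_iff.1 (Finset.mem_range.1 hi)
  obtain ⟨l, rfl⟩ := Nat.exists_eq_add_of_le hi'
  simp only [Polynomial.eval_mul, Polynomial.eval_pow, Polynomial.eval_sub, Polynomial.eval_C,
    Polynomial.eval_X, expCoeff, hu, div_pow, Nat.add_sub_cancel_left, ← hZ]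
  rw [pow_add]
  field_simp

/-- Uniqueness of the expansion that defines the coefficient functions. -/
theorem expCoeff_unique (n : ℕ) {P : Polynomial ℂ} (z : ℍ) (c : ℕ → ℂ)
    (h : P = ∑ i ∈ Finset.range (n + 1), Polynomial.C (c i) *
      (Polynomial.X - Polynomial.C (z : ℂ)) ^ i *
      (Polynomial.X - Polynomial.C (conj (z : ℂ))) ^ (n - i)) {i : ℕ} (hi : i ≤ n) :
    c i = expCoeff n P i z := by
  have hz := z_sub_conj_ne z
  have hP : P.natDegree ≤ n := by
    rw [h]
    refine Polynomial.natDegree_sum_le_of_forall_le _ _ fun m hm => ?_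
    have hm' : m ≤ n := Nat.lt_succ_iff.1 (Finset.mem_range.1 hm)
    have h1 : ∀ (x : ℂ) (e : ℕ),
        ((Polynomial.X - Polynomial.C x) ^ e).natDegree ≤ e := fun x e =>
      (Polynomial.natDegree_pow_le_of_le e (Polynomial.natDegree_X_sub_C_le x)).trans (by simp)
    calc _ ≤ (0 + m) + (n - m) := Polynomial.natDegree_mul_le_of_le
          (Polynomial.natDegree_mul_le_of_le (by simp) (h1 _ _)) (h1 _ _)
      _ = n := by omega
  set Z : ℂ := (z : ℂ) with hZ
  have key : homSubst n (-conj Z) Z (-1) 1 P =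
      ∑ i ∈ Finset.range (n + 1), Polynomial.C ((Z - conj Z) ^ n * c i) * Polynomial.X ^ i := by
    refine Polynomial.eq_of_infinite_eval_eq _ _
      (Set.Infinite.mono ?_ (Set.finite_singleton (1 : ℂ)).infinite_compl)
    intro u hu
    have hu' : -1 * u + 1 ≠ 0 := by
      intro h0
      exact hu (by rw [Set.mem_singleton_iff]; linear_combination -h0)
    have a1 : (-conj Z * u + Z) / (-1 * u + 1) - Z = (Z - conj Z) * u / (-1 * u + 1) := by
      rw [eq_div_iff hu', sub_mul, div_mul_cancel₀ _ hu']; ring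
    have a2 : (-conj Z * u + Z) / (-1 * u + 1) - conj Z = (Z - conj Z) / (-1 * u + 1) := by
      rw [eq_div_iff hu', sub_mul, div_mul_cancel₀ _ hu']; ring
    show Polynomial.eval _ _ = Polynomial.eval _ _
    rw [homSubst_eval n _ _ _ _ u hP hu', h, Polynomial.eval_finsetSum,
      Polynomial.eval_finsetSum, Finset.mul_sum]
    refine Finset.sum_congr rfl fun i hi => ?_
    have hi' : i ≤ n := Nat.lt_succ_iff.1 (Finset.mem_range.1 hi)
    obtain ⟨l, rfl⟩ := Nat.exists_eq_add_of_le hi'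
    simp only [Polynomial.eval_mul, Polynomial.eval_pow, Polynomial.eval_sub, Polynomial.eval_C,
      Polynomial.eval_X, a1, a2, Nat.add_sub_cancel_left]
    generalize -1 * u + 1 = e at hu' ⊢
    rw [div_pow, div_pow, mul_pow, pow_add, pow_add]
    field_simp
  rw [expCoeff, key, Polynomial.finsetSum_coeff, Finset.sum_eq_single i]
  · rw [Polynomial.coeff_C_mul, Polynomial.coeff_X_pow, if_pos rfl, mul_one, ← mul_assoc,
      zpow_neg, zpow_natCast, inv_mul_cancel₀ (pow_ne_zero _ hz), one_mul]
  · intro b _ hb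
    rw [Polynomial.coeff_C_mul, Polynomial.coeff_X_pow, if_neg (Ne.symm hb), mul_zero]
  · intro h'
    exact absurd (Finset.mem_range.2 (Nat.lt_succ_of_le hi)) h'

/-- The space `𝓐` spanned by all `φ^±_{r,s}(f; i, -)`, placed in weights `(r + i, s + k - 2 - i)`, for
`f ∈ S_k` with `k ≥ 12` even, integers `r, s` with `r + s` even and `r + s > k`, and
`0 ≤ i ≤ k - 2`. -/
def spaceA : Submodule ℂ GradedFun :=
  Submodule.span ℂ {G | ∃ k : ℕ, 12 ≤ k ∧ Even k ∧ ∃ (f : CuspForm 𝒮ℒ (k : ℤ)) (r s : ℤ),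
    Even (r + s) ∧ (k : ℤ) < r + s ∧ ∃ i : ℕ, i ≤ k - 2 ∧
      ∃ F : ℍ → Polynomial ℂ, (F = eichlerPlus f ∨ F = eichlerMinus f) ∧
        G = Finsupp.single (r + i, s + k - 2 - i) (phiCoeff k r s F i)}

end ModIter

end

/-!
The operators `∂` and `∂̄` preserve `𝓜`, so `𝓜` itself satisfies the closure conditions and
`MI'_2 = 𝓜`; it remains to show that each `φ^±_{r,s}(f; i, -)` is an element of `𝓜`.

The coefficients of `F_f^+(z, X)` in the basis `(X - z)^i (X - z̄)^(k-2-i)` are finite sums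
`∑ y^j h_j(q)` and are bounded by a power of `y⁻¹`; `φ_i` is the Poincaré series of the `i`-th one,
and this bound gives absolute convergence. To find the `q`-expansion of the sum, write
`F_f^+(γz, γX) j(γ, X)^(k-2) = F_f^+(z, X) + P_γ(X)`, where the period polynomial `P_γ` does not
depend on `z`. Evaluating it at the base point `(-d + i)/c`, where `γ` acts by
`((-d + i)/c) ↦ (a + i)/c`, expands `P_γ` in powers of `cX + d` with coefficients that depend only
on `c` and `d mod c`. Hence `φ_i` becomes a finite combination of series
`∑ κ(c, d) (cz + d)^(-a) (cz̄ + d)^(-b)` over coprime pairs with `κ` periodic in `d`, and Lipschitz'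
formula with two weights, `∑_l (z + l)^(-a) (z̄ + l)^(-b) ∈ ∑ y^j (ℂ[[q]] + ℂ[[q̄]])`, gives their
expansions. The functions `φ^-` are complex conjugates of the `φ^+`.
-/

noncomputable section

namespace ModIter

open Metric Filter Topology Asymptotics MeasureTheory

/-! ### Wirtinger derivatives -/

/-- `f` is real-differentiable at `z` with Wirtinger derivatives `∂f/∂z = a` and `∂f/∂z̄ = b`. -/
def HasWirtingerAt (f : ℍ → ℂ) (z : ℍ) (a b : ℂ) : Prop :=
  HasFDerivAt (fun w : ℂ => f (ofComplex w))
    (a • ContinuousLinearMap.id ℝ ℂ + b • (Complex.conjCLE : ℂ →L[ℝ] ℂ)) z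

lemma hasWirtingerAt_of_hasFDerivAt {f : ℍ → ℂ} {z : ℍ} {a b : ℂ} {L : ℂ →L[ℝ] ℂ}
    (h : HasFDerivAt (fun w : ℂ => f (ofComplex w)) L z) (hL : ∀ v, L v = a * v + b * conj v) :
    HasWirtingerAt f z a b := by
  have : L = a • ContinuousLinearMap.id ℝ ℂ + b • (Complex.conjCLE : ℂ →L[ℝ] ℂ) := by
    ext v
    simp [hL]
  rwa [this] at h

lemma hasWirtingerAt_of_differentiableAt {f : ℍ → ℂ} {z : ℍ}
    (h : DifferentiableAt ℝ (fun w : ℂ => f (ofComplex w)) z) :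
    HasWirtingerAt f z (dz f z) (dzbar f z) := by
  refine hasWirtingerAt_of_hasFDerivAt h.hasFDerivAt fun v => ?_
  have hv : v = v.re • (1 : ℂ) + v.im • Complex.I := by simp [Complex.re_add_im]
  have hconj : conj v = v.re - v.im * Complex.I := by apply Complex.ext <;> simp
  conv_lhs => rw [hv, map_add, map_smul, map_smul]
  rw [hconj]
  nth_rw 3 [← Complex.re_add_im v]
  simp only [dz, dzbar, Complex.real_smul]
  linear_combination ((v.im : ℂ) * fderiv ℝ (fun w : ℂ => f (ofComplex w)) z Complex.I) *
    Complex.I_sq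

namespace HasWirtingerAt

variable {f g : ℍ → ℂ} {z : ℍ} {a b c d : ℂ}

lemma dz_eq (h : HasWirtingerAt f z a b) : dz f z = a := by
  have h1 : fderiv ℝ (fun w : ℂ => f (ofComplex w)) z 1 = a + b := by
    simp [HasFDerivAt.fderiv h]
  have h2 : fderiv ℝ (fun w : ℂ => f (ofComplex w)) z Complex.I = (a - b) * Complex.I := by
    simp only [HasFDerivAt.fderiv h, add_apply, smul_apply, ContinuousLinearMap.id_apply,
      smul_eq_mul, ContinuousLinearEquiv.coe_coe, ContinuousAlgEquiv.coeCLE_apply,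
      Complex.conjCAE_apply, Complex.conj_I, mul_neg]
    ring
  rw [dz, h1, h2]
  linear_combination (b - a) / 2 * Complex.I_sq

lemma mul (hf : HasWirtingerAt f z a b) (hg : HasWirtingerAt g z c d) :
    HasWirtingerAt (f * g) z (a * g z + f z * c) (b * g z + f z * d) := by
  refine hasWirtingerAt_of_hasFDerivAt (HasFDerivAt.mul hf hg) fun v => ?_
  simp only [ofComplex_apply, smul_add, add_apply, smul_apply, ContinuousLinearMap.id_apply,
    smul_eq_mul, ContinuousLinearEquiv.coe_coe, ContinuousAlgEquiv.coeCLE_apply,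
    Complex.conjCAE_apply]
  ring

lemma add (hf : HasWirtingerAt f z a b) (hg : HasWirtingerAt g z c d) :
    HasWirtingerAt (f + g) z (a + c) (b + d) := by
  refine hasWirtingerAt_of_hasFDerivAt (HasFDerivAt.add hf hg) fun v => ?_
  simp only [add_apply, smul_apply, ContinuousLinearMap.id_apply, smul_eq_mul,
    ContinuousLinearEquiv.coe_coe, ContinuousAlgEquiv.coeCLE_apply, Complex.conjCAE_apply]
  ring

lemma star (hf : HasWirtingerAt f z a b) : HasWirtingerAt (star f) z (conj b) (conj a) := by
  refine hasWirtingerAt_of_hasFDerivAt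
    ((Complex.conjCLE : ℂ →L[ℝ] ℂ).hasFDerivAt.comp (z : ℂ) hf) fun v => ?_
  simp only [ContinuousLinearMap.comp_add, add_apply, ContinuousLinearMap.comp_apply, smul_apply,
    ContinuousLinearMap.id_apply, smul_eq_mul, ContinuousLinearEquiv.coe_coe,
    ContinuousAlgEquiv.coeCLE_apply, Complex.conjCAE_apply, map_mul, RingHomCompTriple.comp_apply,
    RingHom.id_apply]
  ring

lemma comp_of_hasDerivAt {φ : ℂ → ℂ} (hφ : HasDerivAt φ c (f z)) (hf : HasWirtingerAt f z a b) :
    HasWirtingerAt (φ ∘ f) z (c * a) (c * b) := by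
  rw [← ofComplex_apply z] at hφ
  refine hasWirtingerAt_of_hasFDerivAt
    ((hφ.hasFDerivAt.restrictScalars ℝ).comp (z : ℂ) hf) fun v => ?_
  simp only [ContinuousLinearMap.comp_add, add_apply, ContinuousLinearMap.comp_apply, smul_apply,
    ContinuousLinearMap.id_apply, smul_eq_mul, ContinuousLinearMap.coe_restrictScalars',
    ContinuousLinearMap.toSpanSingleton_apply, ContinuousLinearEquiv.coe_coe,
    ContinuousAlgEquiv.coeCLE_apply, Complex.conjCAE_apply]
  ring

lemma zpow (hf : HasWirtingerAt f z a b) (h0 : f z ≠ 0) (n : ℤ) :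
    HasWirtingerAt (f ^ n) z (n * f z ^ (n - 1) * a) (n * f z ^ (n - 1) * b) :=
  hf.comp_of_hasDerivAt (hasDerivAt_zpow n _ (Or.inl h0))

lemma pow (hf : HasWirtingerAt f z a b) (n : ℕ) :
    HasWirtingerAt (f ^ n) z (n * f z ^ (n - 1) * a) (n * f z ^ (n - 1) * b) :=
  hf.comp_of_hasDerivAt (hasDerivAt_pow n _)

end HasWirtingerAt

lemma hasWirtingerAt_const (c : ℂ) (z : ℍ) : HasWirtingerAt (fun _ => c) z 0 0 :=
  hasWirtingerAt_of_hasFDerivAt (hasFDerivAt_const c _) fun v => by simp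

lemma eventually_coe_ofComplex (z : ℍ) : ∀ᶠ w : ℂ in 𝓝 (z : ℂ), (ofComplex w : ℂ) = w :=
  eventuallyEq_coe_comp_ofComplex z.im_pos

lemma hasWirtingerAt_of_hasDerivAt {g : ℂ → ℂ} {z : ℍ} {c : ℂ} (hg : HasDerivAt g c z) :
    HasWirtingerAt (fun z => g z) z c 0 := by
  have h : HasDerivAt (fun w : ℂ => g (ofComplex w)) c z := by
    refine hg.congr_of_eventuallyEq ?_
    filter_upwards [eventually_coe_ofComplex z] with w hw
    rw [hw]
  refine hasWirtingerAt_of_hasFDerivAt (h.hasFDerivAt.restrictScalars ℝ) fun v => ?_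
  simp [mul_comm]

lemma hasWirtingerAt_im (z : ℍ) :
    HasWirtingerAt (fun z => (z.im : ℂ)) z (-Complex.I / 2) (Complex.I / 2) := by
  have h : HasFDerivAt (fun w : ℂ => ((ofComplex w).im : ℂ))
      (Complex.ofRealCLM.comp Complex.imCLM) z := by
    refine (Complex.ofRealCLM.comp Complex.imCLM).hasFDerivAt.congr_of_eventuallyEq ?_
    filter_upwards [eventually_coe_ofComplex z] with w hw
    simp [← coe_im, hw]
  refine hasWirtingerAt_of_hasFDerivAt h fun v => ?_
  have hv := Complex.sub_conj v
  push_cast at hv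
  simp only [ContinuousLinearMap.comp_apply, Complex.imCLM_apply, Complex.ofRealCLM_apply]
  linear_combination Complex.I / 2 * hv + v.im * Complex.I_sq

lemma isPreconnected_im_gt (y : ℝ) : IsPreconnected {w : ℂ | y < w.im} :=
  (convex_halfSpace_im_gt y).isPreconnected

lemma norm_wirtinger_le (a b : ℂ) :
    ‖a • ContinuousLinearMap.id ℝ ℂ + b • (Complex.conjCLE : ℂ →L[ℝ] ℂ)‖ ≤ ‖a‖ + ‖b‖ :=
  ContinuousLinearMap.opNorm_le_bound _ (by positivity) fun v => by
    calc ‖a * v + b * conj v‖ ≤ ‖a * v‖ + ‖b * conj v‖ := norm_add_le _ _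
      _ = (‖a‖ + ‖b‖) * ‖v‖ := by rw [norm_mul, norm_mul, RCLike.norm_conj]; ring

lemma hasWirtingerAt_tsum {ι : Type*} {F a b : ι → ℍ → ℂ} {u : ι → ℝ} (hu : Summable u) {y : ℝ}
    (hy : 0 ≤ y) (hF : ∀ i w, HasWirtingerAt (F i) w (a i w) (b i w))
    (ha : ∀ i (w : ℍ), y < w.im → ‖a i w‖ ≤ u i) (hb : ∀ i (w : ℍ), y < w.im → ‖b i w‖ ≤ u i)
    {z : ℍ} (hz : y < z.im) (hFz : Summable fun i => F i z) :
    HasWirtingerAt (fun w => ∑' i, F i w) z (∑' i, a i z) (∑' i, b i z) := by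
  have coe_mk {w : ℂ} (hw : y < w.im) : ∃ τ : ℍ, (τ : ℂ) = w := ⟨⟨w, hy.trans_lt hw⟩, rfl⟩
  have h := hasFDerivAt_tsum_of_isPreconnected (hu.add hu)
    (isOpen_lt continuous_const Complex.continuous_im) (isPreconnected_im_gt y)
    (f := fun i w => F i (ofComplex w))
    (f' := fun i w => a i (ofComplex w) • ContinuousLinearMap.id ℝ ℂ +
      b i (ofComplex w) • (Complex.conjCLE : ℂ →L[ℝ] ℂ))
    (fun i w hw => by
      obtain ⟨τ, rfl⟩ := coe_mk hw
      rw [ofComplex_apply]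
      exact hF i τ)
    (fun i w hw => by
      obtain ⟨τ, rfl⟩ := coe_mk hw
      rw [ofComplex_apply]
      exact (norm_wirtinger_le _ _).trans (add_le_add (ha i τ hw) (hb i τ hw)))
    hz (by simpa only [ofComplex_apply] using hFz) hz
  have hsa : Summable fun i => a i z := .of_norm_bounded hu fun i => ha i z hz
  have hsb : Summable fun i => b i z := .of_norm_bounded hu fun i => hb i z hz
  simp only [ofComplex_apply] at h
  rw [(hsa.smul_const _).tsum_add (hsb.smul_const _), hsa.tsum_smul_const,
    hsb.tsum_smul_const] at h
  exact h

/-! ### Expansions in powers of `y`, `q` and `q̄` -/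

lemma qpar_eq_qParam (z : ℍ) : qpar z = Function.Periodic.qParam 1 z := by
  simp [qpar, Function.Periodic.qParam]

lemma norm_qpar (z : ℍ) : ‖qpar z‖ = Real.exp (-2 * Real.pi * z.im) := by
  rw [qpar_eq_qParam, Function.Periodic.norm_qParam, div_one, coe_im]

lemma norm_qpar_lt_one (z : ℍ) : ‖qpar z‖ < 1 := by
  rw [qpar_eq_qParam]
  exact Function.Periodic.norm_qParam_lt_one one_pos z.im_pos

lemma norm_qpar_le_norm_qpar {z w : ℍ} (h : w.im ≤ z.im) : ‖qpar z‖ ≤ ‖qpar w‖ := by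
  rw [norm_qpar, norm_qpar, Real.exp_le_exp]
  nlinarith [Real.pi_pos]

lemma qpar_mem_ball (z : ℍ) : qpar z ∈ ball (0 : ℂ) 1 :=
  mem_ball_zero_iff.2 (norm_qpar_lt_one z)

lemma exists_norm_qpar_eq {ρ : ℝ} (h0 : 0 < ρ) (h1 : ρ < 1) : ∃ z : ℍ, ‖qpar z‖ = ρ := by
  have hy : 0 < (Complex.I * (-Real.log ρ / (2 * Real.pi) : ℝ)).im := by
    rw [Complex.I_mul_im, Complex.ofReal_re]
    exact div_pos (neg_pos.2 (Real.log_neg h0 h1)) Real.two_pi_pos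
  refine ⟨⟨_, hy⟩, ?_⟩
  rw [norm_qpar, UpperHalfPlane.im, Complex.I_mul_im, Complex.ofReal_re, neg_mul, neg_div,
    neg_mul_neg, mul_div_cancel₀ _ Real.two_pi_pos.ne', Real.exp_log h0]

lemma hasWirtingerAt_qpar (z : ℍ) :
    HasWirtingerAt qpar z (2 * Real.pi * Complex.I * qpar z) 0 := by
  refine hasWirtingerAt_of_hasDerivAt
    (g := fun w => Complex.exp (2 * Real.pi * Complex.I * w)) ?_
  simpa [mul_comm, qpar] using ((hasDerivAt_id (z : ℂ)).const_mul (2 * Real.pi * Complex.I)).cexp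

/-- The term `c_{m,n} q ^ m q̄ ^ n`, with `p = (m, n)`, of a double series in `q` and `q̄`. -/
def qqTerm (c : ℕ × ℕ → ℂ) (p : ℕ × ℕ) (z : ℍ) : ℂ :=
  c p * qpar z ^ p.1 * conj (qpar z) ^ p.2

lemma norm_qqTerm (c : ℕ × ℕ → ℂ) (p : ℕ × ℕ) (z : ℍ) :
    ‖qqTerm c p z‖ = ‖c p‖ * ‖qpar z‖ ^ (p.1 + p.2) := by
  rw [qqTerm, norm_mul, norm_mul, norm_pow, norm_pow, RCLike.norm_conj, pow_add, mul_assoc]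

lemma hasWirtingerAt_qqTerm (c : ℕ × ℕ → ℂ) (p : ℕ × ℕ) (z : ℍ) :
    HasWirtingerAt (qqTerm c p) z (2 * Real.pi * Complex.I * (p.1 * qqTerm c p z))
      (-2 * Real.pi * Complex.I * (p.2 * qqTerm c p z)) := by
  have h := ((hasWirtingerAt_const (c p) z).mul ((hasWirtingerAt_qpar z).pow p.1)).mul
    ((hasWirtingerAt_qpar z).star.pow p.2)
  have pow_sub_one (n : ℕ) (x : ℂ) : n * x ^ (n - 1) * x = n * x ^ n := by
    cases n with
    | zero => simp
    | succ n => rw [Nat.add_sub_cancel, mul_assoc, pow_succ]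
  simp only [Pi.mul_apply, Pi.pow_apply, Pi.star_apply, Complex.star_def, map_mul, map_zero,
    Complex.conj_I, Complex.conj_ofReal, Complex.conj_ofNat] at h
  convert h using 1
  · rfl
  · rw [qqTerm]
    linear_combination (-2 * Real.pi * Complex.I * c p * conj (qpar z) ^ p.2) *
      pow_sub_one p.1 (qpar z)
  · rw [qqTerm]
    linear_combination (2 * Real.pi * Complex.I * c p * qpar z ^ p.1) *
      pow_sub_one p.2 (conj (qpar z))

/-- The functions `∑_{m,n ≥ 0} c_{m,n} q ^ m q̄ ^ n`, with absolute convergence on `ℍ`. -/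
def qqSeries : Submodule ℂ (ℍ → ℂ) where
  carrier := {f | ∃ c : ℕ × ℕ → ℂ, ∀ z, HasSum (fun p => qqTerm c p z) (f z)}
  zero_mem' := ⟨0, fun z => by simp [qqTerm]⟩
  add_mem' := by
    rintro f g ⟨c, hc⟩ ⟨d, hd⟩
    exact ⟨c + d, fun z => by simpa [qqTerm, add_mul] using (hc z).add (hd z)⟩
  smul_mem' := by
    rintro t f ⟨c, hc⟩
    exact ⟨t • c, fun z => by simpa [qqTerm, mul_assoc] using (hc z).mul_left t⟩

lemma summable_nat_mul_norm_mul_pow {ι : Type*} {c : ι → ℂ} {d : ι → ℕ} {ρ σ : ℝ} (hρ : 0 ≤ ρ)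
    (h : ρ < σ) (hc : Summable fun i => ‖c i‖ * σ ^ d i) :
    Summable fun i => d i * (‖c i‖ * ρ ^ d i) := by
  have hσ : 0 < σ := hρ.trans_lt h
  obtain ⟨M, hM⟩ := (tendsto_self_mul_const_pow_of_lt_one (div_nonneg hρ hσ.le)
    ((div_lt_one hσ).2 h)).bddAbove_range
  refine .of_nonneg_of_le (fun i => by positivity) (fun i => ?_) (hc.mul_left M)
  calc d i * (‖c i‖ * ρ ^ d i) = d i * (ρ / σ) ^ d i * (‖c i‖ * σ ^ d i) := by
        rw [div_pow]
        field_simp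
    _ ≤ M * (‖c i‖ * σ ^ d i) :=
        mul_le_mul_of_nonneg_right (hM ⟨d i, rfl⟩) (by positivity)

lemma summable_degree_mul_norm {c : ℕ × ℕ → ℂ} (hc : ∀ z, Summable fun p => qqTerm c p z) (z : ℍ) :
    Summable fun p : ℕ × ℕ => ((p.1 + p.2 : ℕ) : ℝ) * (‖c p‖ * ‖qpar z‖ ^ (p.1 + p.2)) := by
  obtain ⟨σ, hσ, hσ1⟩ := exists_between (norm_qpar_lt_one z)
  obtain ⟨w, rfl⟩ := exists_norm_qpar_eq ((norm_nonneg _).trans_lt hσ) hσ1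
  refine summable_nat_mul_norm_mul_pow (norm_nonneg _) hσ ?_
  simpa only [norm_qqTerm] using (hc w).norm

lemma norm_natCast_mul_qqTerm_le (c : ℕ × ℕ → ℂ) {p : ℕ × ℕ} {m : ℕ} (hm : m ≤ p.1 + p.2)
    {z w : ℍ} (h : w.im ≤ z.im) :
    ‖m * qqTerm c p z‖ ≤ ((p.1 + p.2 : ℕ) : ℝ) * (‖c p‖ * ‖qpar w‖ ^ (p.1 + p.2)) := by
  rw [norm_mul, norm_qqTerm, Complex.norm_natCast]
  have := norm_qpar_le_norm_qpar h
  gcongr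

lemma exists_hasWirtingerAt_of_mem_qqSeries {f : ℍ → ℂ} (hf : f ∈ qqSeries) :
    ∃ g ∈ qqSeries, ∀ z, ∃ b, HasWirtingerAt f z (g z) b := by
  obtain ⟨c, hc⟩ := hf
  obtain rfl : f = fun z => ∑' p, qqTerm c p z := funext fun z => (hc z).tsum_eq.symm
  have hdeg := summable_degree_mul_norm fun z => (hc z).summable
  have hsum (z : ℍ) : Summable fun p : ℕ × ℕ => p.1 * qqTerm c p z :=
    .of_norm_bounded (hdeg z) fun p => norm_natCast_mul_qqTerm_le c (Nat.le_add_right _ _) le_rfl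
  refine ⟨(2 * Real.pi * Complex.I : ℂ) • fun z => ∑' p : ℕ × ℕ, p.1 * qqTerm c p z,
    Submodule.smul_mem _ _ ⟨fun p => p.1 * c p, fun z => ?_⟩, fun z => ?_⟩
  · simpa only [qqTerm, mul_assoc] using (hsum z).hasSum
  · have hw : 0 < ((z : ℂ) / 2).im := by simpa using z.im_pos
    have hwz : (⟨_, hw⟩ : ℍ).im < z.im := by
      change ((z : ℂ) / 2).im < z.im
      rw [Complex.div_ofNat_im]
      exact half_lt_self z.im_pos
    have norm_two_pi_I : ‖(2 * Real.pi * Complex.I : ℂ)‖ = 2 * Real.pi := by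
      simp [abs_of_pos Real.pi_pos]
    have bound {ε : ℂ} (hε : ‖ε‖ = 2 * Real.pi) {p : ℕ × ℕ} {m : ℕ} (hm : m ≤ p.1 + p.2) {τ : ℍ}
        (hτ : (⟨_, hw⟩ : ℍ).im < τ.im) := by
      have h := mul_le_mul_of_nonneg_left (norm_natCast_mul_qqTerm_le c hm hτ.le)
        Real.two_pi_pos.le
      rwa [← hε, ← norm_mul, hε] at h
    rw [Pi.smul_apply, smul_eq_mul, ← tsum_mul_left]
    exact ⟨_, hasWirtingerAt_tsum ((hdeg ⟨_, hw⟩).mul_left (2 * Real.pi)) hw.le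
      (hasWirtingerAt_qqTerm c) (fun p τ hτ => bound norm_two_pi_I (Nat.le_add_right _ _) hτ)
      (fun p τ hτ => bound (by simpa using norm_two_pi_I) (Nat.le_add_left _ _) hτ) hwz
      (hc z).summable⟩

/-- The function `y ^ j` on the upper half-plane. -/
def yPow (j : ℤ) : ℍ → ℂ := fun z => (z.im : ℂ) ^ j

lemma im_ne_zero (z : ℍ) : (z.im : ℂ) ≠ 0 := by exact_mod_cast z.im_pos.ne'

lemma yPow_mul_yPow (i j : ℤ) : yPow i * yPow j = yPow (i + j) :=
  funext fun z => (zpow_add₀ (im_ne_zero z) i j).symm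

lemma star_yPow (j : ℤ) : star (yPow j) = yPow j := by
  funext z
  simp [yPow]

lemma hasWirtingerAt_yPow (j : ℤ) (z : ℍ) :
    HasWirtingerAt (yPow j) z (j * yPow (j - 1) z * (-Complex.I / 2))
      (j * yPow (j - 1) z * (Complex.I / 2)) :=
  (hasWirtingerAt_im z).zpow (im_ne_zero z) j

/-- The finite sums `∑ y ^ j G_j` with `G_j` an absolutely convergent double series in `q`, `q̄`. -/
def fourierExpansions : Submodule ℂ (ℍ → ℂ) :=
  ⨆ j : ℤ, qqSeries.map (LinearMap.mulLeft ℂ (yPow j))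

lemma yPow_mul_mem_fourierExpansions (j : ℤ) {G : ℍ → ℂ} (hG : G ∈ qqSeries) :
    yPow j * G ∈ fourierExpansions :=
  Submodule.mem_iSup_of_mem j ⟨G, hG, rfl⟩

lemma fourierExpansions_induction {P : ∀ f, f ∈ fourierExpansions → Prop}
    (zero : P 0 (zero_mem _))
    (add : ∀ f g hf hg, P f hf → P g hg → P (f + g) (add_mem hf hg))
    (yPow_mul : ∀ j G (hG : G ∈ qqSeries), P (yPow j * G) (yPow_mul_mem_fourierExpansions j hG))
    {f : ℍ → ℂ} (hf : f ∈ fourierExpansions) : P f hf := by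
  refine Submodule.iSup_induction' _ (motive := P) ?_ zero add hf
  rintro j _ ⟨G, hG, rfl⟩
  exact yPow_mul j G hG

lemma star_mem_qqSeries {f : ℍ → ℂ} (hf : f ∈ qqSeries) : star f ∈ qqSeries := by
  obtain ⟨c, hc⟩ := hf
  refine ⟨fun p => conj (c p.swap), fun z => ?_⟩
  convert (Equiv.prodComm ℕ ℕ).hasSum_iff.2 (hc z).star using 2 with p
  · simp [qqTerm, mul_right_comm]
  · rfl

lemma yPow_mul_mem {f : ℍ → ℂ} (j : ℤ) (hf : f ∈ fourierExpansions) :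
    yPow j * f ∈ fourierExpansions := by
  induction hf using fourierExpansions_induction with
  | zero =>
    rw [mul_zero]; exact zero_mem _
  | add f g _ _ hf hg =>
    rw [mul_add]; exact add_mem hf hg
  | yPow_mul i G hG =>
    rw [← mul_assoc, yPow_mul_yPow]
    exact yPow_mul_mem_fourierExpansions _ hG

lemma star_mem_fourierExpansions {f : ℍ → ℂ} (hf : f ∈ fourierExpansions) :
    star f ∈ fourierExpansions := by
  induction hf using fourierExpansions_induction with
  | zero =>
    rw [star_zero]; exact zero_mem _
  | add f g _ _ hf hg =>
    rw [star_add]; exact add_mem hf hg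
  | yPow_mul j G hG =>
    rw [star_mul', star_yPow]
    exact yPow_mul_mem_fourierExpansions j (star_mem_qqSeries hG)

lemma exists_hasWirtingerAt_of_mem_fourierExpansions {f : ℍ → ℂ} (hf : f ∈ fourierExpansions) :
    ∃ g ∈ fourierExpansions, ∀ z, ∃ b, HasWirtingerAt f z (g z) b := by
  induction hf using fourierExpansions_induction with
  | zero =>
    exact ⟨0, zero_mem _, fun z => ⟨0, hasWirtingerAt_const 0 z⟩⟩
  | add f₁ f₂ _ _ hf₁ hf₂ =>
    obtain ⟨g₁, hg₁, h₁⟩ := hf₁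
    obtain ⟨g₂, hg₂, h₂⟩ := hf₂
    refine ⟨g₁ + g₂, add_mem hg₁ hg₂, fun z => ?_⟩
    exact ⟨_, (h₁ z).choose_spec.add (h₂ z).choose_spec⟩
  | yPow_mul j G hG =>
    obtain ⟨g, hg, h⟩ := exists_hasWirtingerAt_of_mem_qqSeries hG
    refine ⟨(j * (-Complex.I / 2)) • (yPow (j - 1) * G) + yPow j * g,
      add_mem (Submodule.smul_mem _ _ (yPow_mul_mem_fourierExpansions _ hG))
        (yPow_mul_mem_fourierExpansions _ hg), fun z => ?_⟩
    obtain ⟨b, hb⟩ := h z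
    have hgz : ((j * (-Complex.I / 2)) • (yPow (j - 1) * G) + yPow j * g) z =
        j * yPow (j - 1) z * (-Complex.I / 2) * G z + yPow j z * g z := by
      simp only [Pi.add_apply, Pi.smul_apply, Pi.mul_apply, smul_eq_mul]
      ring
    exact ⟨_, hgz ▸ (hasWirtingerAt_yPow j z).mul hb⟩

lemma maass_mem_fourierExpansions (r : ℤ) {f : ℍ → ℂ} (hf : f ∈ fourierExpansions) :
    maass r f ∈ fourierExpansions := by
  obtain ⟨g, hg, h⟩ := exists_hasWirtingerAt_of_mem_fourierExpansions hf
  have : maass r f = (2 * Complex.I : ℂ) • (yPow 1 * g) + (r : ℂ) • f := by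
    funext z
    simp [maass, (h z).choose_spec.dz_eq, yPow, mul_assoc]
  rw [this]
  exact add_mem (Submodule.smul_mem _ _ (yPow_mul_mem 1 hg)) (Submodule.smul_mem _ _ hf)

lemma isBigO_im_rpow {a b : ℝ} (h : a ≤ b) :
    (fun z : ℍ => z.im ^ a) =O[atImInfty] fun z : ℍ => z.im ^ b := by
  refine IsBigO.of_bound 1 ?_
  filter_upwards [tendsto_comap.eventually (eventually_ge_atTop (1 : ℝ))] with z hz
  rw [one_mul, Real.norm_of_nonneg (by positivity), Real.norm_of_nonneg (by positivity)]
  exact Real.rpow_le_rpow_of_exponent_le hz h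

lemma isBigO_one_of_mem_qqSeries {f : ℍ → ℂ} (hf : f ∈ qqSeries) :
    f =O[atImInfty] fun _ => (1 : ℝ) := by
  obtain ⟨c, hc⟩ := hf
  have hI : Summable fun p => ‖qqTerm c p I‖ := (hc I).summable.norm
  refine IsBigO.of_bound (∑' p, ‖qqTerm c p I‖) ?_
  filter_upwards [tendsto_comap.eventually (eventually_ge_atTop (1 : ℝ))] with z hz
  rw [norm_one, mul_one, ← (hc z).tsum_eq]
  refine tsum_of_norm_bounded hI.hasSum fun p => ?_
  rw [norm_qqTerm, norm_qqTerm]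
  have := norm_qpar_le_norm_qpar (z := z) (w := I) (by rwa [I_im])
  gcongr

lemma hasModerateGrowth_of_mem {f : ℍ → ℂ} (hf : f ∈ fourierExpansions) :
    HasModerateGrowth f := by
  induction hf using fourierExpansions_induction with
  | zero =>
    exact ⟨1, one_pos, isBigO_zero _ _⟩
  | add f g _ _ hf hg =>
    obtain ⟨C, hC, hf⟩ := hf
    obtain ⟨D, -, hg⟩ := hg
    exact ⟨max C D, lt_max_of_lt_left hC, (hf.trans (isBigO_im_rpow (le_max_left _ _))).add
      (hg.trans (isBigO_im_rpow (le_max_right _ _)))⟩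
  | yPow_mul j G hG =>
    have hj : yPow j =O[atImInfty] fun z : ℍ => z.im ^ (j : ℝ) :=
      .of_norm_le fun z => by simp [yPow, abs_of_pos z.im_pos]
    refine ⟨max j 1, lt_max_of_lt_right one_pos,
      IsBigO.trans ?_ (isBigO_im_rpow (le_max_left (j : ℝ) 1))⟩
    exact (hj.mul (isBigO_one_of_mem_qqSeries hG)).congr (fun _ => rfl) fun z => mul_one _

lemma hasFourierExpansion_iff {f : ℍ → ℂ} : HasFourierExpansion f ↔ f ∈ fourierExpansions := by
  classical
  constructor
  · rintro ⟨a, ha, hf⟩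
    have : f = ∑ j ∈ a.support, yPow j * fun z => ∑' p, qqTerm (a j) p z := by
      funext z
      rw [hf z, Finset.sum_apply]
      rfl
    rw [this]
    exact sum_mem fun j _ => yPow_mul_mem_fourierExpansions j ⟨a j, fun z => (ha j z).hasSum⟩
  · intro hf
    obtain ⟨g, hg, rfl⟩ := (Submodule.mem_iSup_iff_exists_finsupp _ _).1 hf
    have hg (j : ℤ) : ∃ c : ℕ × ℕ → ℂ, ∃ G : ℍ → ℂ,
        (∀ z, HasSum (fun p => qqTerm c p z) (G z)) ∧ yPow j * G = g j :=
      let ⟨G, ⟨c, hc⟩, hG⟩ := hg j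
      ⟨c, G, hc, hG⟩
    choose c G hc hG using hg
    refine ⟨Finsupp.indicator g.support fun j _ => c j, fun j z => ?_, fun z => ?_⟩
    · rw [Finsupp.indicator_apply]
      split_ifs
      · exact (hc j z).summable
      · simp [summable_zero]
    · rw [Finsupp.sum_of_support_subset _ (Finsupp.support_indicator_subset _ _) _ (by simp),
        Finsupp.sum, Finset.sum_apply]
      refine Finset.sum_congr rfl fun j hj => ?_
      rw [Finsupp.indicator_of_mem hj, ← hG j]
      exact congrArg (_ * ·) (hc j z).tsum_eq.symm

/-! ### Modularity and the operators `∂`, `∂̄` -/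

/-- `f` transforms like a modular form of weights `(r, s)` under `SL(2, ℤ)`. -/
def HasWeight (r s : ℤ) (f : ℍ → ℂ) : Prop :=
  ∀ (γ : SL(2, ℤ)) (z : ℍ), f (γ • z) = autj γ z ^ r * autj γ (conj (z : ℂ)) ^ s * f z

lemma autj_eq_denom (γ : SL(2, ℤ)) (z : ℍ) : autj γ z = denom γ z := by
  simp [autj, ModularGroup.denom_apply]

lemma autj_ne_zero (γ : SL(2, ℤ)) (z : ℍ) : autj γ z ≠ 0 := by
  rw [autj_eq_denom]
  exact denom_ne_zero _ z

lemma autj_conj (γ : SL(2, ℤ)) (z : ℂ) : autj γ (conj z) = conj (autj γ z) := by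
  simp [autj]

lemma autj_conj_ne_zero (γ : SL(2, ℤ)) (z : ℍ) : autj γ (conj (z : ℂ)) ≠ 0 := by
  rw [autj_conj]
  exact star_ne_zero.2 (autj_ne_zero γ z)

lemma im_smul_eq (γ : SL(2, ℤ)) (z : ℍ) :
    ((γ • z : ℍ).im : ℂ) = z.im / (autj γ z * autj γ (conj (z : ℂ))) := by
  rw [ModularGroup.im_smul_eq_div_normSq, autj_conj, Complex.mul_conj, autj_eq_denom,
    Complex.ofReal_div]

lemma sub_conj_eq (z : ℍ) : (z : ℂ) - conj (z : ℂ) = 2 * Complex.I * z.im := by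
  rw [Complex.sub_conj, coe_im]
  push_cast
  ring

lemma hasWirtingerAt_autj (γ : SL(2, ℤ)) (z : ℍ) :
    HasWirtingerAt (fun z => autj γ z) z (γ 1 0) 0 := by
  refine hasWirtingerAt_of_hasDerivAt (g := autj γ) ?_
  have h := ((hasDerivAt_id (z : ℂ)).const_mul (γ 1 0 : ℂ)).add_const (γ 1 1 : ℂ)
  rwa [mul_one] at h

lemma hasDerivAt_smul (γ : SL(2, ℤ)) (z : ℍ) :
    HasDerivAt (fun w : ℂ => ((γ • ofComplex w : ℍ) : ℂ)) (1 / autj γ z ^ 2) z := by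
  have hdet : (γ : GL (Fin 2) ℝ).val.det = 1 :=
    (Matrix.SpecialLinearGroup.map (Int.castRingHom ℝ) γ).det_coe
  have h := (hasStrictDerivAt_smul (hdet.symm ▸ one_pos) z).hasDerivAt
  rwa [hdet, Complex.ofReal_one, ← autj_eq_denom] at h

lemma hasWirtingerAt_smul {f : ℍ → ℂ} {z : ℍ} {a b : ℂ} (γ : SL(2, ℤ))
    (h : HasWirtingerAt f (γ • z) a b) :
    HasWirtingerAt (fun z => f (γ • z)) z (a / autj γ z ^ 2) (b / conj (autj γ z) ^ 2) := by
  rw [HasWirtingerAt, show γ • z = γ • ofComplex (z : ℂ) by rw [ofComplex_apply]] at h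
  have hcomp := h.comp (z : ℂ) ((hasDerivAt_smul γ z).hasFDerivAt.restrictScalars ℝ)
  simp only [Function.comp_def, ofComplex_apply] at hcomp
  refine hasWirtingerAt_of_hasFDerivAt hcomp fun v => ?_
  simp only [one_div, ContinuousLinearMap.add_comp, ContinuousLinearMap.smul_comp,
    ContinuousLinearMap.id_comp, add_apply, smul_apply, ContinuousLinearMap.coe_restrictScalars',
    ContinuousLinearMap.toSpanSingleton_apply, smul_eq_mul, ContinuousLinearMap.comp_apply,
    ContinuousLinearEquiv.coe_coe, ContinuousAlgEquiv.coeCLE_apply, Complex.conjCAE_apply, map_mul,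
    map_inv₀, map_pow]
  ring

section Weight

variable {r s : ℤ} {f : ℍ → ℂ}

lemma HasWeight.star (hf : HasWeight r s f) : HasWeight s r (star f) := by
  intro γ z
  simp only [Pi.star_apply, hf γ z, star_mul', star_zpow₀, Complex.star_def, autj_conj,
    Complex.conj_conj]
  ring

lemma HasWeight.dz_smul (hf : HasWeight r s f)
    (hd : ∀ z : ℍ, DifferentiableAt ℝ (fun w : ℂ => f (ofComplex w)) z) (γ : SL(2, ℤ)) (z : ℍ) :
    dz f (γ • z) = autj γ z ^ 2 * (autj γ z ^ r * autj γ (conj (z : ℂ)) ^ s *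
      (r * γ 1 0 / autj γ z * f z + dz f z)) := by
  have hj := autj_ne_zero γ z
  have h₁ := hasWirtingerAt_smul γ (hasWirtingerAt_of_differentiableAt (hd (γ • z)))
  have hj' : Star.star (fun z : ℍ => autj γ z) z ≠ 0 := star_ne_zero.2 hj
  have h₂ := (((hasWirtingerAt_autj γ z).zpow hj r).mul
    ((hasWirtingerAt_autj γ z).star.zpow hj' s)).mul (hasWirtingerAt_of_differentiableAt (hd z))
  have hfun : (fun z => f (γ • z)) =
      (fun z : ℍ => autj γ z) ^ r * (Star.star fun z : ℍ => autj γ z) ^ s * f := by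
    funext w
    simp only [Pi.mul_apply, Pi.pow_apply, Pi.star_apply, Complex.star_def, hf γ w, autj_conj]
  rw [hfun] at h₁
  have h := h₁.dz_eq.symm.trans h₂.dz_eq
  simp only [Pi.mul_apply, Pi.pow_apply, Pi.star_apply, Complex.star_def, map_zero, mul_zero,
    add_zero, div_eq_iff (pow_ne_zero 2 hj)] at h
  rw [h, autj_conj, zpow_sub_one₀ hj]
  field_simp

lemma HasWeight.maass (hf : HasWeight r s f)
    (hd : ∀ z : ℍ, DifferentiableAt ℝ (fun w : ℂ => f (ofComplex w)) z) :
    HasWeight (r + 1) (s - 1) (maass r f) := by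
  intro γ z
  have hj := autj_ne_zero γ z
  have hj' := autj_conj_ne_zero γ z
  have key : 2 * Complex.I * z.im * (γ 1 0 : ℂ) + autj γ (conj (z : ℂ)) = autj γ z := by
    rw [← sub_conj_eq, autj, autj]
    ring
  simp only [ModIter.maass]
  rw [hf.dz_smul hd, hf γ z, im_smul_eq, zpow_sub_one₀ hj', zpow_add_one₀ hj]
  field_simp
  linear_combination r * f z * key

end Weight

lemma maassBar_eq_star_maass_star {f : ℍ → ℂ} (s : ℤ)
    (hd : ∀ z : ℍ, DifferentiableAt ℝ (fun w : ℂ => f (ofComplex w)) z) :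
    maassBar s f = star (maass s (star f)) := by
  funext z
  simp [maass, maassBar, (hasWirtingerAt_of_differentiableAt (hd z)).star.dz_eq]

lemma IsRealAnalytic.star {f : ℍ → ℂ} (hf : IsRealAnalytic f) : IsRealAnalytic (star f) :=
  (Complex.conjCLE : ℂ →L[ℝ] ℂ).comp_analyticOnNhd hf

lemma isRealAnalytic_im : IsRealAnalytic fun z => (z.im : ℂ) := by
  refine ((Complex.ofRealCLM.comp Complex.imCLM).analyticOnNhd _).congr
    (isOpen_lt continuous_const Complex.continuous_im) fun w hw => ?_
  simp [← coe_im, ofComplex_apply_of_im_pos hw]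

lemma IsRealAnalytic.dz {f : ℍ → ℂ} (hf : IsRealAnalytic f) : IsRealAnalytic (dz f) := by
  have h (v : ℂ) : AnalyticOnNhd ℝ (fun w => fderiv ℝ (fun w : ℂ => f (ofComplex w)) w v)
      {w : ℂ | 0 < w.im} :=
    (ContinuousLinearMap.apply ℝ ℂ v).comp_analyticOnNhd hf.fderiv
  refine (((h 1).sub (analyticOnNhd_const (v := Complex.I) |>.mul (h Complex.I))).div
    (analyticOnNhd_const (v := 2)) fun _ _ => two_ne_zero).congr
    (isOpen_lt continuous_const Complex.continuous_im) fun w hw => ?_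
  simp [ModIter.dz, ofComplex_apply_of_im_pos hw]

lemma IsRealAnalytic.maass {f : ℍ → ℂ} (hf : IsRealAnalytic f) (r : ℤ) :
    IsRealAnalytic (maass r f) :=
  ((analyticOnNhd_const.mul isRealAnalytic_im).mul hf.dz).add (analyticOnNhd_const.mul hf)

lemma mem_realAnForms {r s : ℤ} {f : ℍ → ℂ} (ha : IsRealAnalytic f) (hw : HasWeight r s f)
    (hf : f ∈ fourierExpansions) : f ∈ realAnForms r s :=
  ⟨ha, hasModerateGrowth_of_mem hf, hw, hasFourierExpansion_iff.2 hf⟩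

lemma star_mem_realAnForms {r s : ℤ} {f : ℍ → ℂ} (hf : f ∈ realAnForms r s) :
    star f ∈ realAnForms s r :=
  have ⟨ha, _, hw, hF⟩ := hf
  mem_realAnForms ha.star (HasWeight.star hw)
    (star_mem_fourierExpansions (hasFourierExpansion_iff.1 hF))

lemma maass_mem_realAnForms {r s : ℤ} {f : ℍ → ℂ} (hf : f ∈ realAnForms r s) :
    maass r f ∈ realAnForms (r + 1) (s - 1) :=
  have ⟨ha, _, hw, hF⟩ := hf
  mem_realAnForms (ha.maass r) (HasWeight.maass hw (differentiableAt_of_mem hf))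
    (maass_mem_fourierExpansions r (hasFourierExpansion_iff.1 hF))

lemma maassBar_mem_realAnForms {r s : ℤ} {f : ℍ → ℂ} (hf : f ∈ realAnForms r s) :
    maassBar s f ∈ realAnForms (r - 1) (s + 1) := by
  rw [maassBar_eq_star_maass_star s (differentiableAt_of_mem hf)]
  exact star_mem_realAnForms (maass_mem_realAnForms (star_mem_realAnForms hf))

lemma gradedM_mem_admissible : gradedM ∈ admissible := by
  refine ⟨le_rfl, fun F hF => Submodule.mem_sup_left fun p => ?_,
    fun F hF => Submodule.mem_sup_left fun p => ?_⟩
  · rw [del_apply]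
    simpa using maass_mem_realAnForms (hF (p.1 - 1, p.2 + 1))
  · rw [delBar_apply]
    simpa using maassBar_mem_realAnForms (hF (p.1 + 1, p.2 - 1))

lemma extMI_eq_gradedM : extMI = gradedM :=
  le_antisymm (sSup_le fun _ hN => hN.1) (le_sSup gradedM_mem_admissible)

lemma single_mem_gradedM {r s : ℤ} {f : ℍ → ℂ} (hf : f ∈ realAnForms r s) :
    Finsupp.single (r, s) f ∈ gradedM := fun p => by
  by_cases hp : p = (r, s)
  · rwa [hp, Finsupp.single_eq_same]
  · rw [Finsupp.single_eq_of_ne hp]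
    exact zero_mem _

/-! ### Expansions with holomorphic coefficients on the unit disc -/

/-- `A` is holomorphic on the open unit disc, the range of `q`. -/
def DiscHol (A : ℂ → ℂ) : Prop := DifferentiableOn ℂ A (ball 0 1)

lemma discHol_const (c : ℂ) : DiscHol fun _ => c := differentiableOn_const c

lemma DiscHol.analyticAt {A : ℂ → ℂ} (hA : DiscHol A) (z : ℍ) : AnalyticAt ℂ A (qpar z) :=
  DifferentiableOn.analyticAt hA (isOpen_ball.mem_nhds (qpar_mem_ball z))

lemma DiscHol.exists_hasSum {A : ℂ → ℂ} (hA : DiscHol A) :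
    ∃ c : ℕ → ℂ, ∀ q : ℂ, ‖q‖ < 1 → HasSum (fun n => c n * q ^ n) (A q) := by
  refine ⟨fun n => (n.factorial : ℂ)⁻¹ * iteratedDeriv n A 0, fun q hq => ?_⟩
  have h := Complex.hasSum_taylorSeries_on_ball hA (z := q) (by simpa using hq)
  simpa only [sub_zero, smul_eq_mul, mul_assoc, mul_comm (q ^ _)] using h

lemma DiscHol.exists_bound {A : ℂ → ℂ} (hA : DiscHol A) {ρ : ℝ} (hρ : ρ < 1) :
    ∃ M, ∀ q, ‖q‖ ≤ ρ → ‖A q‖ ≤ M := by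
  obtain ⟨M, hM⟩ := (isCompact_closedBall (0 : ℂ) ρ).exists_bound_of_continuousOn
    (hA.continuousOn.mono (closedBall_subset_ball hρ))
  exact ⟨M, fun q hq => hM q (by simpa using hq)⟩

lemma discHol_tsum {ι : Type*} {F : ι → ℂ → ℂ} (hF : ∀ i, DiscHol (F i))
    (hs : ∀ ρ : ℝ, 0 < ρ → ρ < 1 → ∃ u : ι → ℝ, Summable u ∧ ∀ i q, ‖q‖ < ρ → ‖F i q‖ ≤ u i) :
    DiscHol fun q => ∑' i, F i q := by
  intro q hq
  obtain ⟨ρ, h1, h2⟩ := exists_between (show ‖q‖ < 1 by simpa using hq)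
  obtain ⟨u, hu, hle⟩ := hs ρ ((norm_nonneg _).trans_lt h1) h2
  have hd := Complex.differentiableOn_tsum_of_summable_norm (F := F) (U := ball 0 ρ) hu
    (fun i => (hF i).mono (ball_subset_ball h2.le)) isOpen_ball
    (fun i q hq => hle i q (by simpa using hq))
  exact (hd.differentiableAt (isOpen_ball.mem_nhds (by simpa using h1))).differentiableWithinAt

lemma isRealAnalytic_yPow (j : ℤ) : IsRealAnalytic (yPow j) := fun w hw =>
  (isRealAnalytic_im w hw).zpow (im_ne_zero (ofComplex w))

lemma isRealAnalytic_comp_qpar {A : ℂ → ℂ} (hA : DiscHol A) : IsRealAnalytic (A ∘ qpar) := by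
  have key : AnalyticOnNhd ℝ (fun w : ℂ => A (Complex.exp (2 * Real.pi * Complex.I * w)))
      {w : ℂ | 0 < w.im} := by
    intro w hw
    have h : AnalyticAt ℂ (fun w : ℂ => A (Complex.exp (2 * Real.pi * Complex.I * w))) w :=
      AnalyticAt.fun_comp (f := fun w : ℂ => Complex.exp (2 * Real.pi * Complex.I * w))
        (hA.analyticAt ⟨w, hw⟩) (by fun_prop)
    exact h.restrictScalars
  refine key.congr (isOpen_lt continuous_const Complex.continuous_im) fun w hw => ?_
  simp only [Function.comp_apply, qpar, ofComplex_apply_of_im_pos hw]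

lemma comp_qpar_mul_star_mem_qqSeries {A B : ℂ → ℂ} (hA : DiscHol A) (hB : DiscHol B) :
    (A ∘ qpar) * star (B ∘ qpar) ∈ qqSeries := by
  obtain ⟨a, ha⟩ := hA.exists_hasSum
  obtain ⟨b, hb⟩ := hB.exists_hasSum
  have key (z : ℍ) : HasSum (fun p => qqTerm (fun p => a p.1 * conj (b p.2)) p z)
      (A (qpar z) * conj (B (qpar z))) := by
    have hAz := ha _ (norm_qpar_lt_one z)
    have hBz := Complex.hasSum_conj'.2 (hb _ (norm_qpar_lt_one z))
    have hsum := summable_mul_of_summable_norm hAz.summable.norm hBz.summable.norm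
    refine (hAz.mul hBz hsum).congr_fun fun p => ?_
    rw [qqTerm, map_mul, map_pow]
    ring
  exact ⟨_, key⟩

/-- The products `y ^ j A(q) conj (B(q))`, with `A` and `B` holomorphic on the unit disc. -/
def mixedMonomials : Submonoid (ℍ → ℂ) where
  carrier := {f | ∃ (j : ℤ) (A B : ℂ → ℂ), DiscHol A ∧ DiscHol B ∧
    f = yPow j * ((A ∘ qpar) * star (B ∘ qpar))}
  one_mem' := ⟨0, fun _ => 1, fun _ => 1, discHol_const 1, discHol_const 1, by
    funext z; simp [yPow]⟩
  mul_mem' := by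
    rintro _ _ ⟨i, A, B, hA, hB, rfl⟩ ⟨j, A', B', hA', hB', rfl⟩
    refine ⟨i + j, A * A', B * B', hA.mul hA', hB.mul hB', ?_⟩
    rw [← yPow_mul_yPow]
    funext z
    simp only [Pi.mul_apply, Function.comp_apply, Pi.star_apply, star_mul']
    ring

/-- The algebra of finite sums of products `y ^ j A(q) conj (B(q))`. -/
def mixed : Subalgebra ℂ (ℍ → ℂ) := Algebra.adjoin ℂ mixedMonomials

lemma yPow_mul_comp_qpar_mul_star_mem_mixed (j : ℤ) {A B : ℂ → ℂ} (hA : DiscHol A)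
    (hB : DiscHol B) : yPow j * ((A ∘ qpar) * star (B ∘ qpar)) ∈ mixed :=
  Algebra.subset_adjoin ⟨j, A, B, hA, hB, rfl⟩

lemma yPow_mul_comp_qpar_mem_mixed (j : ℤ) {A : ℂ → ℂ} (hA : DiscHol A) :
    yPow j * (A ∘ qpar) ∈ mixed := by
  convert yPow_mul_comp_qpar_mul_star_mem_mixed j hA (discHol_const 1) using 1
  funext z
  simp

lemma yPow_mem_mixed (j : ℤ) : yPow j ∈ mixed := by
  convert yPow_mul_comp_qpar_mem_mixed j (discHol_const 1) using 1
  funext z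
  simp

lemma comp_qpar_mem_mixed {A : ℂ → ℂ} (hA : DiscHol A) : A ∘ qpar ∈ mixed := by
  convert yPow_mul_comp_qpar_mem_mixed 0 hA using 1
  funext z
  simp [yPow]

lemma mixed_toSubmodule_le {S : Submodule ℂ (ℍ → ℂ)}
    (hS : ∀ (j : ℤ) (A B : ℂ → ℂ), DiscHol A → DiscHol B →
      yPow j * ((A ∘ qpar) * star (B ∘ qpar)) ∈ S) :
    Subalgebra.toSubmodule mixed ≤ S := by
  rw [mixed, Algebra.adjoin_eq_span, Submonoid.closure_eq, Submodule.span_le]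
  rintro _ ⟨j, A, B, hA, hB, rfl⟩
  exact hS j A B hA hB

lemma star_mem_mixed {f : ℍ → ℂ} (hf : f ∈ mixed) : star f ∈ mixed := by
  refine mixed_toSubmodule_le (S := (Subalgebra.toSubmodule mixed).comap
    (starLinearEquiv ℂ : (ℍ → ℂ) ≃ₗ⋆[ℂ] (ℍ → ℂ)).toLinearMap) (fun j A B hA hB => ?_) hf
  change star (yPow j * ((A ∘ qpar) * star (B ∘ qpar))) ∈ mixed
  rw [star_mul', star_mul', star_star, star_yPow, mul_comm (star _)]
  exact yPow_mul_comp_qpar_mul_star_mem_mixed j hB hA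

lemma mem_fourierExpansions_of_mem_mixed {f : ℍ → ℂ} (hf : f ∈ mixed) :
    f ∈ fourierExpansions :=
  mixed_toSubmodule_le (fun j _ _ hA hB =>
    yPow_mul_mem_fourierExpansions j (comp_qpar_mul_star_mem_qqSeries hA hB)) hf

lemma isRealAnalytic_of_mem_mixed {f : ℍ → ℂ} (hf : f ∈ mixed) : IsRealAnalytic f := by
  refine mixed_toSubmodule_le (S := {
    carrier := {f | IsRealAnalytic f}
    zero_mem' := analyticOnNhd_const
    add_mem' := fun hf hg => hf.add hg
    smul_mem' := fun c _ hf => analyticOnNhd_const.mul hf }) (fun j A B hA hB => ?_) hf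
  exact (isRealAnalytic_yPow j).mul
    ((isRealAnalytic_comp_qpar hA).mul (isRealAnalytic_comp_qpar hB).star)

lemma mem_realAnForms_of_mem_mixed {r s : ℤ} {f : ℍ → ℂ} (hf : f ∈ mixed)
    (hw : HasWeight r s f) : f ∈ realAnForms r s :=
  mem_realAnForms (isRealAnalytic_of_mem_mixed hf) hw (mem_fourierExpansions_of_mem_mixed hf)

/-- The finite sums of functions `y ^ j A(q)` and `y ^ j conj (A(q))`, with `A` holomorphic on the
unit disc. Unlike `mixed`, this space is stable under weighted averages over real translates. -/
def pureMixed : Submodule ℂ (ℍ → ℂ) :=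
  Submodule.span ℂ {f | ∃ (j : ℤ) (A : ℂ → ℂ), DiscHol A ∧
    (f = yPow j * (A ∘ qpar) ∨ f = yPow j * star (A ∘ qpar))}

lemma yPow_mul_comp_qpar_mem_pureMixed (j : ℤ) {A : ℂ → ℂ} (hA : DiscHol A) :
    yPow j * (A ∘ qpar) ∈ pureMixed :=
  Submodule.subset_span ⟨j, A, hA, Or.inl rfl⟩

lemma yPow_mul_star_comp_qpar_mem_pureMixed (j : ℤ) {A : ℂ → ℂ} (hA : DiscHol A) :
    yPow j * star (A ∘ qpar) ∈ pureMixed :=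
  Submodule.subset_span ⟨j, A, hA, Or.inr rfl⟩

lemma comp_qpar_mem_pureMixed {A : ℂ → ℂ} (hA : DiscHol A) : A ∘ qpar ∈ pureMixed := by
  convert yPow_mul_comp_qpar_mem_pureMixed 0 hA using 1
  funext z
  simp [yPow]

lemma star_mem_pureMixed {f : ℍ → ℂ} (hf : f ∈ pureMixed) : star f ∈ pureMixed := by
  suffices h : pureMixed ≤ pureMixed.comap
      (starLinearEquiv ℂ : (ℍ → ℂ) ≃ₗ⋆[ℂ] (ℍ → ℂ)).toLinearMap from h hf
  refine Submodule.span_le.2 ?_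
  rintro _ ⟨j, A, hA, rfl | rfl⟩
  · change star (yPow j * (A ∘ qpar)) ∈ pureMixed
    rw [star_mul', star_yPow]
    exact yPow_mul_star_comp_qpar_mem_pureMixed j hA
  · change star (yPow j * star (A ∘ qpar)) ∈ pureMixed
    rw [star_mul', star_yPow, star_star]
    exact yPow_mul_comp_qpar_mem_pureMixed j hA

lemma yPow_mul_mem_pureMixed (j : ℤ) {f : ℍ → ℂ} (hf : f ∈ pureMixed) :
    yPow j * f ∈ pureMixed := by
  suffices h : pureMixed ≤ pureMixed.comap (LinearMap.mulLeft ℂ (yPow j)) from h hf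
  refine Submodule.span_le.2 ?_
  rintro _ ⟨i, A, hA, rfl | rfl⟩ <;> change yPow j * (yPow i * _) ∈ pureMixed <;>
    rw [← mul_assoc, yPow_mul_yPow]
  · exact yPow_mul_comp_qpar_mem_pureMixed _ hA
  · exact yPow_mul_star_comp_qpar_mem_pureMixed _ hA

lemma mem_mixed_of_mem_pureMixed {f : ℍ → ℂ} (hf : f ∈ pureMixed) : f ∈ mixed := by
  suffices h : pureMixed ≤ Subalgebra.toSubmodule mixed from h hf
  refine Submodule.span_le.2 ?_
  rintro _ ⟨j, A, hA, rfl | rfl⟩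
  · exact yPow_mul_comp_qpar_mem_mixed j hA
  · exact mixed.mul_mem (yPow_mem_mixed j) (star_mem_mixed (comp_qpar_mem_mixed hA))

section Average

variable {ι : Type*} {w : ι → ℂ} {A : ℂ → ℂ}

lemma qpar_vadd (x : ℝ) (z : ℍ) :
    qpar (x +ᵥ z) = Complex.exp (2 * Real.pi * x * Complex.I) * qpar z := by
  rw [qpar, qpar, ← Complex.exp_add, coe_vadd]
  ring_nf

lemma qpar_int_vadd (l : ℤ) (z : ℍ) : qpar ((l : ℝ) +ᵥ z) = qpar z := by
  rw [qpar_vadd, show (2 * Real.pi * (l : ℝ) * Complex.I : ℂ) = l * (2 * Real.pi * Complex.I) by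
    push_cast; ring, Complex.exp_int_mul_two_pi_mul_I, one_mul]

lemma norm_exp_two_pi_mul_I (x : ℝ) : ‖Complex.exp (2 * Real.pi * x * Complex.I)‖ = 1 := by
  exact_mod_cast Complex.norm_exp_ofReal_mul_I (2 * Real.pi * x)

lemma DiscHol.exists_norm_mul_rotate_le (hA : DiscHol A) (w : ι → ℂ) (x : ι → ℝ) {ρ : ℝ}
    (hρ : ρ < 1) : ∃ M, ∀ i (q : ℂ), ‖q‖ ≤ ρ →
      ‖w i * A (Complex.exp (2 * Real.pi * x i * Complex.I) * q)‖ ≤ ‖w i‖ * M := by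
  obtain ⟨M, hM⟩ := hA.exists_bound hρ
  refine ⟨M, fun i q hq => ?_⟩
  rw [norm_mul]
  gcongr
  exact hM _ (by rwa [norm_mul, norm_exp_two_pi_mul_I, one_mul])

lemma DiscHol.summable_rotate (hA : DiscHol A) (hw : Summable fun i => ‖w i‖) (x : ι → ℝ) {q : ℂ}
    (hq : ‖q‖ < 1) : Summable fun i => w i * A (Complex.exp (2 * Real.pi * x i * Complex.I) * q) :=
  have ⟨M, hM⟩ := hA.exists_norm_mul_rotate_le w x hq
  .of_norm_bounded (hw.mul_right M) fun i => hM i q le_rfl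

lemma DiscHol.tsum_rotate (hA : DiscHol A) (hw : Summable fun i => ‖w i‖) (x : ι → ℝ) :
    DiscHol fun q => ∑' i, w i * A (Complex.exp (2 * Real.pi * x i * Complex.I) * q) := by
  refine discHol_tsum (fun i => ?_) fun ρ _ hρ => ?_
  · refine (DifferentiableOn.comp (t := ball 0 1) hA (by fun_prop) fun q hq => ?_).const_mul _
    simpa [norm_exp_two_pi_mul_I] using hq
  · obtain ⟨M, hM⟩ := hA.exists_norm_mul_rotate_le w x hρ
    exact ⟨_, hw.mul_right M, fun i q hq => hM i q hq.le⟩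

lemma average_yPow_mul_comp_qpar (hA : DiscHol A) (hw : Summable fun i => ‖w i‖) (x : ι → ℝ)
    (j : ℤ) : ∃ B, DiscHol B ∧ ∀ z,
      HasSum (fun i => w i * (yPow j * (A ∘ qpar)) (x i +ᵥ z)) ((yPow j * (B ∘ qpar)) z) := by
  refine ⟨_, hA.tsum_rotate hw x, fun z => ?_⟩
  refine ((hA.summable_rotate hw x (norm_qpar_lt_one z)).hasSum.mul_left
    (yPow j z)).congr_fun fun i => ?_
  simp only [Pi.mul_apply, Function.comp_apply, yPow, vadd_im, qpar_vadd]
  ring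

lemma average_mem_pureMixed (hw : Summable fun i => ‖w i‖) (x : ι → ℝ) {f : ℍ → ℂ}
    (hf : f ∈ pureMixed) : ∃ g ∈ pureMixed, ∀ z, HasSum (fun i => w i * f (x i +ᵥ z)) (g z) := by
  induction hf using Submodule.span_induction with
  | mem f hf =>
    obtain ⟨j, A, hA, rfl | rfl⟩ := hf
    · obtain ⟨B, hB, h⟩ := average_yPow_mul_comp_qpar hA hw x j
      exact ⟨_, yPow_mul_comp_qpar_mem_pureMixed j hB, h⟩
    · obtain ⟨B, hB, h⟩ := average_yPow_mul_comp_qpar hA (w := star w) (by simpa using hw) x j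
      refine ⟨_, yPow_mul_star_comp_qpar_mem_pureMixed j hB, fun z => ?_⟩
      have hstar (A : ℂ → ℂ) : yPow j * star (A ∘ qpar) = star (yPow j * (A ∘ qpar)) := by
        rw [star_mul', star_yPow]
      rw [hstar, hstar]
      simpa only [star_mul', Pi.star_apply, star_star] using (h z).star
  | zero => exact ⟨0, zero_mem _, fun z => by simp [hasSum_zero]⟩
  | add f₁ f₂ _ _ h₁ h₂ =>
    obtain ⟨g₁, hg₁, h₁⟩ := h₁
    obtain ⟨g₂, hg₂, h₂⟩ := h₂
    exact ⟨_, add_mem hg₁ hg₂, fun z => by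
      simpa only [Pi.add_apply, mul_add] using (h₁ z).add (h₂ z)⟩
  | smul c f _ h =>
    obtain ⟨g, hg, h⟩ := h
    exact ⟨_, Submodule.smul_mem _ c hg, fun z => by
      simpa only [Pi.smul_apply, smul_eq_mul, mul_left_comm] using (h z).mul_left c⟩

end Average

/-! ### The Lipschitz formula with two weights -/

/-- `∑_{l ∈ ℤ} (z + l)^{-r} (z̄ + l)^{-s}`, the function of Lipschitz' summation formula. -/
def lipSum (r s : ℤ) (z : ℍ) : ℂ :=
  ∑' l : ℤ, ((z : ℂ) + l) ^ (-r) * (conj (z : ℂ) + l) ^ (-s)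

lemma add_int_ne_zero (z : ℍ) (l : ℤ) : (z : ℂ) + l ≠ 0 := by
  intro h
  simpa [z.im_pos.ne'] using congrArg Complex.im h

lemma conj_add_int (z : ℍ) (l : ℤ) : conj (z : ℂ) + l = conj ((z : ℂ) + l) := by simp

lemma conj_add_int_ne_zero (z : ℍ) (l : ℤ) : conj (z : ℂ) + l ≠ 0 := by
  rw [conj_add_int]
  exact star_ne_zero.2 (add_int_ne_zero z l)

lemma norm_zpow_mul_zpow {a b : ℂ} (ha : a ≠ 0) (hab : ‖b‖ = ‖a‖) (r s : ℤ) :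
    ‖a ^ r * b ^ s‖ = ‖a‖ ^ (r + s) := by
  rw [norm_mul, norm_zpow, norm_zpow, hab, zpow_add₀ (norm_ne_zero_iff.2 ha)]

lemma summable_lipSum {r s : ℤ} (h : 2 ≤ r + s) (z : ℍ) :
    Summable fun l : ℤ => ((z : ℂ) + l) ^ (-r) * (conj (z : ℂ) + l) ^ (-s) := by
  refine Summable.of_norm ?_
  refine (EisensteinSeries.linear_right_summable (z : ℂ) 1 h).norm.congr fun l => ?_
  rw [norm_zpow_mul_zpow (add_int_ne_zero z l) (by rw [conj_add_int, RCLike.norm_conj]),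
    Int.cast_one, one_mul, norm_inv, norm_zpow, ← zpow_neg, neg_add]

lemma star_lipSum (r s : ℤ) : star (lipSum r s) = lipSum s r := by
  funext z
  rw [Pi.star_apply, Complex.star_def, lipSum, lipSum, Complex.conj_tsum]
  refine tsum_congr fun l => ?_
  simp only [map_mul, map_zpow₀, map_add, Complex.conj_conj, map_intCast]
  ring

lemma lipSum_sub_lipSum {r s : ℤ} (h : 3 ≤ r + s) :
    lipSum (r - 1) s - lipSum r (s - 1) = (2 * Complex.I) • (yPow 1 * lipSum r s) := by
  funext z
  simp only [Pi.sub_apply, Pi.smul_apply, Pi.mul_apply, smul_eq_mul, yPow, zpow_one, ← mul_assoc,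
    lipSum]
  rw [← (summable_lipSum (by linarith) z).tsum_sub (summable_lipSum (by linarith) z),
    ← tsum_mul_left]
  refine tsum_congr fun l => ?_
  rw [show -(r - 1) = -r + 1 by ring, show -(s - 1) = -s + 1 by ring,
    zpow_add_one₀ (add_int_ne_zero z l), zpow_add_one₀ (conj_add_int_ne_zero z l)]
  linear_combination ((z : ℂ) + l) ^ (-r) * (conj (z : ℂ) + l) ^ (-s) * sub_conj_eq z

lemma discHol_polylog (k : ℕ) : DiscHol fun q => ∑' n : ℕ, (n : ℂ) ^ k * q ^ n := by
  refine discHol_tsum (fun n => (by fun_prop : Differentiable ℂ _).differentiableOn)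
    fun ρ h0 hρ => ⟨fun n => (n : ℝ) ^ k * ρ ^ n, ?_, fun n q hq => ?_⟩
  · exact summable_pow_mul_geometric_of_norm_lt_one k (by rwa [Real.norm_of_nonneg h0.le])
  · rw [norm_mul, norm_pow, norm_pow, Complex.norm_natCast]
    exact mul_le_mul_of_nonneg_left (pow_le_pow_left₀ (norm_nonneg _) hq.le _) (by positivity)

lemma lipSum_zero_mem {r : ℤ} (hr : 2 ≤ r) : lipSum r 0 ∈ pureMixed := by
  obtain ⟨k, rfl⟩ : ∃ k : ℕ, r = k + 1 := ⟨(r - 1).toNat, by omega⟩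
  have hk : 1 ≤ k := by omega
  convert comp_qpar_mem_pureMixed ((discHol_polylog k).const_mul
    ((-2 * Real.pi * Complex.I) ^ (k + 1) / (k.factorial : ℂ))) using 1
  funext z
  refine Eq.trans ?_ (EisensteinSeries.qExpansion_identity hk z)
  refine tsum_congr fun l => ?_
  rw [neg_zero, zpow_zero, mul_one, zpow_neg, one_div]
  norm_cast

lemma hasSum_cotTerm (z : ℍ) :
    HasSum (cotTerm z) (Real.pi * Complex.cot (Real.pi * z) - 1 / z) := by
  rw [cot_series_rep' (coe_mem_integerComplement z)]
  exact (summable_cotTerm (coe_mem_integerComplement z)).hasSum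

lemma lipSum_one_one_eq_cot (z : ℍ) : 2 * Complex.I * z.im * lipSum 1 1 z =
    conj (Real.pi * Complex.cot (Real.pi * z)) - Real.pi * Complex.cot (Real.pi * z) := by
  have partial_fractions (l : ℤ) : 2 * Complex.I * z.im *
      (((z : ℂ) + l) ^ (-1 : ℤ) * (conj (z : ℂ) + l) ^ (-1 : ℤ)) =
      conj (1 / ((z : ℂ) + l)) - 1 / ((z : ℂ) + l) := by
    have h1 := add_int_ne_zero z l
    have h2 := conj_add_int_ne_zero z l
    rw [map_div₀, map_one, ← conj_add_int, ← sub_conj_eq, zpow_neg_one, zpow_neg_one]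
    field_simp
    ring
  have hL := (summable_lipSum (r := 1) (s := 1) le_rfl z).hasSum.mul_left (2 * Complex.I * z.im)
  simp only [partial_fractions] at hL
  have hcot := (hasSum_cotTerm z).star.sub (hasSum_cotTerm z)
  have hpairs := (hasSum_nat_add_iff' 1).2 hL.nat_add_neg
  have hterm (n : ℕ) : star (cotTerm (z : ℂ) n) - cotTerm (z : ℂ) n =
      conj (1 / ((z : ℂ) + ((n + 1 : ℕ) : ℤ))) - 1 / ((z : ℂ) + ((n + 1 : ℕ) : ℤ)) +
        (conj (1 / ((z : ℂ) + (-((n + 1 : ℕ) : ℤ) : ℤ))) -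
          1 / ((z : ℂ) + (-((n + 1 : ℕ) : ℤ) : ℤ))) := by
    simp only [cotTerm, Complex.star_def, map_add]
    push_cast
    rw [← sub_eq_add_neg]
    ring
  simp only [hterm] at hcot
  have h := hpairs.unique hcot
  simp only [Finset.range_one, Finset.sum_singleton, Nat.cast_zero, neg_zero, Int.cast_zero,
    add_zero, Complex.star_def, map_sub] at h
  rw [lipSum]
  linear_combination h

lemma discHol_cot :
    DiscHol fun q => Real.pi * Complex.I - 2 * Real.pi * Complex.I * (1 - q)⁻¹ := by
  refine (differentiableOn_const _).sub
    ((DifferentiableOn.inv (by fun_prop) fun q hq h => ?_).const_mul _)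
  simp [← sub_eq_zero.1 h] at hq

lemma pi_mul_cot_mem_pureMixed :
    (fun z : ℍ => Real.pi * Complex.cot (Real.pi * z)) ∈ pureMixed := by
  convert comp_qpar_mem_pureMixed discHol_cot using 1
  funext z
  rw [pi_mul_cot_pi_q_exp]
  exact congrArg _ (congrArg _ (tsum_geometric_of_norm_lt_one (norm_qpar_lt_one z)))

lemma mem_pureMixed_of_yPow_mul_mem {j : ℤ} {f : ℍ → ℂ} {c : ℂ} (hc : c ≠ 0)
    (h : c • (yPow j * f) ∈ pureMixed) : f ∈ pureMixed := by
  convert yPow_mul_mem_pureMixed (-j) (Submodule.smul_mem _ c⁻¹ h) using 1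
  funext z
  rw [inv_smul_smul₀ hc, ← mul_assoc, yPow_mul_yPow]
  simp [yPow]

lemma lipSum_one_one_mem : lipSum 1 1 ∈ pureMixed := by
  refine mem_pureMixed_of_yPow_mul_mem (j := 1) (mul_ne_zero two_ne_zero Complex.I_ne_zero) ?_
  convert sub_mem (star_mem_pureMixed pi_mul_cot_mem_pureMixed) pi_mul_cot_mem_pureMixed using 1
  funext z
  simp only [Pi.smul_apply, Pi.mul_apply, smul_eq_mul, yPow, zpow_one, ← mul_assoc,
    lipSum_one_one_eq_cot]
  rfl

lemma lipSum_natCast_mem (r s : ℕ) (h : 2 ≤ r + s) : lipSum r s ∈ pureMixed := by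
  induction r generalizing s with
  | zero =>
    rw [← star_lipSum]
    exact star_mem_pureMixed (lipSum_zero_mem (by omega))
  | succ r ihr =>
    induction s with
    | zero => exact lipSum_zero_mem (by omega)
    | succ s ihs =>
      obtain ⟨rfl, rfl⟩ | h' : (r = 0 ∧ s = 0) ∨ 1 ≤ r + s := by omega
      · simpa using lipSum_one_one_mem
      · refine mem_pureMixed_of_yPow_mul_mem (j := 1) (mul_ne_zero two_ne_zero Complex.I_ne_zero) ?_
        rw [← lipSum_sub_lipSum (by omega)]
        exact sub_mem (by simpa using ihr (s + 1) (by omega)) (by simpa using ihs (by omega))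

lemma lipSum_neg_natCast_mem (r : ℤ) (m : ℕ) (h : 2 ≤ r - m) : lipSum r (-m) ∈ pureMixed := by
  induction m generalizing r with
  | zero => simpa using lipSum_zero_mem (by simpa using h)
  | succ m ih =>
    have hrec := lipSum_sub_lipSum (r := r) (s := -m) (by omega)
    rw [sub_eq_iff_eq_add', ← sub_eq_iff_eq_add, ← neg_add', ← Nat.cast_succ] at hrec
    rw [← hrec]
    exact sub_mem (ih (r - 1) (by omega))
      (Submodule.smul_mem _ _ (yPow_mul_mem_pureMixed 1 (ih r (by omega))))

lemma lipSum_mem {r s : ℤ} (h : 2 ≤ r + s) : lipSum r s ∈ pureMixed := by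
  obtain ⟨m, rfl | rfl⟩ := s.eq_nat_or_neg
  · obtain ⟨n, rfl | rfl⟩ := r.eq_nat_or_neg
    · exact lipSum_natCast_mem n m (by omega)
    · rw [← star_lipSum]
      exact star_mem_pureMixed (lipSum_neg_natCast_mem m n (by omega))
  · exact lipSum_neg_natCast_mem r m (by omega)

/-! ### Double series with periodic coefficients -/

lemma natCast_mul_add_intCast_ne_zero (z : ℍ) (p : ℕ+ × ℤ) :
    ((p.1 : ℕ) : ℂ) * z + p.2 ≠ 0 := by
  intro h
  simpa [z.im_pos.ne'] using congrArg Complex.im h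

lemma natCast_mul_im_le (z : ℍ) (p : ℕ+ × ℤ) :
    ((p.1 : ℕ) : ℝ) * z.im ≤ ‖((p.1 : ℕ) : ℂ) * z + p.2‖ := by
  simpa [abs_mul, abs_of_pos z.im_pos] using Complex.abs_im_le_norm (((p.1 : ℕ) : ℂ) * z + p.2)

lemma summable_norm_linear {w : ℤ} (hw : 3 ≤ w) (z : ℍ) :
    Summable fun p : ℤ × ℤ => ‖(p.1 : ℂ) * z + p.2‖ ^ (-w) := by
  rw [← (finTwoArrowEquiv ℤ).summable_iff]
  refine (EisensteinSeries.summable_norm_eisSummand hw z).congr fun p => ?_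
  rw [EisensteinSeries.eisSummand, norm_zpow]
  rfl

/-- The summand `κ(c, d) (c z + d)^{-r} (c z̄ + d)^{-s}` of a double series over `c ≥ 1` and
`d ∈ ℤ`. -/
def pairTerm (κ : ℕ+ → ℤ → ℂ) (r s : ℤ) (z : ℍ) (p : ℕ+ × ℤ) : ℂ :=
  κ p.1 p.2 *
    ((((p.1 : ℕ) : ℂ) * z + p.2) ^ (-r) * (((p.1 : ℕ) : ℂ) * conj (z : ℂ) + p.2) ^ (-s))

lemma norm_pairTerm (κ : ℕ+ → ℤ → ℂ) (r s : ℤ) (z : ℍ) (p : ℕ+ × ℤ) :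
    ‖pairTerm κ r s z p‖ = ‖κ p.1 p.2‖ * ‖((p.1 : ℕ) : ℂ) * z + p.2‖ ^ (-(r + s)) := by
  have hconj : ((p.1 : ℕ) : ℂ) * conj (z : ℂ) + p.2 = conj (((p.1 : ℕ) : ℂ) * z + p.2) := by simp
  rw [pairTerm, norm_mul, hconj, norm_zpow_mul_zpow (natCast_mul_add_intCast_ne_zero z p)
    (RCLike.norm_conj _), neg_add]

lemma summable_pairTerm {κ : ℕ+ → ℤ → ℂ} {C : ℝ} (hC : ∀ c d, ‖κ c d‖ ≤ C * (c : ℕ)) {r s : ℤ}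
    (h : 4 ≤ r + s) (z : ℍ) : Summable (pairTerm κ r s z) := by
  have hinj : Function.Injective (fun p : ℕ+ × ℤ => (((p.1 : ℕ) : ℤ), p.2)) := by
    rintro ⟨a, b⟩ ⟨a', b'⟩ h
    simpa using h
  refine Summable.of_norm_bounded (((summable_norm_linear (w := r + s - 1) (by omega)
    z).comp_injective hinj).mul_left (C / z.im)) fun p => ?_
  have hpos := norm_pos_iff.2 (natCast_mul_add_intCast_ne_zero z p)
  have hC0 : 0 ≤ C := by simpa using (norm_nonneg _).trans (hC 1 0)
  have hle := natCast_mul_im_le z p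
  have := z.im_pos
  simp only [Function.comp_apply, Int.cast_natCast]
  rw [norm_pairTerm, show -(r + s - 1) = -(r + s) + 1 by ring, zpow_add_one₀ hpos.ne']
  calc ‖κ p.1 p.2‖ * ‖((p.1 : ℕ) : ℂ) * z + p.2‖ ^ (-(r + s))
      ≤ C * (p.1 : ℕ) * ‖((p.1 : ℕ) : ℂ) * z + p.2‖ ^ (-(r + s)) := by
        gcongr
        exact hC _ _
    _ = C / z.im * (‖((p.1 : ℕ) : ℂ) * z + p.2‖ ^ (-(r + s)) * ((p.1 : ℕ) * z.im)) := by
        field_simp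
    _ ≤ _ := by gcongr

/-- The decomposition `d = l c + e`, `0 ≤ e < c`, of the second entry of a pair `(c, d)`. -/
def pairEquiv : (Σ c : ℕ+, Fin (c : ℕ)) × ℤ ≃ ℕ+ × ℤ :=
  ((Equiv.sigmaProdDistrib _ _).trans (Equiv.sigmaCongrRight fun c : ℕ+ =>
    (Equiv.prodComm _ _).trans (Int.divModEquiv (c : ℕ)).symm)).trans (Equiv.sigmaEquivProd _ _)

lemma pairEquiv_apply (i : Σ c : ℕ+, Fin (c : ℕ)) (l : ℤ) :
    pairEquiv (i, l) = (i.1, l * (i.1 : ℕ) + (i.2 : ℕ)) := rfl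

lemma summable_norm_residues {κ : ℕ+ → ℤ → ℂ} {C : ℝ} (hC : ∀ c d, ‖κ c d‖ ≤ C * (c : ℕ)) {w : ℤ}
    (h : 4 ≤ w) : Summable fun i : Σ c : ℕ+, Fin (c : ℕ) =>
      ‖κ i.1 (i.2 : ℕ) * ((i.1 : ℕ) : ℂ) ^ (-w)‖ := by
  have hC0 : 0 ≤ C := by simpa using (norm_nonneg _).trans (hC 1 0)
  refine (summable_sigma_of_nonneg fun _ => norm_nonneg _).2 ⟨fun c => Summable.of_finite, ?_⟩
  refine Summable.of_nonneg_of_le (fun c => tsum_nonneg fun _ => norm_nonneg _) (fun c => ?_)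
    (((Real.summable_nat_pow_inv.2 one_lt_two).comp_injective PNat.coe_injective).mul_left C)
  have hc : (1 : ℝ) ≤ (c : ℕ) := by exact_mod_cast one_le (a := c)
  rw [tsum_fintype]
  calc ∑ d : Fin (c : ℕ), ‖κ c (d : ℕ) * ((c : ℕ) : ℂ) ^ (-w)‖
      ≤ ∑ _d : Fin (c : ℕ), C * (c : ℕ) * ((c : ℕ) : ℝ) ^ (-4 : ℤ) := by
        refine Finset.sum_le_sum fun d _ => ?_
        rw [norm_mul, norm_zpow, Complex.norm_natCast]
        gcongr
        exact hC c (d : ℕ)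
    _ = C * (((c : ℕ) : ℝ) ^ 2)⁻¹ := by
        rw [Finset.sum_const, Finset.card_univ, Fintype.card_fin, nsmul_eq_mul, zpow_neg,
          zpow_ofNat]
        field_simp

lemma tsum_pairTerm_mem {κ : ℕ+ → ℤ → ℂ}
    (hκ : ∀ (c : ℕ+) (d l : ℤ), κ c (l * (c : ℕ) + d) = κ c d) {C : ℝ}
    (hC : ∀ c d, ‖κ c d‖ ≤ C * (c : ℕ)) {r s : ℤ} (h : 4 ≤ r + s) :
    (fun z => ∑' p, pairTerm κ r s z p) ∈ pureMixed := by
  obtain ⟨g, hg, hsum⟩ := average_mem_pureMixed (summable_norm_residues hC h)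
    (fun i => ((i.2 : ℕ) : ℝ) / (i.1 : ℕ)) (lipSum_mem (r := r) (s := s) (by omega))
  convert hg using 2 with z
  rw [← (hsum z).tsum_eq, ← pairEquiv.tsum_eq]
  refine ((pairEquiv.summable_iff.2 (summable_pairTerm hC h z)).tsum_prod).trans ?_
  refine tsum_congr fun i => ?_
  rw [lipSum, ← tsum_mul_left]
  refine tsum_congr fun l => ?_
  have hc : ((i.1 : ℕ) : ℂ) ≠ 0 := by exact_mod_cast i.1.ne_zero
  have factor_out (v : ℂ) : ((i.1 : ℕ) : ℂ) * v + (l * (i.1 : ℕ) + (i.2 : ℕ)) =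
      ((i.1 : ℕ) : ℂ) * (((i.2 : ℕ) : ℂ) / (i.1 : ℕ) + v + l) := by
    field_simp
    ring
  rw [Function.comp_apply, pairEquiv_apply, pairTerm, hκ]
  simp only [coe_vadd, map_add, Complex.conj_ofReal]
  push_cast
  rw [factor_out, factor_out, mul_zpow, mul_zpow, neg_add, zpow_add₀ hc]
  ring

/-! ### Integrals of `q`-series against polynomials -/

lemma DiscHol.exists_factor {A : ℂ → ℂ} (hA : DiscHol A) (h0 : A 0 = 0) :
    ∃ B, DiscHol B ∧ ∀ q, A q = q * B q := by
  refine ⟨dslope A 0, (Complex.differentiableOn_dslope (ball_mem_nhds 0 one_pos)).2 hA,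
    fun q => ?_⟩
  simpa only [sub_zero, smul_eq_mul, h0] using (sub_smul_dslope A 0 q).symm

/-- `H` is the primitive of the differential form `A(q) dq / q` on the unit disc that vanishes at
the origin. -/
structure IsLogPrimitive (A H : ℂ → ℂ) : Prop where
  map_zero : H 0 = 0
  exists_hasDerivAt : ∀ q ∈ ball (0 : ℂ) 1, ∃ D, HasDerivAt H D q ∧ q * D = A q

lemma IsLogPrimitive.discHol {A H : ℂ → ℂ} (h : IsLogPrimitive A H) : DiscHol H := fun q hq =>
  have ⟨_, hD, _⟩ := h.exists_hasDerivAt q hq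
  hD.differentiableAt.differentiableWithinAt

lemma DiscHol.exists_isLogPrimitive {A : ℂ → ℂ} (hA : DiscHol A) (h0 : A 0 = 0) :
    ∃ H, IsLogPrimitive A H := by
  obtain ⟨B, hB, hAB⟩ := hA.exists_factor h0
  obtain ⟨H, hH0, hH⟩ := (DifferentiableOn.isExactOn_ball hB).with_val_at 0 0
  exact ⟨H, hH0, fun q hq => ⟨B q, hH q hq, (hAB q).symm⟩⟩

/-- The value of `q` at the point `z + i t`, where `q` is its value at `z`. -/
def qshift (q : ℂ) (t : ℝ) : ℂ := q * Real.exp (-(2 * Real.pi) * t)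

lemma qshift_zero (q : ℂ) : qshift q 0 = q := by simp [qshift]

lemma norm_qshift (q : ℂ) (t : ℝ) : ‖qshift q t‖ = ‖q‖ * Real.exp (-(2 * Real.pi) * t) := by
  rw [qshift, norm_mul, Complex.norm_real, Real.norm_of_nonneg (Real.exp_pos _).le]

lemma norm_qshift_le (q : ℂ) {t : ℝ} (ht : 0 ≤ t) : ‖qshift q t‖ ≤ ‖q‖ := by
  rw [norm_qshift]
  refine mul_le_of_le_one_right (norm_nonneg _) (Real.exp_le_one_iff.2 ?_)
  exact mul_nonpos_of_nonpos_of_nonneg (neg_nonpos.2 Real.two_pi_pos.le) ht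

lemma qshift_mem_ball {q : ℂ} (hq : q ∈ ball (0 : ℂ) 1) {t : ℝ} (ht : 0 ≤ t) :
    qshift q t ∈ ball (0 : ℂ) 1 := by
  rw [mem_ball_zero_iff] at hq ⊢
  exact (norm_qshift_le q ht).trans_lt hq

lemma hasDerivAt_qshift (q : ℂ) (t : ℝ) :
    HasDerivAt (qshift q) (-(2 * Real.pi) * qshift q t) t := by
  refine (((hasDerivAt_id t).const_mul (-(2 * Real.pi))).exp.ofReal_comp.const_mul q).congr_deriv ?_
  simp only [qshift, id_eq, mul_one]
  push_cast
  ring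

lemma continuous_qshift (q : ℂ) : Continuous (qshift q) := by unfold qshift; fun_prop

lemma IsLogPrimitive.hasDerivAt_qshift {A H : ℂ → ℂ} (h : IsLogPrimitive A H) {q : ℂ}
    (hq : q ∈ ball (0 : ℂ) 1) {t : ℝ} (ht : 0 ≤ t) :
    HasDerivAt (fun t => H (qshift q t)) (-(2 * Real.pi) * A (qshift q t)) t := by
  obtain ⟨D, hD, hqD⟩ := h.exists_hasDerivAt _ (qshift_mem_ball hq ht)
  refine (HasDerivAt.comp_of_eq (h₂ := H) t hD (ModIter.hasDerivAt_qshift q t) rfl).congr_deriv ?_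
  rw [← hqD]
  ring

section

variable {A : ℂ → ℂ} (hA : DiscHol A) (h0 : A 0 = 0) {q : ℂ} (hq : q ∈ ball (0 : ℂ) 1)

include hA hq in
lemma DiscHol.continuousOn_qshift_mul (P : Polynomial ℂ) :
    ContinuousOn (fun t : ℝ => A (qshift q t) * P.eval (t : ℂ)) (Set.Ici 0) :=
  (hA.continuousOn.comp (continuous_qshift q).continuousOn fun _ ht => qshift_mem_ball hq ht).mul
    (by fun_prop)

include hA h0 hq

lemma DiscHol.isBigO_qshift :
    (fun t => A (qshift q t)) =O[atTop] fun t => Real.exp (-(2 * Real.pi) * t) := by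
  obtain ⟨B, hB, hAB⟩ := hA.exists_factor h0
  obtain ⟨M, hM⟩ := hB.exists_bound (mem_ball_zero_iff.1 hq)
  refine IsBigO.of_bound (‖q‖ * M) ((eventually_ge_atTop 0).mono fun t ht => ?_)
  rw [hAB, norm_mul, norm_qshift, mul_right_comm, Real.norm_of_nonneg (Real.exp_pos _).le]
  gcongr
  exact hM _ (norm_qshift_le q ht)

lemma DiscHol.isBigO_qshift_mul (P : Polynomial ℂ) :
    (fun t : ℝ => A (qshift q t) * P.eval (t : ℂ)) =O[atTop] fun t => Real.exp (-Real.pi * t) := by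
  have hP : (fun t : ℝ => P.eval (t : ℂ)) =O[atTop] fun t => Real.exp (Real.pi * t) := by
    have hpow (e : ℕ) : (fun t : ℝ => (t : ℂ) ^ e) =O[atTop] fun t => Real.exp (Real.pi * t) := by
      refine IsBigO.of_norm_left ?_
      simpa only [norm_pow, Complex.norm_real] using
        (isLittleO_pow_exp_pos_mul_atTop e Real.pi_pos).isBigO.norm_left
    simp only [Polynomial.eval_eq_sum_range]
    exact IsBigO.fun_sum fun e _ => (hpow e).const_mul_left (P.coeff e)
  refine ((hA.isBigO_qshift h0 hq).mul hP).congr_right fun t => ?_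
  rw [← Real.exp_add]
  ring_nf

lemma DiscHol.integrableOn_qshift_mul (P : Polynomial ℂ) :
    IntegrableOn (fun t : ℝ => A (qshift q t) * P.eval (t : ℂ)) (Set.Ioi 0) :=
  (integrableOn_Ici_iff_integrableOn_Ioi (by finiteness)).1 <|
    ((hA.continuousOn_qshift_mul hq P).locallyIntegrableOn measurableSet_Ici)
      |>.integrableOn_of_isBigO_atTop (hA.isBigO_qshift_mul h0 hq P)
        ⟨Set.Ioi 0, Ioi_mem_atTop 0, exp_neg_integrableOn_Ioi 0 Real.pi_pos⟩

lemma DiscHol.tendsto_qshift_mul (P : Polynomial ℂ) :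
    Tendsto (fun t : ℝ => A (qshift q t) * P.eval (t : ℂ)) atTop (𝓝 0) := by
  refine (hA.isBigO_qshift_mul h0 hq P).trans_tendsto (Real.tendsto_exp_atBot.comp ?_)
  exact tendsto_id.const_mul_atTop_of_neg (neg_lt_zero.2 Real.pi_pos)

end

/-- The integral `∫_0^∞ A(q(z + i t)) P(t) dt`, as a function of `q = q(z)`. -/
def discInt (A : ℂ → ℂ) (P : Polynomial ℂ) (q : ℂ) : ℂ :=
  ∫ t in Set.Ioi (0 : ℝ), A (qshift q t) * P.eval (t : ℂ)

lemma discInt_C_mul (A : ℂ → ℂ) (c : ℂ) (P : Polynomial ℂ) (q : ℂ) :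
    discInt A (Polynomial.C c * P) q = c * discInt A P q := by
  simp only [discInt, Polynomial.eval_mul, Polynomial.eval_C, mul_left_comm _ c,
    integral_const_mul]

lemma discInt_finsetSum {A : ℂ → ℂ} (hA : DiscHol A) (h0 : A 0 = 0) {ι : Type*} (s : Finset ι)
    (P : ι → Polynomial ℂ) {q : ℂ} (hq : q ∈ ball (0 : ℂ) 1) :
    discInt A (∑ i ∈ s, P i) q = ∑ i ∈ s, discInt A (P i) q := by
  simp only [discInt, Polynomial.eval_finsetSum, Finset.mul_sum]
  exact integral_finsetSum _ fun i _ => hA.integrableOn_qshift_mul h0 hq (P i)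

lemma discInt_eq_add_derivative {A H : ℂ → ℂ} (hA : DiscHol A) (h0 : A 0 = 0)
    (hH : IsLogPrimitive A H) (P : Polynomial ℂ) {q : ℂ} (hq : q ∈ ball (0 : ℂ) 1) :
    discInt A P q =
      (2 * Real.pi : ℂ)⁻¹ * (H q * P.eval 0 + discInt H P.derivative q) := by
  have hderiv (t : ℝ) (ht : t ∈ Set.Ici (0 : ℝ)) :
      HasDerivAt (fun t : ℝ => H (qshift q t) * P.eval (t : ℂ))
        (-(2 * Real.pi) * (A (qshift q t) * P.eval (t : ℂ)) +
          H (qshift q t) * P.derivative.eval (t : ℂ)) t := by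
    refine ((hH.hasDerivAt_qshift hq ht).mul (P.hasDerivAt (t : ℂ)).comp_ofReal).congr_deriv ?_
    ring
  have hint := hA.integrableOn_qshift_mul h0 hq P
  have hint' := hH.discHol.integrableOn_qshift_mul hH.map_zero hq P.derivative
  have hparts := integral_Ioi_of_hasDerivAt_of_tendsto' hderiv ((hint.const_mul _).add hint')
    (hH.discHol.tendsto_qshift_mul hH.map_zero hq P)
  rw [integral_add (hint.const_mul _) hint', integral_const_mul, qshift_zero,
    Complex.ofReal_zero] at hparts
  simp only [discInt]
  have hpi : (Real.pi : ℂ) ≠ 0 := by exact_mod_cast Real.pi_ne_zero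
  field_simp
  linear_combination -hparts

/-- Integrating by parts lowers the degree of the polynomial, whence an induction principle for
statements on integrals `discInt A P`. -/
lemma discHol_polynomial_induction {motive : (ℂ → ℂ) → Polynomial ℂ → Prop}
    (zero : ∀ A, motive A 0)
    (step : ∀ A H P, DiscHol A → A 0 = 0 → IsLogPrimitive A H → motive H P.derivative → motive A P)
    {A : ℂ → ℂ} (hA : DiscHol A) (h0 : A 0 = 0) (P : Polynomial ℂ) : motive A P := by
  suffices h : ∀ (n : ℕ) (A : ℂ → ℂ) (P : Polynomial ℂ), DiscHol A → A 0 = 0 →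
      Polynomial.derivative^[n] P = 0 → motive A P from
    h (P.natDegree + 1) A P hA h0 (Polynomial.iterate_derivative_eq_zero (Nat.lt_succ_self _))
  intro n
  induction n with
  | zero =>
    rintro A P - - rfl
    exact zero A
  | succ n ih =>
    intro A P hA h0 hP
    obtain ⟨H, hH⟩ := hA.exists_isLogPrimitive h0
    exact step A H P hA h0 hH
      (ih H _ hH.discHol hH.map_zero (by rwa [← Function.iterate_succ_apply]))

lemma discHol_discInt {A : ℂ → ℂ} (hA : DiscHol A) (h0 : A 0 = 0) (P : Polynomial ℂ) :
    DiscHol (discInt A P) := by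
  refine discHol_polynomial_induction (motive := fun A P => DiscHol (discInt A P)) (fun A => ?_)
    (fun A H P hA h0 hH ih => ?_) hA h0 P
  · convert discHol_const 0 using 1
    funext q
    simp [discInt]
  · exact ((hH.discHol.mul_const _).add ih |>.const_mul _).congr
      fun q hq => discInt_eq_add_derivative hA h0 hH P hq

/-- The fundamental theorem of calculus for the integral of `A(q(w)) P(w) dw` along the vertical
line from `z` to the cusp, parametrised by `w = z + i t`. -/
lemma hasDerivAt_discInt_comp {A : ℂ → ℂ} (hA : DiscHol A) (h0 : A 0 = 0) (P : Polynomial ℂ)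
    {z : ℂ} (hz : Complex.exp (2 * Real.pi * Complex.I * z) ∈ ball (0 : ℂ) 1) :
    HasDerivAt (fun w => discInt A
        (P.comp (Polynomial.C w + Polynomial.C Complex.I * Polynomial.X))
        (Complex.exp (2 * Real.pi * Complex.I * w)))
      (Complex.I * (A (Complex.exp (2 * Real.pi * Complex.I * z)) * P.eval z)) z := by
  refine discHol_polynomial_induction (motive := fun A P => HasDerivAt (fun w => discInt A
    (P.comp (Polynomial.C w + Polynomial.C Complex.I * Polynomial.X))
    (Complex.exp (2 * Real.pi * Complex.I * w)))
      (Complex.I * (A (Complex.exp (2 * Real.pi * Complex.I * z)) * P.eval z)) z) (fun A => ?_)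
    (fun A H P hA h0 hH ih => ?_) hA h0 P
  · simpa [discInt] using hasDerivAt_const z (0 : ℂ)
  · have hexp : HasDerivAt (fun w => Complex.exp (2 * Real.pi * Complex.I * w))
        (Complex.exp (2 * Real.pi * Complex.I * z) * (2 * Real.pi * Complex.I)) z := by
      simpa using ((hasDerivAt_id z).const_mul (2 * Real.pi * Complex.I)).cexp
    obtain ⟨D, hD, hqD⟩ := hH.exists_hasDerivAt _ hz
    have hpi : (Real.pi : ℂ) ≠ 0 := by exact_mod_cast Real.pi_ne_zero
    refine ((((hD.comp_of_eq z hexp rfl).mul (P.hasDerivAt z)).add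
      (ih.const_mul Complex.I)).const_mul (2 * Real.pi : ℂ)⁻¹).congr_of_eventuallyEq ?_
      |>.congr_deriv ?_
    · filter_upwards [hexp.continuousAt.eventually_mem (isOpen_ball.mem_nhds hz)] with w hw
      rw [discInt_eq_add_derivative hA h0 hH _ hw, Polynomial.derivative_comp,
        show Polynomial.derivative (Polynomial.C w + Polynomial.C Complex.I * Polynomial.X) =
          Polynomial.C Complex.I by simp, mul_comm (Polynomial.C _), discInt_C_mul]
      simp
    · rw [← hqD, Function.comp_apply]
      field_simp
      linear_combination Polynomial.eval z P.derivative *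
        H (Complex.exp (2 * Real.pi * Complex.I * z)) * Complex.I_sq

/-! ### Eichler integrals of cusp forms -/

/-- The `q`-expansion of a cusp form, as a function on the unit disc. -/
def cuspDisc {k : ℤ} (f : CuspForm 𝒮ℒ k) : ℂ → ℂ := cuspFunction 1 f

section

variable {k : ℤ} (f : CuspForm 𝒮ℒ k)

lemma discHol_cuspDisc : DiscHol (cuspDisc f) := fun q hq =>
  (ModularFormClass.differentiableAt_cuspFunction f one_pos one_mem_strictPeriods_SL
    (by simpa using hq)).differentiableWithinAt

lemma cuspDisc_zero : cuspDisc f 0 = 0 :=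
  CuspFormClass.cuspFunction_apply_zero f one_pos one_mem_strictPeriods_SL

lemma cuspDisc_qpar (z : ℍ) : cuspDisc f (qpar z) = f z := by
  rw [← SlashInvariantFormClass.eq_cuspFunction f z one_mem_strictPeriods_SL one_ne_zero, cuspDisc,
    qpar, Function.Periodic.qParam, Complex.ofReal_one, div_one]

lemma add_I_mul_im_pos (z : ℍ) {t : ℝ} (ht : 0 ≤ t) : 0 < ((z : ℂ) + Complex.I * t).im := by
  simpa using add_pos_of_pos_of_nonneg z.im_pos ht

lemma cuspDisc_qshift_qpar (z : ℍ) {t : ℝ} (ht : 0 ≤ t) :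
    cuspDisc f (qshift (qpar z) t) = f (ofComplex ((z : ℂ) + Complex.I * t)) := by
  rw [ofComplex_apply_of_im_pos (add_I_mul_im_pos z ht), ← cuspDisc_qpar]
  congr 1
  rw [qshift, qpar, qpar, Complex.ofReal_exp, ← Complex.exp_add]
  congr 1
  push_cast
  linear_combination -2 * Real.pi * t * Complex.I_sq

lemma integralFromCusp_mul_eval (P : Polynomial ℂ) (z : ℍ) :
    integralFromCusp (fun w => f (ofComplex w) * P.eval w) z = -Complex.I * discInt (cuspDisc f)
      (P.comp (Polynomial.C (z : ℂ) + Polynomial.C Complex.I * Polynomial.X)) (qpar z) := by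
  rw [integralFromCusp, discInt]
  congr 1
  refine setIntegral_congr_fun measurableSet_Ioi fun t ht => ?_
  simp only [cuspDisc_qshift_qpar f z (le_of_lt ht), Polynomial.eval_comp, Polynomial.eval_add,
    Polynomial.eval_mul, Polynomial.eval_C, Polynomial.eval_X]

end

lemma coeff_C_sub_X_pow (w : ℂ) (n m : ℕ) :
    ((Polynomial.C w - Polynomial.X) ^ n).coeff m =
      (Polynomial.C ((-1) ^ n * (n.choose m : ℂ)) * (-Polynomial.X) ^ (n - m)).eval w := by
  rw [← neg_sub, neg_pow, show (-1 : Polynomial ℂ) ^ n = Polynomial.C ((-1) ^ n) by simp,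
    Polynomial.coeff_C_mul, sub_eq_add_neg, ← Polynomial.C_neg, Polynomial.coeff_X_add_C_pow]
  simp only [Polynomial.eval_mul, Polynomial.eval_C, Polynomial.eval_pow, Polynomial.eval_neg,
    Polynomial.eval_X]
  ring

lemma X_sub_C_pow_eq_sum (x : ℂ) (n : ℕ) : (Polynomial.X - Polynomial.C x) ^ n =
    ∑ m ∈ Finset.range (n + 1), Polynomial.C (x ^ m) *
      (Polynomial.C ((-1) ^ n * (n.choose m : ℂ)) * (-Polynomial.X) ^ (n - m)) := by
  rw [← neg_sub, neg_pow, sub_eq_add_neg, add_pow, Finset.mul_sum]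
  refine Finset.sum_congr rfl fun m _ => ?_
  simp only [map_mul, map_pow, map_neg, map_one, map_natCast]
  ring

section

variable {k : ℕ} (f : CuspForm 𝒮ℒ (k : ℤ))

lemma eichlerPlus_natDegree_le (hk : 2 ≤ k) (z : ℍ) : (eichlerPlus f z).natDegree ≤ k - 2 :=
  Polynomial.natDegree_sum_le_of_forall_le _ _ fun m hm =>
    (Polynomial.natDegree_monomial_le _).trans (by have := Finset.mem_range.1 hm; lia)

lemma eval_eichlerPlus (hk : 2 ≤ k) (z : ℍ) (x : ℂ) : (eichlerPlus f z).eval x =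
    -Complex.I * discInt (cuspDisc f) (((Polynomial.X - Polynomial.C x) ^ (k - 2)).comp
      (Polynomial.C (z : ℂ) + Polynomial.C Complex.I * Polynomial.X)) (qpar z) := by
  rw [X_sub_C_pow_eq_sum, Polynomial.sum_comp, discInt_finsetSum (discHol_cuspDisc f)
    (cuspDisc_zero f) _ _ (qpar_mem_ball z), Finset.mul_sum, eichlerPlus,
    Polynomial.eval_finsetSum, show k - 1 = k - 2 + 1 by lia]
  refine Finset.sum_congr rfl fun m _ => ?_
  simp only [coeff_C_sub_X_pow]
  rw [Polynomial.eval_monomial, integralFromCusp_mul_eval]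
  simp only [Polynomial.C_mul_comp, discInt_C_mul]
  ring

lemma hasDerivAt_eval_eichlerPlus (hk : 2 ≤ k) (z : ℍ) (x : ℂ) :
    HasDerivAt (fun w : ℂ => (eichlerPlus f (ofComplex w)).eval x)
      (f z * ((z : ℂ) - x) ^ (k - 2)) z := by
  refine ((hasDerivAt_discInt_comp (discHol_cuspDisc f) (cuspDisc_zero f)
    ((Polynomial.X - Polynomial.C x) ^ (k - 2)) (qpar_mem_ball z)).const_mul
      (-Complex.I)).congr_of_eventuallyEq ?_ |>.congr_deriv ?_
  · filter_upwards [isOpen_upperHalfPlaneSet.mem_nhds z.im_pos] with w hw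
    rw [eval_eichlerPlus f hk, ofComplex_apply_of_im_pos hw]
    rfl
  · rw [← qpar, cuspDisc_qpar, Polynomial.eval_pow, Polynomial.eval_sub, Polynomial.eval_X,
      Polynomial.eval_C]
    linear_combination -f z * ((z : ℂ) - x) ^ (k - 2) * Complex.I_sq

end

/-- The polynomial in `t = Im w - Im z` against which a cusp form is integrated, along the vertical
line above `z`, in the `i`-th coefficient of its Eichler integral; here `y = Im z`. -/
def seedPoly (n i : ℕ) (y : ℝ) : Polynomial ℂ :=
  (Polynomial.C Complex.I * Polynomial.X) ^ (n - i) *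
    (Polynomial.C Complex.I * (Polynomial.X + Polynomial.C (2 * y : ℂ))) ^ i

lemma X_sub_C_pow_comp_eq_sum_seedPoly (n : ℕ) (z : ℍ) (x : ℂ) :
    ((Polynomial.X - Polynomial.C x) ^ n).comp
        (Polynomial.C (z : ℂ) + Polynomial.C Complex.I * Polynomial.X) =
      ∑ i ∈ Finset.range (n + 1), Polynomial.C ((2 * Complex.I * z.im) ^ (-(n : ℤ)) *
        ((-1) ^ i * (n.choose i : ℂ)) * ((x - z) ^ i * (x - conj (z : ℂ)) ^ (n - i))) *
          seedPoly n i z.im := by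
  refine Polynomial.funext fun t => ?_
  have hy : (2 * Complex.I * z.im : ℂ) ≠ 0 := by simp [im_ne_zero z]
  have hsplit : (2 * Complex.I * z.im) * ((z : ℂ) + Complex.I * t - x) =
      -((x - z) * (Complex.I * (t + 2 * z.im))) + (x - conj (z : ℂ)) * (Complex.I * t) := by
    linear_combination (-Complex.I * t) * sub_conj_eq z
  have hpow : ((z : ℂ) + Complex.I * t - x) ^ n = (2 * Complex.I * z.im) ^ (-(n : ℤ)) *
      (-((x - z) * (Complex.I * (t + 2 * z.im))) + (x - conj (z : ℂ)) * (Complex.I * t)) ^ n := by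
    rw [← hsplit, mul_pow, zpow_neg, zpow_natCast, inv_mul_cancel_left₀ (pow_ne_zero _ hy)]
  simp only [Polynomial.eval_comp, Polynomial.eval_finsetSum, seedPoly, Polynomial.eval_pow,
    Polynomial.eval_mul, Polynomial.eval_add, Polynomial.eval_sub, Polynomial.eval_C,
    Polynomial.eval_X]
  rw [hpow, add_pow, Finset.mul_sum]
  refine Finset.sum_congr rfl fun i _ => ?_
  rw [neg_pow, mul_pow (x - (z : ℂ)), mul_pow (x - conj (z : ℂ))]
  ring

lemma seedPoly_eq_sum {n i : ℕ} (hi : i ≤ n) (y : ℝ) : seedPoly n i y =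
    ∑ b ∈ Finset.range (i + 1), Polynomial.C ((y : ℂ) ^ (i - b)) *
      (Polynomial.C (Complex.I ^ n * (2 ^ (i - b) * (i.choose b : ℂ))) *
        Polynomial.X ^ (n - i + b)) := by
  rw [seedPoly, mul_pow, mul_pow, add_pow, Finset.mul_sum, Finset.mul_sum]
  refine Finset.sum_congr rfl fun b _ => ?_
  conv_rhs => rw [← Nat.sub_add_cancel hi, pow_add Complex.I, Nat.sub_add_cancel hi]
  simp only [map_mul, map_pow, map_natCast, map_ofNat, mul_pow, pow_add]
  ring

lemma norm_eval_seedPoly_le {n i : ℕ} (hi : i ≤ n) {y t : ℝ} (hy : 0 ≤ y) (ht : 0 ≤ t) :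
    ‖(seedPoly n i y).eval (t : ℂ)‖ ≤ (2 * (y + t)) ^ n := by
  have hfirst : ‖(Complex.I * t : ℂ)‖ ≤ 2 * (y + t) := by
    rw [norm_mul, Complex.norm_I, one_mul, Complex.norm_real, Real.norm_of_nonneg ht]
    linarith
  have hsecond : ‖Complex.I * ((t : ℂ) + 2 * y)‖ ≤ 2 * (y + t) := by
    rw [norm_mul, Complex.norm_I, one_mul, show (t : ℂ) + 2 * y = (t + 2 * y : ℝ) by push_cast; rfl,
      Complex.norm_real, Real.norm_of_nonneg (by positivity)]
    linarith
  simp only [seedPoly, Polynomial.eval_mul, Polynomial.eval_pow, Polynomial.eval_add,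
    Polynomial.eval_C, Polynomial.eval_X, norm_mul, norm_pow]
  calc _ ≤ (2 * (y + t)) ^ (n - i) * (2 * (y + t)) ^ i := by
        rw [← norm_mul, ← norm_mul]
        gcongr
    _ = (2 * (y + t)) ^ n := by rw [← pow_add, Nat.sub_add_cancel hi]

/-- The coefficient functions of the Eichler integral `F_f^+(z, X)` in the basis
`(X - z)^i (X - z̄)^(k-2-i)`. -/
def seed {k : ℕ} (f : CuspForm 𝒮ℒ (k : ℤ)) (i : ℕ) (z : ℍ) : ℂ :=
  expCoeff (k - 2) (eichlerPlus f z) i z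

section

variable {k : ℕ} (f : CuspForm 𝒮ℒ (k : ℤ)) (hk : 2 ≤ k) {i : ℕ} (hi : i ≤ k - 2)
include hk hi

lemma seed_eq_discInt (z : ℍ) : seed f i z =
    (2 * Complex.I * z.im) ^ (-((k - 2 : ℕ) : ℤ)) * ((-1) ^ i * ((k - 2).choose i : ℂ)) *
      (-Complex.I * discInt (cuspDisc f) (seedPoly (k - 2) i z.im) (qpar z)) := by
  refine (expCoeff_unique (k - 2) z (fun i => (2 * Complex.I * z.im) ^ (-((k - 2 : ℕ) : ℤ)) *
    ((-1) ^ i * ((k - 2).choose i : ℂ)) *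
      (-Complex.I * discInt (cuspDisc f) (seedPoly (k - 2) i z.im) (qpar z))) ?_ hi).symm
  refine Polynomial.funext fun x => ?_
  rw [eval_eichlerPlus f hk, X_sub_C_pow_comp_eq_sum_seedPoly, discInt_finsetSum
    (discHol_cuspDisc f) (cuspDisc_zero f) _ _ (qpar_mem_ball z), Polynomial.eval_finsetSum,
    Finset.mul_sum]
  refine Finset.sum_congr rfl fun j _ => ?_
  simp only [discInt_C_mul, Polynomial.eval_mul, Polynomial.eval_C, Polynomial.eval_pow,
    Polynomial.eval_sub, Polynomial.eval_X]
  ring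

lemma seed_vadd (l : ℤ) (z : ℍ) : seed f i ((l : ℝ) +ᵥ z) = seed f i z := by
  rw [seed_eq_discInt f hk hi, seed_eq_discInt f hk hi, vadd_im, qpar_int_vadd]

lemma seed_mem_mixed : seed f i ∈ mixed := by
  set n := k - 2
  have hsum : seed f i = ∑ b ∈ Finset.range (i + 1), ((2 * Complex.I) ^ (-(n : ℤ)) *
      ((-1) ^ i * (n.choose i : ℂ)) * -Complex.I) • (yPow (((i - b : ℕ) : ℤ) - n) * fun z =>
        discInt (cuspDisc f) (Polynomial.C (Complex.I ^ n * (2 ^ (i - b) * (i.choose b : ℂ))) *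
          Polynomial.X ^ (n - i + b)) (qpar z)) := by
    funext z
    rw [seed_eq_discInt f hk hi, seedPoly_eq_sum hi, discInt_finsetSum (discHol_cuspDisc f)
      (cuspDisc_zero f) _ _ (qpar_mem_ball z), Finset.sum_apply, Finset.mul_sum, Finset.mul_sum]
    refine Finset.sum_congr rfl fun b _ => ?_
    rw [discInt_C_mul, Pi.smul_apply, Pi.mul_apply, smul_eq_mul, yPow, sub_eq_add_neg,
      zpow_add₀ (im_ne_zero z), mul_zpow, zpow_natCast]
    ring
  rw [hsum]
  exact sum_mem fun b _ => mixed.smul_mem (yPow_mul_comp_qpar_mem_mixed _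
    (discHol_discInt (discHol_cuspDisc f) (cuspDisc_zero f) _)) _

end

/-! ### Growth of the coefficient functions -/

lemma exists_cuspForm_norm_le {k : ℕ} (f : CuspForm 𝒮ℒ (k : ℤ)) {a : ℝ} (ha : (k : ℝ) / 2 ≤ a) :
    ∃ C, 0 ≤ C ∧ ∀ z : ℍ, ‖f z‖ ≤ C * z.im ^ (-a) := by
  obtain ⟨C₀, hC₀⟩ := CuspFormClass.exists_bound f
  have hdecay : (f : ℍ → ℂ) =O[atImInfty] fun z => z.im ^ (-a) := by
    refine (CuspFormClass.exp_decay_atImInfty f one_pos one_mem_strictPeriods_SL).trans ?_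
    simp only [div_one, neg_mul 2 Real.pi]
    exact (isLittleO_exp_neg_mul_rpow_atTop (mul_pos two_pos Real.pi_pos) (-a)).isBigO.comp_tendsto
      tendsto_comap
  obtain ⟨C₁, hC₁⟩ := hdecay.bound
  obtain ⟨N, hN⟩ := (atImInfty_mem _).1 hC₁
  have hC₁' (z : ℍ) (hz : N ≤ z.im) : ‖f z‖ ≤ C₁ * z.im ^ (-a) := by
    simpa [abs_of_pos (Real.rpow_pos_of_pos z.im_pos _)] using hN z hz
  refine ⟨max (|C₀| * max N 1 ^ (a - k / 2)) C₁, le_max_of_le_left (by positivity), fun z => ?_⟩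
  have hy := z.im_pos
  rcases le_total z.im (max N 1) with hz | hz
  · calc ‖f z‖ ≤ C₀ / z.im ^ ((k : ℝ) / 2) := by simpa using hC₀ z
      _ ≤ |C₀| / z.im ^ ((k : ℝ) / 2) := by gcongr; exact le_abs_self _
      _ = |C₀| * z.im ^ (a - k / 2) * z.im ^ (-a) := by
          rw [mul_assoc, ← Real.rpow_add hy, div_eq_mul_inv, ← Real.rpow_neg hy.le]
          congr 2
          ring
      _ ≤ _ := by
          gcongr
          refine le_max_of_le_left ?_
          gcongr
  · refine (hC₁' z ((le_max_left _ _).trans hz)).trans ?_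
    gcongr
    exact le_max_right _ _

lemma integral_add_rpow {y : ℝ} (hy : 0 < y) {a : ℝ} (ha : a < -1) :
    ∫ t in Set.Ioi (0 : ℝ), (y + t) ^ a = -y ^ (a + 1) / (a + 1) := by
  rw [← integral_Ioi_rpow_of_lt ha hy,
    ← (measurePreserving_add_left volume y).setIntegral_preimage_emb
      (measurableEmbedding_addLeft y) (fun t => t ^ a), Set.preimage_const_add_Ioi, sub_self]

lemma exists_discInt_seedPoly_norm_le {k : ℕ} (hk : 2 ≤ k) (f : CuspForm 𝒮ℒ (k : ℤ)) :
    ∃ C, 0 ≤ C ∧ ∀ i ≤ k - 2, ∀ z : ℍ,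
      ‖discInt (cuspDisc f) (seedPoly (k - 2) i z.im) (qpar z)‖ ≤ C * z.im ^ (-(1 / 2) : ℝ) := by
  have hweight : (k : ℝ) / 2 ≤ (k - 2 : ℕ) + 3 / 2 := by
    have : (2 : ℝ) ≤ k := by exact_mod_cast hk
    push_cast [hk]
    linarith
  obtain ⟨C, hC0, hC⟩ := exists_cuspForm_norm_le f hweight
  set n := k - 2
  refine ⟨C * 2 ^ n * 2, by positivity, fun i hi z => ?_⟩
  have hint : IntegrableOn (fun t : ℝ => (z.im + t) ^ (-(3 / 2) : ℝ)) (Set.Ioi 0) := by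
    simpa only [add_comm] using integrableOn_add_rpow_Ioi_of_lt (a := -(3 / 2)) (c := 0)
      (m := z.im) (by norm_num) (by linarith [z.im_pos])
  calc ‖discInt (cuspDisc f) (seedPoly n i z.im) (qpar z)‖
      ≤ ∫ t in Set.Ioi (0 : ℝ), (C * 2 ^ n) * (z.im + t) ^ (-(3 / 2) : ℝ) := by
        refine norm_integral_le_of_norm_le (hint.const_mul _) ?_
        filter_upwards [ae_restrict_mem measurableSet_Ioi] with t (ht : 0 < t)
        have hs : 0 < z.im + t := add_pos z.im_pos ht
        have him : (ofComplex ((z : ℂ) + Complex.I * t)).im = z.im + t := by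
          rw [ofComplex_apply_of_im_pos (add_I_mul_im_pos z ht.le)]
          change ((z : ℂ) + Complex.I * t).im = _
          simp
        calc _ ≤ C * (z.im + t) ^ (-((n : ℝ) + 3 / 2)) * (2 * (z.im + t)) ^ n := by
              rw [norm_mul, cuspDisc_qshift_qpar f z ht.le, ← him]
              gcongr
              · exact hC _
              · rw [him]
                exact norm_eval_seedPoly_le hi z.im_pos.le ht.le
          _ = C * 2 ^ n * ((z.im + t) ^ (-((n : ℝ) + 3 / 2)) * (z.im + t) ^ (n : ℝ)) := by
              rw [mul_pow, Real.rpow_natCast]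
              ring
          _ = C * 2 ^ n * (z.im + t) ^ (-(3 / 2) : ℝ) := by
              rw [← Real.rpow_add hs]
              congr 2
              ring
    _ = C * 2 ^ n * 2 * z.im ^ (-(1 / 2) : ℝ) := by
        rw [integral_const_mul, integral_add_rpow z.im_pos (by norm_num)]
        norm_num
        ring

lemma exists_seed_norm_le {k : ℕ} (hk : 2 ≤ k) (f : CuspForm 𝒮ℒ (k : ℤ)) :
    ∃ C, 0 ≤ C ∧ ∀ i ≤ k - 2, ∀ z : ℍ,
      ‖seed f i z‖ ≤ C * z.im ^ (-((2 * (k - 2 : ℕ) + 1 : ℤ) : ℝ) / 2) := by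
  obtain ⟨C, hC0, hC⟩ := exists_discInt_seedPoly_norm_le hk f
  refine ⟨2 ^ (k - 2) * C, by positivity, fun i hi z => ?_⟩
  specialize hC i hi z
  rw [seed_eq_discInt f hk hi]
  set n := k - 2
  have hy := z.im_pos
  have hscale : ‖(2 * Complex.I * z.im : ℂ) ^ (-(n : ℤ))‖ ≤ z.im ^ (-(n : ℝ)) := by
    rw [norm_zpow, zpow_neg, zpow_natCast, Real.rpow_neg hy.le, Real.rpow_natCast,
      show ‖(2 * Complex.I * z.im : ℂ)‖ = 2 * z.im by simp [abs_of_pos hy]]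
    gcongr
    linarith
  have hchoose : ‖((-1) ^ i * (n.choose i : ℂ) : ℂ)‖ ≤ 2 ^ n := by
    rw [norm_mul, norm_pow, norm_neg, norm_one, one_pow, one_mul, Complex.norm_natCast]
    exact_mod_cast Nat.choose_le_two_pow n i
  rw [norm_mul, norm_mul, norm_mul (-Complex.I), norm_neg, Complex.norm_I, one_mul]
  calc _ ≤ z.im ^ (-(n : ℝ)) * 2 ^ n * (C * z.im ^ (-(1 / 2) : ℝ)) := by gcongr
    _ = 2 ^ n * C * (z.im ^ (-(n : ℝ)) * z.im ^ (-(1 / 2) : ℝ)) := by ring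
    _ = _ := by
        rw [← Real.rpow_add hy]
        congr 2
        push_cast
        ring

/-! ### Poincaré series -/

lemma polynomial_eq_of_eval_eq {P Q : Polynomial ℂ}
    (h : ∀ x : ℍ, P.eval (x : ℂ) = Q.eval (x : ℂ)) : P = Q :=
  Polynomial.eq_of_infinite_eval_eq _ _ <|
    (infinite_of_mem_nhds Complex.I (isOpen_upperHalfPlaneSet.mem_nhds (by simp))).mono
      fun x hx => h ⟨x, hx⟩

lemma det_eq (γ : SL(2, ℤ)) : (γ 0 0 : ℂ) * γ 1 1 - γ 0 1 * γ 1 0 = 1 := by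
  exact_mod_cast (Matrix.det_fin_two _).symm.trans γ.det_coe

lemma coe_smul_eq (γ : SL(2, ℤ)) (z : ℍ) :
    ((γ • z : ℍ) : ℂ) = ((γ 0 0 : ℂ) * z + γ 0 1) / autj γ z := by
  simp [specialLinearGroup_apply, autj]

lemma coe_smul_sub_coe_smul (γ : SL(2, ℤ)) (w z : ℍ) :
    ((γ • w : ℍ) : ℂ) - (γ • z : ℍ) = ((w : ℂ) - z) / (autj γ w * autj γ z) := by
  rw [coe_smul_eq, coe_smul_eq, div_sub_div _ _ (autj_ne_zero γ w) (autj_ne_zero γ z)]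
  congr 1
  simp only [autj]
  linear_combination ((w : ℂ) - z) * det_eq γ

lemma coe_smul_sub_conj_coe_smul (γ : SL(2, ℤ)) (w z : ℍ) :
    ((γ • w : ℍ) : ℂ) - conj ((γ • z : ℍ) : ℂ) =
      ((w : ℂ) - conj (z : ℂ)) / (autj γ w * autj γ (conj (z : ℂ))) := by
  rw [coe_smul_eq, coe_smul_eq, map_div₀, ← autj_conj,
    div_sub_div _ _ (autj_ne_zero γ w) (autj_conj_ne_zero γ z)]
  congr 1
  simp only [autj, map_add, map_mul, map_intCast]
  linear_combination ((w : ℂ) - conj (z : ℂ)) * det_eq γ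

lemma autj_mul (γ δ : SL(2, ℤ)) (z : ℍ) : autj (γ * δ) z = autj γ (δ • z : ℍ) * autj δ z := by
  have hmul : autj γ (δ • z : ℍ) * autj δ z =
      γ 1 0 * ((δ 0 0 : ℂ) * z + δ 0 1) + γ 1 1 * autj δ z := by
    rw [coe_smul_eq, autj, add_mul, mul_assoc, div_mul_cancel₀ _ (autj_ne_zero δ z)]
  rw [hmul]
  simp only [autj, Matrix.SpecialLinearGroup.coe_mul, Matrix.mul_apply, Fin.sum_univ_two]
  push_cast
  ring

/-- The summand `Φ(γ z) j(γ, z)^{-R} j(γ, z̄)^{-S}` of the Poincaré series of weights `(R, S)`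
attached to `Φ`. -/
def poincareTerm (Φ : ℍ → ℂ) (R S : ℤ) (γ : SL(2, ℤ)) (z : ℍ) : ℂ :=
  Φ (γ • z) * (autj γ z ^ (-R) * autj γ (conj (z : ℂ)) ^ (-S))

/-- The Poincaré series of weights `(R, S)` attached to a `1`-periodic function `Φ`, summed over
representatives of `B \ Γ`. -/
def poincare (Φ : ℍ → ℂ) (R S : ℤ) (z : ℍ) : ℂ := ∑' γ : CosetB, poincareTerm Φ R S γ.out z

lemma poincareTerm_smul (Φ : ℍ → ℂ) (R S : ℤ) (γ δ : SL(2, ℤ)) (z : ℍ) :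
    poincareTerm Φ R S γ (δ • z) =
      autj δ z ^ R * autj δ (conj (z : ℂ)) ^ S * poincareTerm Φ R S (γ * δ) z := by
  have h := autj_ne_zero δ z
  have h' := autj_conj_ne_zero δ z
  rw [autj_conj] at h'
  simp only [poincareTerm, autj_conj, autj_mul, mul_smul, mul_zpow, map_mul, zpow_neg]
  field_simp

lemma poincareTerm_conj (Φ : ℍ → ℂ) (R S : ℤ) (γ : SL(2, ℤ)) (z : ℍ) :
    poincareTerm (fun z => conj (Φ z)) R S γ z = conj (poincareTerm Φ S R γ z) := by
  simp only [poincareTerm, map_mul, map_zpow₀, autj_conj, Complex.conj_conj]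
  ring

lemma poincare_conj (Φ : ℍ → ℂ) (R S : ℤ) :
    poincare (fun z => conj (Φ z)) R S = fun z => conj (poincare Φ S R z) := by
  funext z
  simp only [poincare, Complex.conj_tsum, poincareTerm_conj]

lemma mem_subgroupB_iff {γ : SL(2, ℤ)} : γ ∈ subgroupB ↔ γ 1 0 = 0 := by
  refine ⟨?_, fun h => ?_⟩
  · rintro ⟨n, rfl | rfl⟩ <;> simp [ModularGroup.coe_T_zpow]
  · have hdet := γ.det_coe
    rw [Matrix.det_fin_two, h, mul_zero, sub_zero] at hdet
    rcases Int.eq_one_or_neg_one_of_mul_eq_one' hdet with ⟨h₀, h₁⟩ | ⟨h₀, h₁⟩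
    · refine ⟨γ 0 1, Or.inl ?_⟩
      ext i j
      fin_cases i <;> fin_cases j <;> simp [ModularGroup.coe_T_zpow, h, h₀, h₁]
    · refine ⟨-γ 0 1, Or.inr ?_⟩
      ext i j
      fin_cases i <;> fin_cases j <;> simp [ModularGroup.coe_T_zpow, h, h₀, h₁]

/-- The class of `γ` in `B \ Γ`. -/
def cosetMk (γ : SL(2, ℤ)) : CosetB := Quotient.mk _ γ

lemma cosetMk_out (q : CosetB) : cosetMk q.out = q := Quotient.out_eq q

lemma cosetMk_eq_iff_mem {γ δ : SL(2, ℤ)} : cosetMk γ = cosetMk δ ↔ δ * γ⁻¹ ∈ subgroupB :=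
  Quotient.eq.trans (by rw [QuotientGroup.rightRel_apply])

lemma cosetMk_eq_iff {γ δ : SL(2, ℤ)} : cosetMk γ = cosetMk δ ↔ δ 1 0 * γ 1 1 = δ 1 1 * γ 1 0 := by
  have hentry : (δ * γ⁻¹) 1 0 = δ 1 0 * γ 1 1 - δ 1 1 * γ 1 0 := by
    simp [Matrix.mul_apply, Fin.sum_univ_two, Matrix.adjugate_fin_two, sub_eq_add_neg]
  rw [cosetMk_eq_iff_mem, mem_subgroupB_iff, hentry, sub_eq_zero]

/-- The action of `δ` on `B \ Γ` by right multiplication. -/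
def cosetMul (δ : SL(2, ℤ)) : CosetB ≃ CosetB :=
  Quotient.congr (Equiv.mulRight δ) fun a b => by
    simp [QuotientGroup.rightRel_apply, mul_assoc]

lemma cosetMul_eq (δ : SL(2, ℤ)) (q : CosetB) : cosetMul δ q = cosetMk (q.out * δ) := by
  conv_lhs => rw [← q.out_eq]
  rfl

lemma bottom_row_out_injective :
    Function.Injective fun q : CosetB => (q.out 1 0, q.out 1 1) := fun q q' heq => by
  obtain ⟨h₀, h₁⟩ := Prod.mk.inj heq
  rw [← cosetMk_out q, ← cosetMk_out q']
  exact cosetMk_eq_iff.2 (by rw [h₀, h₁, mul_comm])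

lemma norm_poincareTerm_le {Φ : ℍ → ℂ} {C : ℝ} {w : ℤ}
    (hC : ∀ z : ℍ, ‖Φ z‖ ≤ C * z.im ^ (-(w : ℝ) / 2)) (R S : ℤ) (γ : SL(2, ℤ)) (z : ℍ) :
    ‖poincareTerm Φ R S γ z‖ ≤ C * z.im ^ (-(w : ℝ) / 2) * ‖autj γ z‖ ^ (-(R + S - w)) := by
  have hj := autj_ne_zero γ z
  have hj' : 0 < ‖autj γ z‖ := norm_pos_iff.2 hj
  have him : (γ • z : ℍ).im = z.im * ‖autj γ z‖ ^ (-2 : ℝ) := by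
    rw [ModularGroup.im_smul_eq_div_normSq, autj_eq_denom, Complex.normSq_eq_norm_sq,
      Real.rpow_neg (norm_nonneg _), Real.rpow_two, div_eq_mul_inv]
  rw [poincareTerm, norm_mul, norm_zpow_mul_zpow hj (by rw [autj_conj, RCLike.norm_conj])]
  calc _ ≤ C * (γ • z : ℍ).im ^ (-(w : ℝ) / 2) * ‖autj γ z‖ ^ (-R + -S) := by gcongr; exact hC _
    _ = C * (z.im ^ (-(w : ℝ) / 2) * ‖autj γ z‖ ^ w) * ‖autj γ z‖ ^ (-R + -S) := by
        rw [him, Real.mul_rpow z.im_pos.le (by positivity), ← Real.rpow_mul hj'.le,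
          show (-2 : ℝ) * (-(w : ℝ) / 2) = w by ring, Real.rpow_intCast]
    _ = C * z.im ^ (-(w : ℝ) / 2) * (‖autj γ z‖ ^ w * ‖autj γ z‖ ^ (-R + -S)) := by ring
    _ = _ := by rw [← zpow_add₀ hj'.ne']; ring_nf

lemma summable_poincareTerm {Φ : ℍ → ℂ} {C : ℝ} {w : ℤ}
    (hC : ∀ z : ℍ, ‖Φ z‖ ≤ C * z.im ^ (-(w : ℝ) / 2)) {R S : ℤ} (h : w + 3 ≤ R + S) (z : ℍ) :
    Summable fun γ : CosetB => poincareTerm Φ R S γ.out z :=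
  .of_norm_bounded (((summable_norm_linear (w := R + S - w) (by linarith) z).comp_injective
    bottom_row_out_injective).mul_left (C * z.im ^ (-(w : ℝ) / 2)))
      fun q => norm_poincareTerm_le hC R S q.out z

section Periodic

variable {Φ : ℍ → ℂ} (hΦ : ∀ (l : ℤ) (z : ℍ), Φ ((l : ℝ) +ᵥ z) = Φ z) {R S : ℤ} (h : Even (R + S))
include hΦ h

lemma poincareTerm_mul_of_mem {β : SL(2, ℤ)} (hβ : β ∈ subgroupB) (γ : SL(2, ℤ)) (z : ℍ) :
    poincareTerm Φ R S (β * γ) z = poincareTerm Φ R S γ z := by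
  obtain ⟨n, rfl | rfl⟩ := hβ
  · have hautj (w : ℍ) : autj (ModularGroup.T ^ n) w = 1 := by
      simp [autj, ModularGroup.coe_T_zpow]
    simp only [poincareTerm, autj_conj, autj_mul, hautj, one_mul, mul_smul, modular_T_zpow_smul, hΦ]
  · have hautj (w : ℍ) : autj (-ModularGroup.T ^ n) w = -1 := by
      simp [autj, ModularGroup.coe_T_zpow]
    have hsign : (-1 : ℂ) ^ (-R) * (-1) ^ (-S) = 1 := by
      rw [← zpow_add₀ (by simp), ← neg_add, h.neg.neg_one_zpow]
    simp only [poincareTerm, autj_conj, autj_mul, hautj, mul_smul, ModularGroup.SL_neg_smul,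
      map_mul, map_neg, map_one, mul_zpow, modular_T_zpow_smul, hΦ]
    linear_combination (Φ (γ • z) * autj γ z ^ (-R) * (conj (autj γ z)) ^ (-S)) * hsign

lemma poincareTerm_out_cosetMk (γ : SL(2, ℤ)) (z : ℍ) :
    poincareTerm Φ R S (cosetMk γ).out z = poincareTerm Φ R S γ z := by
  rw [← poincareTerm_mul_of_mem hΦ h (cosetMk_eq_iff_mem.1 (cosetMk_out (cosetMk γ))),
    inv_mul_cancel_right]

lemma poincare_hasWeight : HasWeight R S (poincare Φ R S) := by
  intro δ z
  rw [poincare, poincare, ← (cosetMul δ).tsum_eq fun γ : CosetB => poincareTerm Φ R S γ.out z,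
    ← tsum_mul_left]
  refine tsum_congr fun q => ?_
  rw [poincareTerm_smul, cosetMul_eq, poincareTerm_out_cosetMk hΦ h]

end Periodic

/-! ### Cosets and coprime pairs -/

/-- The bottom rows `(c, d)` with `c ≥ 1` of the matrices in `SL(2, ℤ)`. -/
def coprimePairs : Set (ℕ+ × ℤ) := {p | IsCoprime ((p.1 : ℕ) : ℤ) p.2}

/-- A chosen matrix in `SL(2, ℤ)` with prescribed bottom row. -/
def rowLift (p : coprimePairs) : SL(2, ℤ) := (IsCoprime.exists_SL2_row p.2 1).choose

lemma rowLift_one_zero (p : coprimePairs) : rowLift p 1 0 = ((p.1.1 : ℕ) : ℤ) :=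
  (IsCoprime.exists_SL2_row p.2 1).choose_spec.1

lemma rowLift_one_one (p : coprimePairs) : rowLift p 1 1 = p.1.2 :=
  (IsCoprime.exists_SL2_row p.2 1).choose_spec.2

/-- The classes of `B \ Γ`: that of the identity, and one for each coprime pair `(c, d)` with
`c ≥ 1`. -/
def cosetRep (o : Option coprimePairs) : CosetB := o.elim (cosetMk 1) fun p => cosetMk (rowLift p)

lemma cosetMk_rowLift_injective : Function.Injective fun p => cosetMk (rowLift p) := by
  rintro ⟨⟨c, d⟩, hp⟩ ⟨⟨c', d'⟩, hp'⟩ heq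
  have hcross := cosetMk_eq_iff.1 heq
  simp only [rowLift_one_zero, rowLift_one_one] at hcross
  have hc : 0 < ((c : ℕ) : ℤ) := by exact_mod_cast c.pos
  have hc' : 0 < ((c' : ℕ) : ℤ) := by exact_mod_cast c'.pos
  obtain ⟨rfl, hcc⟩ := Rat.div_int_inj hc hc' (Int.isCoprime_iff_gcd_eq_one.1 hp.symm)
    (Int.isCoprime_iff_gcd_eq_one.1 hp'.symm) (by
      rw [div_eq_div_iff (by exact_mod_cast hc.ne') (by exact_mod_cast hc'.ne'), mul_comm]
      exact_mod_cast hcross)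
  obtain rfl : c = c' := PNat.eq (by exact_mod_cast hcc)
  rfl

lemma cosetRep_injective : Function.Injective cosetRep := by
  have hne (p : coprimePairs) : cosetMk 1 ≠ cosetMk (rowLift p) := fun heq => by
    simpa [rowLift_one_zero] using cosetMk_eq_iff.1 heq
  rintro (_ | p) (_ | p') heq
  · rfl
  · exact absurd heq (hne p')
  · exact absurd heq.symm (hne p)
  · exact congrArg some (cosetMk_rowLift_injective heq)

lemma cosetRep_surjective : Function.Surjective cosetRep := fun q => by
  rw [← cosetMk_out q]
  generalize q.out = γ
  rcases eq_or_ne (γ 1 0) 0 with hzero | hne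
  · exact ⟨none, cosetMk_eq_iff.2 (by simp [hzero])⟩
  · have hcop : IsCoprime ((γ 1 0).natAbs : ℤ) ((γ 1 0).sign * γ 1 1) := by
      rw [isCoprime_mul_unit_left_right (Int.isUnit_iff.2 (by
        rcases hne.lt_or_gt with h | h <;> simp [Int.sign_eq_neg_one_of_neg,
          Int.sign_eq_one_of_pos, h])), Int.natCast_natAbs, IsCoprime.abs_left_iff]
      exact ModularGroup.bottom_row_coprime γ
    refine ⟨some ⟨(⟨(γ 1 0).natAbs, Int.natAbs_pos.2 hne⟩, (γ 1 0).sign * γ 1 1), hcop⟩,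
      cosetMk_eq_iff.2 ?_⟩
    rw [rowLift_one_zero, rowLift_one_one, PNat.mk_coe]
    conv_lhs => rw [mul_left_comm]
    linear_combination γ 1 1 * Int.sign_mul_self_eq_natAbs (γ 1 0)

lemma poincare_eq_add_tsum {Φ : ℍ → ℂ} (hΦ : ∀ (l : ℤ) (z : ℍ), Φ ((l : ℝ) +ᵥ z) = Φ z) {R S : ℤ}
    (h : Even (R + S)) (z : ℍ) (hs : Summable fun γ : CosetB => poincareTerm Φ R S γ.out z) :
    poincare Φ R S z = Φ z + ∑' p : coprimePairs, poincareTerm Φ R S (rowLift p) z := by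
  set e := Equiv.ofBijective cosetRep ⟨cosetRep_injective, cosetRep_surjective⟩
  have hterm (o : Option coprimePairs) : poincareTerm Φ R S (e o).out z =
      o.elim (Φ z) fun p => poincareTerm Φ R S (rowLift p) z := by
    rcases o with _ | p
    · exact (poincareTerm_out_cosetMk hΦ h 1 z).trans (by simp [poincareTerm, autj])
    · exact poincareTerm_out_cosetMk hΦ h (rowLift p) z
  have hs' := e.summable_iff.2 hs
  simp only [Function.comp_def, hterm] at hs'
  rw [poincare, ← e.tsum_eq]
  simp only [hterm]
  rw [hs'.tsum_eq_add_tsum_ite none, ← (Option.some_injective _).tsum_eq]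
  · simp only [reduceCtorEq, if_false, Option.elim_some, Option.elim_none]
  · rintro (_ | p) hp
    · exact absurd (if_pos rfl) hp
    · exact ⟨p, rfl⟩

/-! ### Coefficients as Poincaré series -/

/-- The polynomial `(X - z) ^ i (X - z̄) ^ (n - i)`. -/
def expBasis (n i : ℕ) (z : ℍ) : Polynomial ℂ :=
  (Polynomial.X - Polynomial.C (z : ℂ)) ^ i *
    (Polynomial.X - Polynomial.C (conj (z : ℂ))) ^ (n - i)

lemma expBasis_natDegree_le {n i : ℕ} (hi : i ≤ n) (z : ℍ) : (expBasis n i z).natDegree ≤ n :=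
  (Polynomial.natDegree_mul_le_of_le
    (Polynomial.natDegree_pow_le_of_le i (Polynomial.natDegree_X_sub_C_le _))
    (Polynomial.natDegree_pow_le_of_le (n - i) (Polynomial.natDegree_X_sub_C_le _))).trans
      (by lia)

lemma eval_expBasis (n i : ℕ) (z : ℍ) (x : ℂ) :
    (expBasis n i z).eval x = (x - z) ^ i * (x - conj (z : ℂ)) ^ (n - i) := by
  simp [expBasis]

lemma expBasis_map_conj {n i : ℕ} (hi : i ≤ n) (z : ℍ) :
    (expBasis n (n - i) z).map (starRingEnd ℂ) = expBasis n i z := by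
  simp only [expBasis, Polynomial.map_mul, Polynomial.map_pow, Polynomial.map_sub, Polynomial.map_X,
    Polynomial.map_C, Complex.conj_conj, Nat.sub_sub_self hi]
  ring

lemma eq_sum_expBasis {n : ℕ} {P : Polynomial ℂ} (hP : P.natDegree ≤ n) (z : ℍ) :
    P = ∑ i ∈ Finset.range (n + 1), Polynomial.C (expCoeff n P i z) * expBasis n i z := by
  simpa only [expBasis, mul_assoc] using expCoeff_expansion n hP z

lemma expCoeff_eq_of_eq_sum {n : ℕ} {P : Polynomial ℂ} {z : ℍ} (c : ℕ → ℂ)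
    (h : P = ∑ i ∈ Finset.range (n + 1), Polynomial.C (c i) * expBasis n i z) {i : ℕ}
    (hi : i ≤ n) : expCoeff n P i z = c i :=
  (expCoeff_unique n z c (by simpa only [expBasis, mul_assoc] using h) hi).symm

lemma expCoeff_map_conj {n : ℕ} {P : Polynomial ℂ} (hP : P.natDegree ≤ n) (z : ℍ) {i : ℕ}
    (hi : i ≤ n) : expCoeff n (P.map (starRingEnd ℂ)) i z = conj (expCoeff n P (n - i) z) := by
  refine expCoeff_eq_of_eq_sum (fun i => conj (expCoeff n P (n - i) z)) ?_ hi
  conv_lhs => rw [eq_sum_expBasis hP z, ← Finset.sum_range_reflect, Polynomial.map_sum]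
  refine Finset.sum_congr rfl fun j hj => ?_
  rw [Nat.add_sub_cancel, Polynomial.map_mul, Polynomial.map_C,
    expBasis_map_conj (Finset.mem_range_succ_iff.1 hj)]

lemma eval_slash {k : ℕ} (r s : ℤ) {F : ℍ → Polynomial ℂ} (γ : SL(2, ℤ)) {z : ℍ}
    (hF : (F (γ • z)).natDegree ≤ k - 2) (x : ℍ) : (slash k r s F γ z).eval (x : ℂ) =
      autj γ z ^ (-r) * autj γ (conj (z : ℂ)) ^ (-s) *
        (autj γ x ^ (k - 2) * (F (γ • z)).eval ((γ • x : ℍ) : ℂ)) := by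
  rw [slash, Polynomial.eval_mul, Polynomial.eval_C,
    homSubst_eval _ _ _ _ _ _ hF (autj_ne_zero γ x), coe_smul_eq]
  rfl

lemma slash_eq_sum {k : ℕ} {F : ℍ → Polynomial ℂ} (hF : ∀ z, (F z).natDegree ≤ k - 2) (r s : ℤ)
    (γ : SL(2, ℤ)) (z : ℍ) :
    slash k r s F γ z = ∑ i ∈ Finset.range (k - 2 + 1),
      Polynomial.C (poincareTerm (fun z => expCoeff (k - 2) (F z) i z) (r + i)
        (s + (k - 2 : ℕ) - i) γ z) * expBasis (k - 2) i z := by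
  refine polynomial_eq_of_eval_eq fun x => ?_
  have ha := autj_ne_zero γ z
  have hb := autj_conj_ne_zero γ z
  have hx := autj_ne_zero γ x
  rw [eval_slash r s γ (hF _)]
  conv_lhs => rw [eq_sum_expBasis (hF (γ • z)) (γ • z)]
  rw [Polynomial.eval_finsetSum, Polynomial.eval_finsetSum, Finset.mul_sum, Finset.mul_sum]
  refine Finset.sum_congr rfl fun i hi => ?_
  obtain ⟨l, hl⟩ := Nat.exists_eq_add_of_le (Finset.mem_range_succ_iff.1 hi)
  rw [Polynomial.eval_mul, Polynomial.eval_mul, Polynomial.eval_C, Polynomial.eval_C,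
    eval_expBasis, eval_expBasis, coe_smul_sub_coe_smul, coe_smul_sub_conj_coe_smul, poincareTerm,
    hl, Nat.add_sub_cancel_left, show -(s + ((i + l : ℕ) : ℤ) - i) = -s - l by push_cast; ring,
    neg_add, ← sub_eq_add_neg, zpow_sub₀ ha, zpow_sub₀ hb, zpow_natCast, zpow_natCast, pow_add,
    div_pow, div_pow, mul_pow, mul_pow]
  field_simp

section Slash

variable {k : ℕ} {F : ℍ → Polynomial ℂ} {C : ℝ} {w : ℤ} (hC : ∀ i ≤ k - 2, ∀ z : ℍ,
  ‖expCoeff (k - 2) (F z) i z‖ ≤ C * z.im ^ (-(w : ℝ) / 2)) {r s : ℤ}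
  (h : w + 3 ≤ r + s + (k - 2 : ℕ))
include hC h

lemma summable_poincareTerm_expCoeff {i : ℕ} (hi : i ≤ k - 2) (z : ℍ) :
    Summable fun γ : CosetB => poincareTerm (fun z => expCoeff (k - 2) (F z) i z) (r + i)
      (s + (k - 2 : ℕ) - i) γ.out z :=
  summable_poincareTerm (hC i hi) (by linarith) z

variable (hF : ∀ z, (F z).natDegree ≤ k - 2)
include hF

lemma summable_coeff_slash (z : ℍ) (m : ℕ) :
    Summable fun γ : CosetB => (slash k r s F γ.out z).coeff m := by
  simp only [slash_eq_sum hF, Polynomial.finsetSum_coeff, Polynomial.coeff_C_mul]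
  exact summable_sum fun i hi => (summable_poincareTerm_expCoeff hC h
    (Finset.mem_range_succ_iff.1 hi) z).mul_right _

lemma tsum_coeff_slash (z : ℍ) (m : ℕ) : ∑' γ : CosetB, (slash k r s F γ.out z).coeff m =
    ∑ i ∈ Finset.range (k - 2 + 1), poincare (fun z => expCoeff (k - 2) (F z) i z) (r + i)
      (s + (k - 2 : ℕ) - i) z * (expBasis (k - 2) i z).coeff m := by
  simp only [slash_eq_sum hF, Polynomial.finsetSum_coeff, Polynomial.coeff_C_mul]
  rw [Summable.tsum_finsetSum fun i hi => (summable_poincareTerm_expCoeff hC h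
    (Finset.mem_range_succ_iff.1 hi) z).mul_right _]
  simp only [tsum_mul_right, poincare]

lemma phiCoeff_eq_poincare (hk : 2 ≤ k) {i : ℕ} (hi : i ≤ k - 2) : phiCoeff k r s F i =
    poincare (fun z => expCoeff (k - 2) (F z) i z) (r + i) (s + (k - 2 : ℕ) - i) := by
  funext z
  refine expCoeff_eq_of_eq_sum (fun i => poincare (fun z => expCoeff (k - 2) (F z) i z)
    (r + i) (s + (k - 2 : ℕ) - i) z) ?_ hi
  ext m
  rw [phi, Polynomial.finsetSum_coeff, Polynomial.finsetSum_coeff]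
  simp only [Polynomial.coeff_monomial, Polynomial.coeff_C_mul, Finset.sum_ite_eq',
    Finset.mem_range]
  split_ifs with hm
  · exact tsum_coeff_slash hC h hF z m
  · refine (Finset.sum_eq_zero fun i hi => ?_).symm
    rw [Polynomial.coeff_eq_zero_of_natDegree_lt, mul_zero]
    exact (expBasis_natDegree_le (Finset.mem_range_succ_iff.1 hi) z).trans_lt (by lia)

end Slash

/-! ### Period polynomials -/

section

variable {k : ℕ} (f : CuspForm 𝒮ℒ (k : ℤ))

lemma cuspForm_smul (γ : SL(2, ℤ)) (z : ℍ) : f (γ • z) = autj γ z ^ (k : ℤ) * f z := by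
  rw [autj_eq_denom]
  exact SlashInvariantForm.slash_action_eqn'' (Γ := 𝒮ℒ)
    (γ := Matrix.SpecialLinearGroup.mapGL ℝ γ) f ⟨γ, rfl⟩ z

/-- The period polynomial of `γ`: the defect of invariance of the Eichler integral of `f`. It is
computed at the point `z`, but does not depend on it. -/
def periodPoly (γ : SL(2, ℤ)) (z : ℍ) : Polynomial ℂ :=
  slash k 0 0 (eichlerPlus f) γ z - eichlerPlus f z

variable (hk : 2 ≤ k)
include hk

lemma eval_periodPoly (γ : SL(2, ℤ)) (z x : ℍ) : (periodPoly f γ z).eval (x : ℂ) =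
    autj γ x ^ (k - 2) * (eichlerPlus f (γ • z)).eval ((γ • x : ℍ) : ℂ) -
      (eichlerPlus f z).eval (x : ℂ) := by
  rw [periodPoly, Polynomial.eval_sub, eval_slash 0 0 γ (eichlerPlus_natDegree_le f hk _), neg_zero,
    zpow_zero, zpow_zero, one_mul, one_mul]

lemma hasDerivAt_eval_periodPoly (γ : SL(2, ℤ)) (z x : ℍ) :
    HasDerivAt (fun w : ℂ => (periodPoly f γ (ofComplex w)).eval (x : ℂ)) 0 z := by
  have houter : HasDerivAt (fun w : ℂ => (eichlerPlus f (ofComplex w)).eval ((γ • x : ℍ) : ℂ))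
      (f (γ • z) * (((γ • z : ℍ) : ℂ) - (γ • x : ℍ)) ^ (k - 2)) (γ • ofComplex (z : ℂ) : ℍ) := by
    simpa only [ofComplex_apply] using hasDerivAt_eval_eichlerPlus f hk (γ • z) _
  have hderiv := ((houter.comp (z : ℂ) (hasDerivAt_smul γ z)).const_mul (autj γ x ^ (k - 2))).sub
    (hasDerivAt_eval_eichlerPlus f hk z x)
  simp only [Function.comp_def, Pi.sub_def, ofComplex_apply, ← eval_periodPoly f hk] at hderiv
  refine hderiv.congr_deriv ?_
  have hz := autj_ne_zero γ z
  have hx := autj_ne_zero γ x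
  obtain ⟨n, rfl⟩ := Nat.exists_eq_add_of_le hk
  rw [cuspForm_smul, coe_smul_sub_coe_smul, Nat.add_sub_cancel_left, div_pow, mul_pow,
    zpow_natCast, pow_add]
  field_simp
  ring

lemma periodPoly_eq_periodPoly (γ : SL(2, ℤ)) (z w : ℍ) : periodPoly f γ z = periodPoly f γ w := by
  refine polynomial_eq_of_eval_eq fun x => ?_
  have hderiv (v : ℂ) (hv : 0 < v.im) :=
    hasDerivAt_eval_periodPoly f hk γ ⟨v, hv⟩ x
  simpa only [ofComplex_apply] using isOpen_upperHalfPlaneSet.is_const_of_deriv_eq_zero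
    (convex_halfSpace_im_gt 0).isPreconnected
    (fun v hv => (hderiv v hv).differentiableAt.differentiableWithinAt)
    (fun v hv => (hderiv v hv).deriv) z.im_pos w.im_pos

lemma periodPoly_eq_sum_expBasis (γ : SL(2, ℤ)) (z : ℍ) : periodPoly f γ z =
    ∑ i ∈ Finset.range (k - 2 + 1), Polynomial.C
      (poincareTerm (seed f i) i ((k - 2 : ℕ) - i) γ z - seed f i z) * expBasis (k - 2) i z := by
  have hdeg := eichlerPlus_natDegree_le f hk
  rw [periodPoly, slash_eq_sum hdeg]
  conv_lhs => arg 2; rw [eq_sum_expBasis (hdeg z) z]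
  simp only [zero_add, Polynomial.C_sub, sub_mul, Finset.sum_sub_distrib]
  rfl

lemma poincareTerm_seed_eq (γ : SL(2, ℤ)) (z : ℍ) {i : ℕ} (hi : i ≤ k - 2) :
    poincareTerm (seed f i) i ((k - 2 : ℕ) - i) γ z =
      seed f i z + expCoeff (k - 2) (periodPoly f γ z) i z := by
  rw [expCoeff_eq_of_eq_sum _ (periodPoly_eq_sum_expBasis f hk γ z) hi]
  ring

end

/-- The point `(d + i) / c` of the upper half-plane. A matrix with bottom row `(c, d)` maps
`(-d + i) / c` to `(a + i) / c`, where `a` is an inverse of `d` modulo `c`. -/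
def basePt (c : ℕ+) (d : ℤ) : ℍ :=
  ⟨((d : ℂ) + Complex.I) / ((c : ℕ) : ℂ), by
    rw [Complex.div_natCast_im]
    have : 0 < ((c : ℕ) : ℝ) := by exact_mod_cast c.pos
    simp [this]⟩

lemma coe_basePt (c : ℕ+) (d : ℤ) : (basePt c d : ℂ) = ((d : ℂ) + Complex.I) / ((c : ℕ) : ℂ) := rfl

lemma im_basePt (c : ℕ+) (d : ℤ) : (basePt c d).im = ((c : ℕ) : ℝ)⁻¹ := by
  rw [← coe_im, coe_basePt, Complex.div_natCast_im]
  simp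

lemma pnat_cast_ne_zero (c : ℕ+) : ((c : ℕ) : ℂ) ≠ 0 := by exact_mod_cast c.ne_zero

lemma autj_basePt {c : ℕ+} {d : ℤ} {γ : SL(2, ℤ)} (hc : γ 1 0 = ((c : ℕ) : ℤ)) (hd : γ 1 1 = d) :
    autj γ (basePt c (-d)) = Complex.I := by
  have := pnat_cast_ne_zero c
  rw [autj, hc, hd, coe_basePt]
  push_cast
  field_simp
  ring

lemma smul_basePt {c : ℕ+} {d : ℤ} {γ : SL(2, ℤ)} (hc : γ 1 0 = ((c : ℕ) : ℤ)) (hd : γ 1 1 = d) :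
    γ • basePt c (-d) = basePt c (γ 0 0) := by
  have := pnat_cast_ne_zero c
  have hdet := det_eq γ
  rw [hc, hd] at hdet
  apply UpperHalfPlane.ext
  rw [coe_smul_eq, autj_basePt hc hd, coe_basePt, coe_basePt]
  push_cast at hdet ⊢
  field_simp
  linear_combination (-1) * hdet - Complex.I_sq

/-- The linear form `a X + b`. -/
def linPoly (a b : ℂ) : Polynomial ℂ := Polynomial.C a * Polynomial.X + Polynomial.C b

lemma linPoly_pow_natDegree_le {n m : ℕ} (hm : m ≤ n) (a b : ℂ) : (linPoly a b ^ m).natDegree ≤ n :=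
  ((Polynomial.natDegree_pow_le_of_le m Polynomial.natDegree_linear_le).trans (by simp)).trans hm

lemma expBasis_basePt_eq_comp {n a : ℕ} (ha : a ≤ n) (c : ℕ+) (d : ℤ) :
    expBasis n a (basePt c (-d)) =
      Polynomial.C (((c : ℕ) : ℂ) ^ n)⁻¹ * (expBasis n a I).comp (linPoly (c : ℕ) d) := by
  have hc := pnat_cast_ne_zero c
  refine Polynomial.funext fun x => ?_
  obtain ⟨l, rfl⟩ := Nat.exists_eq_add_of_le ha
  have hsub (u : ℂ) :
      x - (-d + u) / ((c : ℕ) : ℂ) = (((c : ℕ) : ℂ) * x + d - u) / ((c : ℕ) : ℂ) := by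
    field_simp
    ring
  rw [Polynomial.eval_mul, Polynomial.eval_C, Polynomial.eval_comp, eval_expBasis, eval_expBasis,
    coe_basePt, map_div₀, map_add, map_natCast, map_intCast, Int.cast_neg, hsub, hsub]
  simp only [linPoly, Polynomial.eval_add, Polynomial.eval_mul, Polynomial.eval_C,
    Polynomial.eval_X, coe_I, Nat.add_sub_cancel_left, div_pow, pow_add]
  field_simp

lemma expBasis_basePt {n a : ℕ} (ha : a ≤ n) (c : ℕ+) (d : ℤ) : expBasis n a (basePt c (-d)) =
    ∑ m ∈ Finset.range (n + 1),
      Polynomial.C ((((c : ℕ) : ℂ) ^ n)⁻¹ * (expBasis n a I).coeff m) * linPoly (c : ℕ) d ^ m := by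
  rw [expBasis_basePt_eq_comp ha, Polynomial.comp,
    Polynomial.eval₂_eq_sum_range' _ (Nat.lt_succ_of_le (expBasis_natDegree_le ha I)),
    Finset.mul_sum]
  simp only [Polynomial.C_mul, mul_assoc]

lemma coeff_linPoly_pow (a b : ℂ) (m t : ℕ) :
    (linPoly a b ^ m).coeff t = (m.choose t : ℂ) * a ^ t * b ^ ((m : ℤ) - t) := by
  have hcomp : linPoly a b ^ m =
      ((Polynomial.X + Polynomial.C b) ^ m).comp (Polynomial.C a * Polynomial.X) := by
    simp [linPoly]
  rw [hcomp, Polynomial.comp_C_mul_X_coeff, Polynomial.coeff_X_add_C_pow]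
  rcases le_or_gt t m with htm | htm
  · rw [← Nat.cast_sub htm, zpow_natCast]
    ring
  · simp [Nat.choose_eq_zero_of_lt htm]

lemma homSubst_linPoly_pow {n m : ℕ} (hm : m ≤ n) (a b : ℂ) (z : ℍ) :
    homSubst n (-conj (z : ℂ)) z (-1) 1 (linPoly a b ^ m) =
      linPoly (-(a * conj (z : ℂ) + b)) (a * z + b) ^ m * linPoly (-1) 1 ^ (n - m) := by
  refine Polynomial.eq_of_infinite_eval_eq _ _
    ((Set.finite_singleton (1 : ℂ)).infinite_compl.mono fun u hu => ?_)
  have hden : -1 * u + 1 ≠ 0 := fun h => hu (by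
    rw [Set.mem_singleton_iff]
    linear_combination -h)
  obtain ⟨l, rfl⟩ := Nat.exists_eq_add_of_le hm
  rw [Set.mem_ofPred_eq, homSubst_eval _ _ _ _ _ _ (linPoly_pow_natDegree_le hm a b) hden]
  simp only [linPoly, Polynomial.eval_mul, Polynomial.eval_pow, Polynomial.eval_add,
    Polynomial.eval_C, Polynomial.eval_X, Nat.add_sub_cancel_left]
  rw [pow_add, mul_right_comm, ← mul_pow]
  congr 2
  rw [mul_add, mul_left_comm, mul_div_cancel₀ _ hden]
  ring

/-- The coefficient of `(a z + b) ^ (m - t.1) (a z̄ + b) ^ t.1` in the `(t.1 + t.2)`-th coefficient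
of `(a X + b) ^ m`, seen as a polynomial of degree at most `n`, in the basis `expBasis`. -/
def linPolyCoeff (n m : ℕ) (t : ℕ × ℕ) (z : ℍ) : ℂ :=
  ((z : ℂ) - conj (z : ℂ)) ^ (-(n : ℤ)) *
    ((-1) ^ (t.1 + t.2) * (m.choose t.1 * (n - m).choose t.2))

lemma expCoeff_linPoly_pow {n m : ℕ} (hm : m ≤ n) (i : ℕ) (a b : ℂ) (z : ℍ) :
    expCoeff n (linPoly a b ^ m) i z = ∑ t ∈ Finset.HasAntidiagonal.antidiagonal i,
      linPolyCoeff n m t z * ((a * z + b) ^ ((m : ℤ) - t.1) * (a * conj (z : ℂ) + b) ^ t.1) := by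
  rw [expCoeff, homSubst_linPoly_pow hm, Polynomial.coeff_mul, Finset.mul_sum]
  refine Finset.sum_congr rfl fun t _ => ?_
  rw [coeff_linPoly_pow, coeff_linPoly_pow, one_zpow, neg_pow, linPolyCoeff, pow_add]
  ring

lemma linPolyCoeff_mem_mixed (n m : ℕ) (t : ℕ × ℕ) : linPolyCoeff n m t ∈ mixed := by
  have heq : linPolyCoeff n m t = ((2 * Complex.I) ^ (-(n : ℤ)) *
      ((-1) ^ (t.1 + t.2) * (m.choose t.1 * (n - m).choose t.2))) • yPow (-n) := by
    funext z
    rw [linPolyCoeff, sub_conj_eq, mul_zpow, Pi.smul_apply, yPow, smul_eq_mul]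
    ring
  rw [heq]
  exact mixed.smul_mem (yPow_mem_mixed _) _

section

variable {k : ℕ} (f : CuspForm 𝒮ℒ (k : ℤ))

/-- The coefficient of `(c X + d) ^ m` in the period polynomial of a matrix with bottom row
`(c, d)`. The upper left entry of such a matrix enters only modulo `c`, as the inverse of `d`, so
that the formula makes sense for all `d` and depends only on `d` modulo `c`. -/
def periodCoeff (m : ℕ) (c : ℕ+) (d : ℤ) : ℂ :=
  (((c : ℕ) : ℂ) ^ (k - 2))⁻¹ * ∑ a ∈ Finset.range (k - 2 + 1), (expBasis (k - 2) a I).coeff m *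
    (seed f a (basePt c ((d : ZMod c)⁻¹.val : ℕ)) *
      (Complex.I ^ (-(a : ℤ)) * (-Complex.I) ^ (-(((k - 2 : ℕ) : ℤ) - a))) -
        seed f a (basePt c (-d)))

variable (hk : 2 ≤ k)
include hk

lemma seed_basePt_eq {a : ℕ} (ha : a ≤ k - 2) {c : ℕ+} {d d' : ℤ} (h : (d : ZMod c) = d') :
    seed f a (basePt c d) = seed f a (basePt c d') := by
  obtain ⟨l, hl⟩ := (ZMod.intCast_eq_intCast_iff_dvd_sub d d' c).1 h
  have hc := pnat_cast_ne_zero c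
  rw [← seed_vadd f hk ha l (basePt c d)]
  congr 1
  apply UpperHalfPlane.ext
  rw [coe_vadd, coe_basePt, coe_basePt, ← sub_add_cancel d' d, hl]
  push_cast
  field_simp
  ring

lemma periodCoeff_add_mul (m : ℕ) (c : ℕ+) (d l : ℤ) :
    periodCoeff f m c (l * (c : ℕ) + d) = periodCoeff f m c d := by
  have hcast : ((l * (c : ℕ) + d : ℤ) : ZMod c) = d := by simp
  rw [periodCoeff, periodCoeff, hcast]
  congr 1
  refine Finset.sum_congr rfl fun a ha => ?_
  rw [seed_basePt_eq f hk (Finset.mem_range_succ_iff.1 ha) (d := -(l * (c : ℕ) + d)) (d' := -d)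
    (by simp)]

lemma exists_periodCoeff_norm_le (m : ℕ) : ∃ C : ℝ, ∀ c d, ‖periodCoeff f m c d‖ ≤ C * (c : ℕ) := by
  obtain ⟨C, hC₀, hC⟩ := exists_seed_norm_le hk f
  set n := k - 2 with hn
  have hseed {a : ℕ} (ha : a ≤ n) (c : ℕ+) (b : ℤ) :
      ‖seed f a (basePt c b)‖ ≤ C * (((c : ℕ) : ℝ) ^ n * (c : ℕ)) := by
    refine (hC a ha _).trans (mul_le_mul_of_nonneg_left ?_ hC₀)
    have hc : (1 : ℝ) ≤ (c : ℕ) := by exact_mod_cast one_le (a := c)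
    rw [im_basePt, Real.inv_rpow (by positivity), ← Real.rpow_neg (by positivity), ← pow_succ,
      ← Real.rpow_natCast]
    refine Real.rpow_le_rpow_of_exponent_le hc ?_
    push_cast
    linarith
  refine ⟨∑ a ∈ Finset.range (n + 1), ‖(expBasis n a I).coeff m‖ * (2 * C), fun c d => ?_⟩
  have : 0 < ((c : ℕ) : ℝ) := by exact_mod_cast c.pos
  rw [periodCoeff, ← hn, norm_mul, norm_inv, norm_pow, Complex.norm_natCast,
    inv_mul_le_iff₀ (by positivity), Finset.sum_mul, Finset.mul_sum]
  refine norm_sum_le_of_le _ fun a ha => ?_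
  have ha' := Finset.mem_range_succ_iff.1 ha
  calc _ ≤ ‖(expBasis n a I).coeff m‖ *
        (C * (((c : ℕ) : ℝ) ^ n * (c : ℕ)) + C * (((c : ℕ) : ℝ) ^ n * (c : ℕ))) := by
        rw [norm_mul]
        refine mul_le_mul_of_nonneg_left (norm_sub_le_of_le ?_ (hseed ha' c _)) (norm_nonneg _)
        simpa using hseed ha' c _
    _ = _ := by ring

variable {γ : SL(2, ℤ)} {c : ℕ+} {d : ℤ} (hc : γ 1 0 = ((c : ℕ) : ℤ)) (hd : γ 1 1 = d)
include hc hd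

lemma seed_smul_basePt {a : ℕ} (ha : a ≤ k - 2) :
    seed f a (γ • basePt c (-d)) = seed f a (basePt c ((d : ZMod c)⁻¹.val : ℕ)) := by
  have hdet : (d : ZMod c) * (γ 0 0 : ℤ) = 1 := by
    have hdet := γ.det_coe
    rw [Matrix.det_fin_two, hc, hd] at hdet
    simpa [mul_comm] using congrArg (Int.cast : ℤ → ZMod c) hdet
  rw [smul_basePt hc hd]
  refine seed_basePt_eq f hk ha ?_
  rw [Int.cast_natCast, ZMod.natCast_zmod_val, ZMod.inv_eq_of_mul_eq_one _ _ _ hdet]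

lemma periodPoly_eq_sum_linPoly (z : ℍ) : periodPoly f γ z = ∑ m ∈ Finset.range (k - 2 + 1),
    Polynomial.C (periodCoeff f m c d) * linPoly (c : ℕ) d ^ m := by
  rw [periodPoly_eq_periodPoly f hk γ z (basePt c (-d)), periodPoly_eq_sum_expBasis f hk]
  simp only [periodCoeff, Finset.mul_sum, map_sum, Finset.sum_mul]
  rw [Finset.sum_comm]
  refine Finset.sum_congr rfl fun a ha => ?_
  have ha' := Finset.mem_range_succ_iff.1 ha
  rw [expBasis_basePt ha', poincareTerm, seed_smul_basePt f hk hc hd ha', autj_conj,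
    autj_basePt hc hd, Complex.conj_I, Finset.mul_sum]
  refine Finset.sum_congr rfl fun m _ => ?_
  simp only [map_mul]
  ring

end

/-! ### Series over coprime pairs -/

lemma pairTerm_eq_autj (κ : ℕ+ → ℤ → ℂ) (r s : ℤ) {γ : SL(2, ℤ)} {c : ℕ+} {d : ℤ}
    (hc : γ 1 0 = ((c : ℕ) : ℤ)) (hd : γ 1 1 = d) (z : ℍ) : pairTerm κ r s z (c, d) =
      κ c d * (autj γ z ^ (-r) * autj γ (conj (z : ℂ)) ^ (-s)) := by
  simp only [pairTerm, autj, hc, hd, Int.cast_natCast]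

/-- The double series of `pairTerm`, restricted to coprime pairs. -/
def coprimeSeries (κ : ℕ+ → ℤ → ℂ) (r s : ℤ) (z : ℍ) : ℂ :=
  ∑' p : coprimePairs, pairTerm κ r s z p

lemma add_mul_mem_coprimePairs (c : ℕ+) (d l : ℤ) :
    (c, l * (c : ℕ) + d) ∈ coprimePairs ↔ (c, d) ∈ coprimePairs := by
  rw [add_comm]
  exact IsCoprime.add_mul_right_right_iff

lemma coprimeSeries_mem_pureMixed {κ : ℕ+ → ℤ → ℂ}
    (hκ : ∀ (c : ℕ+) (d l : ℤ), κ c (l * (c : ℕ) + d) = κ c d) {C : ℝ}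
    (hC : ∀ c d, ‖κ c d‖ ≤ C * (c : ℕ)) {r s : ℤ} (h : 4 ≤ r + s) :
    coprimeSeries κ r s ∈ pureMixed := by
  classical
  let κ' : ℕ+ → ℤ → ℂ := fun c d => coprimePairs.indicator (fun p => κ p.1 p.2) (c, d)
  have hκ' (c : ℕ+) (d l : ℤ) : κ' c (l * (c : ℕ) + d) = κ' c d := by
    simp only [κ', Set.indicator_apply, add_mul_mem_coprimePairs, hκ]
  have hC' (c : ℕ+) (d : ℤ) : ‖κ' c d‖ ≤ C * (c : ℕ) :=
    (norm_indicator_le_norm_self _ _).trans (hC c d)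
  convert tsum_pairTerm_mem hκ' hC' h using 2 with z
  rw [coprimeSeries, tsum_subtype coprimePairs (pairTerm κ r s z)]
  refine tsum_congr fun p => ?_
  simp only [pairTerm, κ', Prod.mk.eta, Set.indicator_apply, ite_mul, zero_mul]

lemma poincareTerm_add (Φ : ℍ → ℂ) (R S r s : ℤ) (γ : SL(2, ℤ)) (z : ℍ) :
    poincareTerm Φ (r + R) (s + S) γ z =
      autj γ z ^ (-r) * autj γ (conj (z : ℂ)) ^ (-s) * poincareTerm Φ R S γ z := by
  rw [poincareTerm, poincareTerm, neg_add, neg_add, zpow_add₀ (autj_ne_zero γ z),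
    zpow_add₀ (autj_conj_ne_zero γ z)]
  ring

lemma expCoeff_sum {ι : Type*} {n : ℕ} (t : Finset ι) (b : ι → ℂ) {P : ι → Polynomial ℂ}
    (hP : ∀ m ∈ t, (P m).natDegree ≤ n) {i : ℕ} (hi : i ≤ n) (z : ℍ) :
    expCoeff n (∑ m ∈ t, Polynomial.C (b m) * P m) i z = ∑ m ∈ t, b m * expCoeff n (P m) i z := by
  refine expCoeff_eq_of_eq_sum (fun i => ∑ m ∈ t, b m * expCoeff n (P m) i z) ?_ hi
  simp only [map_sum, Finset.sum_mul]
  rw [Finset.sum_comm]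
  refine Finset.sum_congr rfl fun m hm => ?_
  conv_lhs => rw [eq_sum_expBasis (hP m hm) z, Finset.mul_sum]
  simp only [map_mul, mul_assoc]

/-! ### The series `φ^±` -/

lemma norm_one_apply_le (c : ℕ+) (d : ℤ) : ‖(1 : ℕ+ → ℤ → ℂ) c d‖ ≤ 1 * ((c : ℕ) : ℝ) := by
  simpa using Nat.one_le_cast (α := ℝ) |>.2 c.pos

section

variable {k : ℕ} (f : CuspForm 𝒮ℒ (k : ℤ)) (hk : 2 ≤ k)
include hk

lemma expCoeff_periodPoly {i : ℕ} (hi : i ≤ k - 2) {γ : SL(2, ℤ)} {c : ℕ+} {d : ℤ}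
    (hc : γ 1 0 = ((c : ℕ) : ℤ)) (hd : γ 1 1 = d) (z : ℍ) :
    expCoeff (k - 2) (periodPoly f γ z) i z = ∑ m ∈ Finset.range (k - 2 + 1),
      ∑ t ∈ Finset.HasAntidiagonal.antidiagonal i, linPolyCoeff (k - 2) m t z *
        (periodCoeff f m c d * (autj γ z ^ ((m : ℤ) - t.1) * autj γ (conj (z : ℂ)) ^ t.1)) := by
  have hm {m : ℕ} (hm : m ∈ Finset.range (k - 2 + 1)) := Finset.mem_range_succ_iff.1 hm
  rw [periodPoly_eq_sum_linPoly f hk hc hd, expCoeff_sum _ (fun m => periodCoeff f m c d)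
    (fun m hmem => linPoly_pow_natDegree_le (hm hmem) _ _) hi]
  refine Finset.sum_congr rfl fun m hmem => ?_
  rw [expCoeff_linPoly_pow (hm hmem), Finset.mul_sum]
  refine Finset.sum_congr rfl fun t _ => ?_
  simp only [autj, hc, hd, Int.cast_natCast]
  ring

variable {r s : ℤ} {i : ℕ} (hi : i ≤ k - 2)
include hi

lemma poincareTerm_seed_rowLift (p : coprimePairs) (z : ℍ) :
    poincareTerm (seed f i) (r + i) (s + (k - 2 : ℕ) - i) (rowLift p) z =
      seed f i z * pairTerm 1 r s z p + ∑ m ∈ Finset.range (k - 2 + 1),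
        ∑ t ∈ Finset.HasAntidiagonal.antidiagonal i, linPolyCoeff (k - 2) m t z *
          pairTerm (periodCoeff f m) (r - m + t.1) (s - t.1) z p := by
  obtain ⟨⟨c, d⟩, hp⟩ := p
  have hc := rowLift_one_zero ⟨(c, d), hp⟩
  have hd := rowLift_one_one ⟨(c, d), hp⟩
  rw [add_sub_assoc, poincareTerm_add, poincareTerm_seed_eq f hk _ z hi,
    expCoeff_periodPoly f hk hi hc hd, pairTerm_eq_autj _ _ _ hc hd, mul_add, Finset.mul_sum]
  congr 1
  · simp only [Pi.one_apply]
    ring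
  refine Finset.sum_congr rfl fun m _ => ?_
  rw [Finset.mul_sum]
  refine Finset.sum_congr rfl fun t _ => ?_
  rw [pairTerm_eq_autj _ _ _ hc hd, show -(r - (m : ℤ) + t.1) = -r + ((m : ℤ) - t.1) by ring,
    show -(s - (t.1 : ℤ)) = -s + t.1 by ring, zpow_add₀ (autj_ne_zero _ z),
    zpow_add₀ (autj_conj_ne_zero _ z), zpow_natCast]
  ring

variable (h : ((k - 2 : ℕ) : ℤ) + 4 ≤ r + s)
include h

lemma tsum_poincareTerm_seed_rowLift (z : ℍ) :
    ∑' p : coprimePairs, poincareTerm (seed f i) (r + i) (s + (k - 2 : ℕ) - i) (rowLift p) z =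
      seed f i z * coprimeSeries 1 r s z + ∑ m ∈ Finset.range (k - 2 + 1),
        ∑ t ∈ Finset.HasAntidiagonal.antidiagonal i, linPolyCoeff (k - 2) m t z *
          coprimeSeries (periodCoeff f m) (r - m + t.1) (s - t.1) z := by
  have hone : Summable fun p : coprimePairs => pairTerm 1 r s z p :=
    (summable_pairTerm norm_one_apply_le (by lia) z).subtype _
  have hperiod {m : ℕ} (hm : m ∈ Finset.range (k - 2 + 1)) (t : ℕ × ℕ) :
      Summable fun p : coprimePairs => linPolyCoeff (k - 2) m t z *
        pairTerm (periodCoeff f m) (r - m + t.1) (s - t.1) z p := by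
    obtain ⟨C, hC⟩ := exists_periodCoeff_norm_le f hk m
    have := Finset.mem_range.1 hm
    exact ((summable_pairTerm hC (by lia) z).subtype _).mul_left _
  simp only [poincareTerm_seed_rowLift f hk hi]
  rw [(hone.mul_left _).tsum_add (summable_sum fun m hm => summable_sum fun t _ => hperiod hm t),
    tsum_mul_left, Summable.tsum_finsetSum fun m hm => summable_sum fun t _ => hperiod hm t]
  congr 1
  refine Finset.sum_congr rfl fun m hm => ?_
  rw [Summable.tsum_finsetSum fun t _ => hperiod hm t]
  simp only [tsum_mul_left, coprimeSeries]

lemma tsum_poincareTerm_seed_rowLift_mem_mixed : (fun z => ∑' p : coprimePairs,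
    poincareTerm (seed f i) (r + i) (s + (k - 2 : ℕ) - i) (rowLift p) z) ∈ mixed := by
  have hone : coprimeSeries 1 r s ∈ mixed := mem_mixed_of_mem_pureMixed <|
    coprimeSeries_mem_pureMixed (fun _ _ _ => rfl) norm_one_apply_le (by lia)
  have hperiod {m : ℕ} (hm : m ∈ Finset.range (k - 2 + 1)) (t : ℕ × ℕ) :
      coprimeSeries (periodCoeff f m) (r - m + t.1) (s - t.1) ∈ mixed := by
    obtain ⟨C, hC⟩ := exists_periodCoeff_norm_le f hk m
    have := Finset.mem_range.1 hm
    exact mem_mixed_of_mem_pureMixed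
      (coprimeSeries_mem_pureMixed (periodCoeff_add_mul f hk m) hC (by lia))
  convert mixed.add_mem (mixed.mul_mem (seed_mem_mixed f hk hi) hone)
    (mixed.sum_mem fun m hm => mixed.sum_mem
      fun t (_ : t ∈ Finset.HasAntidiagonal.antidiagonal i) =>
        mixed.mul_mem (linPolyCoeff_mem_mixed (k - 2) m t) (hperiod hm t)) using 1
  funext z
  simp only [tsum_poincareTerm_seed_rowLift f hk hi h, Pi.add_apply, Pi.mul_apply,
    Finset.sum_apply]

lemma phiCoeff_eichlerPlus_mem_realAnForms (hke : Even k) (hrs : Even (r + s)) :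
    phiCoeff k r s (eichlerPlus f) i ∈ realAnForms (r + i) (s + (k - 2 : ℕ) - i) := by
  obtain ⟨C, -, hC⟩ := exists_seed_norm_le hk f
  have hexp : (2 * (k - 2 : ℕ) + 1 : ℤ) + 3 ≤ r + s + (k - 2 : ℕ) := by linarith
  have heven : Even ((r + (i : ℤ)) + (s + (k - 2 : ℕ) - i)) := by
    rw [show (r + (i : ℤ)) + (s + (k - 2 : ℕ) - i) = (r + s) + ((k - 2 : ℕ) : ℤ) by ring]
    exact hrs.add (by exact_mod_cast hke.tsub even_two)
  have hvadd := seed_vadd f hk hi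
  rw [phiCoeff_eq_poincare hC hexp (eichlerPlus_natDegree_le f hk) hk hi]
  refine mem_realAnForms_of_mem_mixed ?_ (poincare_hasWeight hvadd heven)
  convert mixed.add_mem (seed_mem_mixed f hk hi)
    (tsum_poincareTerm_seed_rowLift_mem_mixed f hk (r := r) (s := s) hi h) using 1
  funext z
  exact poincare_eq_add_tsum hvadd heven z (summable_poincareTerm_expCoeff hC hexp hi z)

end

section

variable {k : ℕ} (f : CuspForm 𝒮ℒ (k : ℤ)) (hk : 2 ≤ k)
include hk

lemma eichlerMinus_natDegree_le (z : ℍ) : (eichlerMinus f z).natDegree ≤ k - 2 :=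
  Polynomial.natDegree_map_le.trans (eichlerPlus_natDegree_le f hk z)

lemma expCoeff_eichlerMinus {i : ℕ} (hi : i ≤ k - 2) (z : ℍ) :
    expCoeff (k - 2) (eichlerMinus f z) i z = conj (seed f (k - 2 - i) z) :=
  expCoeff_map_conj (eichlerPlus_natDegree_le f hk z) z hi

lemma exists_expCoeff_eichler_norm_le : ∃ C, ∀ i ≤ k - 2, ∀ z : ℍ,
    ‖expCoeff (k - 2) (eichlerPlus f z) i z‖ ≤ C * z.im ^ (-((2 * (k - 2 : ℕ) + 1 : ℤ) : ℝ) / 2) ∧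
    ‖expCoeff (k - 2) (eichlerMinus f z) i z‖ ≤
      C * z.im ^ (-((2 * (k - 2 : ℕ) + 1 : ℤ) : ℝ) / 2) := by
  obtain ⟨C, -, hC⟩ := exists_seed_norm_le hk f
  refine ⟨C, fun i hi z => ⟨hC i hi z, ?_⟩⟩
  rw [expCoeff_eichlerMinus f hk hi, RCLike.norm_conj]
  exact hC _ (Nat.sub_le _ _) z

variable {r s : ℤ} (h : ((k - 2 : ℕ) : ℤ) + 4 ≤ r + s)
include h

lemma summable_coeff_slash_eichlerPlus (z : ℍ) (m : ℕ) :
    Summable fun γ : CosetB => (slash k r s (eichlerPlus f) γ.out z).coeff m := by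
  obtain ⟨C, hC⟩ := exists_expCoeff_eichler_norm_le f hk
  exact summable_coeff_slash (fun i hi z => (hC i hi z).1) (by linarith)
    (eichlerPlus_natDegree_le f hk) z m

lemma summable_coeff_slash_eichlerMinus (z : ℍ) (m : ℕ) :
    Summable fun γ : CosetB => (slash k r s (eichlerMinus f) γ.out z).coeff m := by
  obtain ⟨C, hC⟩ := exists_expCoeff_eichler_norm_le f hk
  exact summable_coeff_slash (fun i hi z => (hC i hi z).2) (by linarith)
    (eichlerMinus_natDegree_le f hk) z m

lemma phiCoeff_eichlerMinus {i : ℕ} (hi : i ≤ k - 2) :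
    phiCoeff k r s (eichlerMinus f) i = star (phiCoeff k s r (eichlerPlus f) (k - 2 - i)) := by
  obtain ⟨C, hC⟩ := exists_expCoeff_eichler_norm_le f hk
  rw [phiCoeff_eq_poincare (fun i hi z => (hC i hi z).2) (by linarith)
      (eichlerMinus_natDegree_le f hk) hk hi,
    phiCoeff_eq_poincare (fun i hi z => (hC i hi z).1) (by linarith)
      (eichlerPlus_natDegree_le f hk) hk (Nat.sub_le _ _)]
  simp only [expCoeff_eichlerMinus f hk hi]
  refine (poincare_conj _ _ _).trans ?_
  rw [show s + ((k - 2 : ℕ) : ℤ) - i = s + ((k - 2 - i : ℕ) : ℤ) by lia,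
    show r + (i : ℤ) = r + (k - 2 : ℕ) - ((k - 2 - i : ℕ) : ℤ) by lia]
  rfl

lemma phiCoeff_eichlerMinus_mem_realAnForms {i : ℕ} (hi : i ≤ k - 2) (hke : Even k)
    (hrs : Even (r + s)) :
    phiCoeff k r s (eichlerMinus f) i ∈ realAnForms (r + i) (s + (k - 2 : ℕ) - i) := by
  rw [phiCoeff_eichlerMinus f hk h hi,
    show s + ((k - 2 : ℕ) : ℤ) - i = s + ((k - 2 - i : ℕ) : ℤ) by lia,
    show r + (i : ℤ) = r + (k - 2 : ℕ) - ((k - 2 - i : ℕ) : ℤ) by lia]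
  exact star_mem_realAnForms (phiCoeff_eichlerPlus_mem_realAnForms f hk (Nat.sub_le _ _)
    (by linarith) hke (by rwa [add_comm]))

end

lemma sub_two_add_four_le {k : ℕ} {n : ℤ} (hk : 2 ≤ k) (hke : Even k) (hn : Even n)
    (h : (k : ℤ) < n) : ((k - 2 : ℕ) : ℤ) + 4 ≤ n := by
  obtain ⟨a, rfl⟩ := hke
  obtain ⟨b, rfl⟩ := hn
  lia

lemma spaceA_le_gradedM : spaceA ≤ gradedM := by
  refine Submodule.span_le.2 ?_
  rintro _ ⟨k, hk, hke, f, r, s, hrs, h, i, hi, F, hF, rfl⟩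
  have hk₂ : 2 ≤ k := by lia
  have h₄ := sub_two_add_four_le hk₂ hke hrs h
  rw [show s + (k : ℤ) - 2 - i = s + ((k - 2 : ℕ) : ℤ) - i by lia]
  refine single_mem_gradedM ?_
  rcases hF with rfl | rfl
  · exact phiCoeff_eichlerPlus_mem_realAnForms f hk₂ hi h₄ hke hrs
  · exact phiCoeff_eichlerMinus_mem_realAnForms f hk₂ h₄ hi hke hrs

end ModIter

end

theorem mainTheorem2 :
    (∀ (k : ℕ), 12 ≤ k → Even k → ∀ (f : CuspForm 𝒮ℒ (k : ℤ)) (r s : ℤ),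
      Even (r + s) → (k : ℤ) < r + s → ∀ (z : ℍ) (m : ℕ),
        Summable (fun γ : ModIter.CosetB =>
          (ModIter.slash k r s (ModIter.eichlerPlus f) γ.out z).coeff m) ∧
        Summable (fun γ : ModIter.CosetB =>
          (ModIter.slash k r s (ModIter.eichlerMinus f) γ.out z).coeff m)) ∧
    ModIter.spaceA ≤ ModIter.extMI := by
  refine ⟨fun k hk hke f r s hrs h z m => ?_, ModIter.extMI_eq_gradedM ▸ ModIter.spaceA_le_gradedM⟩
  have hk₂ : 2 ≤ k := by lia
  have h₄ := ModIter.sub_two_add_four_le hk₂ hke hrs h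
  exact ⟨ModIter.summable_coeff_slash_eichlerPlus f hk₂ h₄ z m,
    ModIter.summable_coeff_slash_eichlerMinus f hk₂ h₄ z m⟩
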